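/- Let $(M,d)$ be a proper metric space and let $\mu$ be a ($\sigma$-finite) locally finite Borel measure on $M$. Let $p\in(1,2)\cup(2,3)$ and $\frac1p+\frac1q=1$. *The $q$-heat flow.* For $f:M\to\mathbb R$ let $|Df|(x)=\limsup_{y\to x}|f(y)-f(x)|/d(y,x)$. A function $g\in L^q(\mu)$ is a $q$-relaxed slope of $f\in L^2(\mu)$ if there are Lipschitz functions $f_n\in L^2(\mu)$ with $f_n\to f$ in $L^2(\mu)$ such that $|Df_n|$ converges weakly in $L^q(\mu)$ to some $\tilde g\in L^q(\mu)$ with $\tilde g\le g$ a.e. Let $|\nabla f|_*$ be the $q$-relaxed slope of minimal $L^q$-norm, and let $\operatorname{Ch}_q(f)=\frac1q\int|\nabla f|_*^q\,d\mu$ ($=\infty$ if $f$ has no $q$-relaxed slope). The $q$-heat flow $f_t=H_t(f_0)$ from $f_0\in L^2(\mu)$ is the gradient flow of $\operatorname{Ch}_q$ in $L^2(\mu)$: $t\mapsto f_t\in L^2(\mu)$ is locally Lipschitz on $(0,\infty)$, $f_t\to f_0$ in $L^2(\mu)$ as $t\to0$, and $\frac{d}{dt}f_t\in-\partial^-\operatorname{Ch}_q(f_t)$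 for a.e. $t>0$, where $\ell\in\partial^-\operatorname{Ch}_q(f)$ means $\operatorname{Ch}_q(f)<\infty$ and $\int\ell(g-f)\,d\mu\le\operatorname{Ch}_q(g)-\operatorname{Ch}_q(f)$ for all $g\in L^2(\mu)$. *Hypotheses.* Let $\exp_p(t)=(1+(2-p)t)^{1/(2-p)}$, and let $V:M\to[\varepsilon,\infty)$, $\varepsilon>0$, be Lipschitz such that * if $p\in(2,3)$: $\int\exp_p(-V^p)\,d\mu\le1$ and $\int V^p\exp_p(-V^p)\,d\mu<\infty$; * if $p\in(1,2)$: there is an increasing (i.e. nondecreasing) $\Phi:\mathbb R\to[0,\infty]$ with $\int\Phi(-V^p)\,d\mu\le1$. *Conclusions.* (a) (Mass preservation) If $f_0\in L^1(\mu)\cap L^2(\mu)$ and $f_t=H_t(f_0)$, then for every $t\ge0$, $f_t\in L^1(\mu)$ and $\int f_t\,d\mu=\int f_0\,d\mu$. (b) (Moment and entropy bounds) Let $f_0\in L^1(\mu)\cap L^2(\mu)$ be nonnegative with $\int V^pf_0\,d\mu<\infty$, and let $f_t=H_t(f_0)$. Then $f_0^{3-p}\in L^1(\mu)$. Let moreover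 $L\ge0$ be a Lipschitz constant of $V$ (in particular $L=\operatorname{Lip}(V)$) and let $z>0$ satisfy $z\int\exp_p(-V^p)\,d\mu\le\int f_0\,d\mu$ if $p\in(2,3)$, and $z\le1$ if $p\in(1,2)$. Then for every $t\ge0$ $$\int V^pf_t\,d\mu\le S_t\qquad\text{and}\qquad\int_0^t\int_{\{f_s>0\}}\frac{|\nabla f_s|_*^q}{f_s^{p-1}}\,d\mu\,ds\le\frac{4}{3-p}S_t,$$ where $$S_t=e^{C_pL^qt}\left(I_p+\int\Big[\tfrac1{2-p}\big(f_0^{3-p}-f_0\big)+\big(pV^p+z^{-1}l_p\big)f_0\Big]d\mu\right),\qquad l_p=\max\{\tfrac1{2-p},1\},$$ $I_p=0$ if $p\in(1,2)$, $I_p=\frac{p-2}{3-p}\int V^p\exp_p(-V^p)\,d\mu$ if $p\in(2,3)$, and $$C_p=\frac1q\Big(\frac p{3-p}\Big)^q\ \text{ if }p\in(1,2),\qquad C_p=\max\Big\{\frac1q\Big(\frac p{3-p}\Big)^q,\ \frac{p^{q+1}}{q\,(3-p)^{q-1}(2p-3)}\Big\}\ \text{ if }p\in(2,3).$$ -/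

import Mathlib

open MeasureTheory Filter Set Topology
open scoped ENNReal NNReal

noncomputable section

namespace QHeat

section Slopes

variable {X : Type*} [MetricSpace X] [MeasurableSpace X]

/-- The local Lipschitz constant `|Df|(x) = limsup_{y → x} |f y - f x| / d(y, x)`
(equal to `0` at an isolated point). -/
def localLip (f : X → ℝ) (x : X) : ℝ≥0∞ :=
  limsup (fun y => edist (f y) (f x) / edist y x) (𝓝[≠] x)

/-- Weak convergence `G n ⇀ g` in `L^q(μ)`, tested against `L^{q'}(μ)`, with `q'` the conjugate
exponent of `q`. -/
def TendstoWeakly (q : ℝ) (μ : Measure X) (G : ℕ → X → ℝ) (g : X → ℝ) : Prop :=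
  (∀ n, MemLp (G n) (ENNReal.ofReal q) μ) ∧ MemLp g (ENNReal.ofReal q) μ ∧
    ∀ h : X → ℝ, MemLp h (ENNReal.ofReal q.conjExponent) μ →
      Tendsto (fun n => ∫ x, G n x * h x ∂μ) atTop (𝓝 (∫ x, g x * h x ∂μ))

/-- `g ∈ L^q` is a `q`-relaxed slope of `f ∈ L²`: there are Lipschitz functions `F n ∈ L²`,
`F n → f` strongly in `L²`, whose local Lipschitz constants converge weakly in `L^q` to some `G`
with `G ≤ g` almost everywhere. -/
def IsRelaxedSlope (q : ℝ) (μ : Measure X) (f : Lp ℝ 2 μ) (g : X → ℝ) : Prop :=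
  MemLp g (ENNReal.ofReal q) μ ∧
    ∃ (F : ℕ → X → ℝ) (G : X → ℝ),
      (∀ n, ∃ K : ℝ≥0, LipschitzWith K (F n)) ∧
      (∀ n, MemLp (F n) 2 μ) ∧
      Tendsto (fun n => eLpNorm (fun x => F n x - f x) 2 μ) atTop (𝓝 0) ∧
      TendstoWeakly q μ (fun n x => (localLip (F n) x).toReal) G ∧
      G ≤ᵐ[μ] g

/-- `g` has minimal `L^q`-norm among all `q`-relaxed slopes of `f`. -/
def IsMinimalRelaxedSlope (q : ℝ) (μ : Measure X) (f : Lp ℝ 2 μ) (g : X → ℝ) : Prop :=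
  IsRelaxedSlope q μ f g ∧
    ∀ g' : X → ℝ, IsRelaxedSlope q μ f g' →
      eLpNorm g (ENNReal.ofReal q) μ ≤ eLpNorm g' (ENNReal.ofReal q) μ

open Classical in
/-- The minimal relaxed slope `|∇f|_*` (determined up to null sets); it is set to `∞`
if `f` has none. -/
def relaxedSlope (q : ℝ) (μ : Measure X) (f : Lp ℝ 2 μ) : X → ℝ≥0∞ :=
  if h : ∃ g : X → ℝ, IsMinimalRelaxedSlope q μ f g then
    fun x => ENNReal.ofReal (h.choose x)
  else fun _ => ∞

/-- The `q`-Cheeger energy `Ch_q(f) = (1/q) ∫ |∇f|_*^q dμ`. -/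
def cheeger (q : ℝ) (μ : Measure X) (f : Lp ℝ 2 μ) : ℝ≥0∞ :=
  ENNReal.ofReal (1 / q) * ∫⁻ x, relaxedSlope q μ f x ^ q ∂μ

/-- `ℓ` belongs to the subdifferential of `Ch_q` at `f`: `f` has finite energy and
`∫ ℓ (g - f) dμ ≤ Ch_q(g) - Ch_q(f)` for all `g ∈ L²` (which is no condition if
`Ch_q(g) = ∞`). -/
def IsSubgradient (q : ℝ) (μ : Measure X) (f ℓ : Lp ℝ 2 μ) : Prop :=
  cheeger q μ f ≠ ∞ ∧
    ∀ g : Lp ℝ 2 μ, cheeger q μ g ≠ ∞ →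
      inner ℝ ℓ (g - f) ≤ (cheeger q μ g).toReal - (cheeger q μ f).toReal

/-- `t ↦ f t`, `t ≥ 0`, is the `q`-heat flow started at `f 0`, that is, the gradient flow of `Ch_q`
in `L²(μ)`: it is locally Lipschitz on `(0, ∞)`, `f t → f 0` as `t → 0`, and
`d/dt f t ∈ -∂Ch_q(f t)` for almost every `t > 0`. -/
structure IsHeatFlow (q : ℝ) (μ : Measure X) (f : ℝ → Lp ℝ 2 μ) : Prop where
  locallyLipschitz : LocallyLipschitzOn (Ioi 0) f
  tendsto_zero : Tendsto f (𝓝[>] 0) (𝓝 (f 0))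
  deriv_mem : ∀ᵐ t ∂(volume.restrict (Ioi (0 : ℝ))),
    ∃ f' : Lp ℝ 2 μ, HasDerivAt f f' t ∧ IsSubgradient q μ (f t) (-f')

/-- `∫_{f > 0} |∇f|_*^q / f^{p-1} dμ`. -/
def fisher (p q : ℝ) (μ : Measure X) (f : Lp ℝ 2 μ) : ℝ≥0∞ :=
  ∫⁻ x in {x | 0 < f x}, relaxedSlope q μ f x ^ q / ENNReal.ofReal (f x ^ (p - 1)) ∂μ

end Slopes

/-- The generalized exponential `exp_p(t) = (1 + (2 - p) t)^{1/(2-p)}`. -/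
def pexp (p t : ℝ) : ℝ := (1 + (2 - p) * t) ^ (1 / (2 - p))

/-- The exponential rate `C_p`. -/
def rateConst (p q : ℝ) : ℝ :=
  if p < 2 then (p / (3 - p)) ^ q / q
  else max ((p / (3 - p)) ^ q / q) (p ^ (q + 1) / (q * (3 - p) ^ (q - 1) * (2 * p - 3)))

/-- `I_p`. -/
def momentI {X : Type*} [MeasurableSpace X] (p : ℝ) (μ : Measure X) (V : X → ℝ) : ℝ :=
  if p < 2 then 0 else (p - 2) / (3 - p) * ∫ x, V x ^ p * pexp p (-(V x ^ p)) ∂μ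

/-- The bound
`S_t = e^{C_p L^q t} (I_p + ∫ (f₀^{3-p} - f₀)/(2-p) + (p V^p + l_p / z) f₀ dμ)`,
with `l_p = max {1/(2-p), 1}`. -/
def momentBound {X : Type*} [MeasurableSpace X] (p q : ℝ) (μ : Measure X) (V : X → ℝ)
    (L z : ℝ) (f₀ : X → ℝ) (t : ℝ) : ℝ :=
  Real.exp (rateConst p q * L ^ q * t) *
    (momentI p μ V +
      ∫ x, (1 / (2 - p) * (f₀ x ^ (3 - p) - f₀ x) +
        (p * V x ^ p + z⁻¹ * max (1 / (2 - p)) 1) * f₀ x) ∂μ)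

end QHeat

end

/-!
# Mass preservation and entropy bounds for the `q`-heat flow

**The mechanism.** Let `f` solve the flow. Every fact about it comes from testing the
subdifferential inequality of `Ch_q` at `f t` with perturbations `f t - τ • h`, where
`h = c * entropyDeriv b w (f t) + u`, the shift `w > 0` and the function `u` are Lipschitz, and
`entropyDeriv b w` has derivative `(|r| + w) ^ (-b)`. For small `τ` the map `F ↦ F - τ h(F)` is
increasing in `F`, so it lowers the slope of a Lipschitz function pointwise, up to the slopes of
`w` and `u` (`lipSlope_perturb_le`). No linearity of the gradient is used: the first variation of
`∫ G ^ q` turns this chain rule into the formal integration by parts as an inequality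
(`IsTestData.inner_testFun_le`), hence into a differential inequality for
`∫ c * entropy b w f + u * f` along the flow (`IsTestData.ae_hasDerivAt`). With
`g = |∇f|_*`, its right-hand side `∫ g ^ (q - 1) * B - c * g ^ q * (|f| + w) ^ (-b)` contains the
slopes of `w` and `u` in `B`; Young's inequality absorbs the first term into the second
(`IsTestData.ae_hasDerivAt_le`).

Two facts of Cheeger theory make this rigorous. A function of finite energy is the `L²`-limit of
Lipschitz functions whose slopes converge *strongly* in `L^q` to the minimal relaxed slope
(`exists_isSlopeApprox_of_cheeger_ne_top`), and any such approximation bounds the energy from above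
(`cheeger_le_of_tendsto`). Both follow from the convexity of the local Lipschitz constant and the
uniform convexity of `L^q`, which also shows that the minimal relaxed slope is unique.

**Mass.** With `b = 3 / 2`, `u = 0` and `w → 0` the `L¹`-norm does not increase
(`IsHeatFlow.integral_abs_le`). With `u = ±cutoff` and `b < 1` the mass in a ball of radius `R`
changes by at most a constant times `R ^ (-q) * ∫ (|f| + w) ^ (b * (q - 1))` over the double ball.
For `p < 2` the choice `b = p - 1` makes this exponent `1`. For `p > 2` the choice
`b = (3 - p) * (p - 1)` makes it `3 - p`, and the power is controlled by the integrable function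
`V ^ p * pexp p (-V ^ p)` at the cost of a power of `R` smaller than `q`
(`IsHeatFlow.integral_eq`). Since the mass is preserved and the `L¹`-norm does not increase, the
flow preserves nonnegativity (`IsHeatFlow.nonneg`).

**Moments and entropy.** Here `b = p - 1`, so that `b * (q - 1) = 1`, and `u` is a multiple `β` of
the `p`-th power of a compactly supported truncation of `V`. For `p < 2` the entropy is nonnegative,
and Grönwall's inequality with `β = p * (3 - p) ^ (1 - p)` gives the bound with the right constant
(`IsHeatFlow.integral_rpow_mul_le_of_lt_two`). For `p > 2` the limit of the entropies has the wrong
sign. A first estimate, for the entropy relative to the finite measure `pexp p (-V ^ p) μ`, shows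
that the moment is finite (`IsHeatFlow.exists_integral_rpow_mul_le`). Then `β = p` is used: the
terms linear in `f`, which diverge as `w → 0`, cancel by mass preservation
(`IsHeatFlow.moment_sub_le`), Young's inequality with `pexp p (-V ^ p)` absorbs `∫ f ^ (3 - p)` into
the moment (`rpow_le_of_pexp`), and the integral form of Grönwall's inequality applies. The bound on
`∫∫ |∇f|_* ^ q / f ^ (p - 1)` is the dissipation of the entropies with `u = 0`, in the limit `w → 0`
(`IsHeatFlow.lintegral_fisher_le`).
-/

open MeasureTheory Filter Set Topology
open scoped ENNReal NNReal

noncomputable section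

namespace QHeat

/-! ### The local Lipschitz constant -/

section LipSlope

variable {X : Type*} [MetricSpace X]

/-- The local Lipschitz constant as a real number; it carries the junk value `0` where
`localLip` is infinite, which does not happen for Lipschitz functions. -/
def lipSlope (f : X → ℝ) (x : X) : ℝ := (localLip f x).toReal

theorem lipSlope_nonneg (f : X → ℝ) (x : X) : 0 ≤ lipSlope f x := ENNReal.toReal_nonneg

theorem localLip_le_of_eventually {f : X → ℝ} {x : X} {c : ℝ} (hc : 0 ≤ c)
    (h : ∀ ε > 0, ∀ᶠ y in 𝓝 x, |f y - f x| ≤ (c + ε) * dist y x) :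
    localLip f x ≤ ENNReal.ofReal c := by
  refine ENNReal.le_of_forall_pos_le_add fun ε hε _ => ?_
  have hε' : (0 : ℝ) < ε := hε
  rw [show ENNReal.ofReal c + (ε : ℝ≥0∞) = ENNReal.ofReal (c + ε) by
    rw [ENNReal.ofReal_add hc hε'.le, ENNReal.ofReal_coe_nnreal]]
  refine limsup_le_of_le (by isBoundedDefault) ?_
  filter_upwards [nhdsWithin_le_nhds (h ε hε')] with y hy
  refine ENNReal.div_le_of_le_mul ?_
  rw [edist_dist, edist_dist, ← ENNReal.ofReal_mul (by positivity), Real.dist_eq]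
  exact ENNReal.ofReal_le_ofReal hy

theorem lipSlope_le_of_eventually {f : X → ℝ} {x : X} {c : ℝ} (hc : 0 ≤ c)
    (h : ∀ ε > 0, ∀ᶠ y in 𝓝 x, |f y - f x| ≤ (c + ε) * dist y x) : lipSlope f x ≤ c :=
  ENNReal.toReal_le_of_le_ofReal hc (localLip_le_of_eventually hc h)

theorem localLip_ne_top {f : X → ℝ} {K : ℝ≥0} (hf : LipschitzWith K f) (x : X) :
    localLip f x ≠ ∞ := by
  refine ne_top_of_le_ne_top ENNReal.ofReal_ne_top
    (localLip_le_of_eventually (c := K) K.2 fun ε hε => Eventually.of_forall fun y => ?_)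
  have := hf.dist_le_mul y x
  rw [Real.dist_eq] at this
  nlinarith [dist_nonneg (x := y) (y := x)]

theorem lipSlope_le {f : X → ℝ} {K : ℝ≥0} (hf : LipschitzWith K f) (x : X) :
    lipSlope f x ≤ K := by
  refine lipSlope_le_of_eventually K.2 fun ε hε => Eventually.of_forall fun y => ?_
  have := hf.dist_le_mul y x
  rw [Real.dist_eq] at this
  nlinarith [dist_nonneg (x := y) (y := x)]

theorem eventually_le_lipSlope {f : X → ℝ} {K : ℝ≥0} (hf : LipschitzWith K f) (x : X)
    {ε : ℝ} (hε : 0 < ε) : ∀ᶠ y in 𝓝 x, |f y - f x| ≤ (lipSlope f x + ε) * dist y x := by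
  have h1 : localLip f x < ENNReal.ofReal (lipSlope f x + ε) := by
    rw [ENNReal.lt_ofReal_iff_toReal_lt (localLip_ne_top hf x)]
    exact lt_add_of_pos_right _ hε
  have h2 := eventually_lt_of_limsup_lt (f := 𝓝[≠] x) h1 (by isBoundedDefault)
  rw [eventually_nhdsWithin_iff] at h2
  filter_upwards [h2] with y hy
  by_cases hxy : y = x
  · simp [hxy]
  have hd : 0 < dist y x := dist_pos.2 hxy
  have h3 := (hy hxy).le
  rw [edist_dist, edist_dist, ← ENNReal.ofReal_div_of_pos hd, Real.dist_eq] at h3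
  rw [ENNReal.ofReal_le_ofReal_iff (add_nonneg (lipSlope_nonneg f x) hε.le)] at h3
  rwa [div_le_iff₀ hd] at h3

/-- For continuous `f`, the supremum of the difference quotients over a punctured ball is a lower
semicontinuous function of the centre. -/
theorem measurable_localLip [MeasurableSpace X] [BorelSpace X] {f : X → ℝ} (hf : Continuous f) :
    Measurable (localLip f) := by
  have h1 : localLip f = fun x => ⨅ n : ℕ, ⨆ y ∈ Metric.ball x (1 / ((n : ℝ) + 1)) ∩ {x}ᶜ,
      edist (f y) (f x) / edist y x := by
    funext x
    have hb := (Metric.nhds_basis_ball_inv_nat_succ (x := x))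
    have := (nhdsWithin_hasBasis hb ({x}ᶜ)).limsup_eq_iInf_iSup
      (u := fun y => edist (f y) (f x) / edist y x)
    simpa [localLip] using this
  rw [h1]
  refine Measurable.iInf fun n => ?_
  set r : ℝ := 1 / ((n : ℝ) + 1)
  refine measurable_of_Ioi fun c => IsOpen.measurableSet ?_
  have h2 : (fun x => ⨆ y ∈ Metric.ball x r ∩ {x}ᶜ, edist (f y) (f x) / edist y x) ⁻¹' Ioi c =
      ⋃ y, {x | (dist y x < r ∧ y ≠ x) ∧ c < edist (f y) (f x) / edist y x} := by
    ext x
    simp only [mem_preimage, mem_Ioi, lt_iSup_iff, mem_iUnion, mem_ofPred_eq, mem_inter_iff,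
      Metric.mem_ball, mem_compl_iff, mem_singleton_iff, exists_prop, ne_eq]
  rw [h2]
  refine isOpen_iUnion fun y => ?_
  rw [isOpen_iff_mem_nhds]
  rintro x ⟨⟨hx1, hx2⟩, hx3⟩
  have hc : ContinuousAt (fun z => edist (f y) (f z) / edist y z) x := by
    refine ENNReal.Tendsto.div ?_ (Or.inr ?_) ?_ (Or.inr ?_)
    · exact (continuous_const.edist hf).continuousAt
    · simpa using hx2
    · exact (continuous_const.edist continuous_id).continuousAt
    · simp [edist_ne_top]
  have e1 : ∀ᶠ z in 𝓝 x, dist y z < r :=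
    (continuous_const.dist continuous_id).continuousAt.eventually_lt continuousAt_const hx1
  have e2 : ∀ᶠ z in 𝓝 x, y ≠ z := by
    filter_upwards [isOpen_ne.mem_nhds (Ne.symm hx2)] with z hz using Ne.symm hz
  filter_upwards [e1, e2, hc.eventually (lt_mem_nhds hx3)] with z h1 h2 h3 using ⟨⟨h1, h2⟩, h3⟩

theorem measurable_lipSlope [MeasurableSpace X] [BorelSpace X] {f : X → ℝ} (hf : Continuous f) :
    Measurable (lipSlope f) := (measurable_localLip hf).ennreal_toReal

theorem lipSlope_add_smul_le {f g : X → ℝ} {K K' : ℝ≥0} (hf : LipschitzWith K f)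
    (hg : LipschitzWith K' g) {a c : ℝ} (ha : 0 ≤ a) (hc : 0 ≤ c) (x : X) :
    lipSlope (fun y => a * f y + c * g y) x ≤ a * lipSlope f x + c * lipSlope g x := by
  refine lipSlope_le_of_eventually (add_nonneg (mul_nonneg ha (lipSlope_nonneg _ _))
    (mul_nonneg hc (lipSlope_nonneg _ _))) fun ε hε => ?_
  have hε' : 0 < ε / (a + c + 1) := by positivity
  filter_upwards [eventually_le_lipSlope hf x hε', eventually_le_lipSlope hg x hε'] with y h1 h2
  have h3 : ε / (a + c + 1) * (a + c) ≤ ε := by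
    rw [div_mul_eq_mul_div, div_le_iff₀ (by positivity)]; nlinarith
  have h4 : |a * f y + c * g y - (a * f x + c * g x)| ≤ a * |f y - f x| + c * |g y - g x| := by
    rw [show a * f y + c * g y - (a * f x + c * g x) = a * (f y - f x) + c * (g y - g x) by ring]
    refine (abs_add_le _ _).trans ?_
    rw [abs_mul, abs_mul, abs_of_nonneg ha, abs_of_nonneg hc]
  have hd := dist_nonneg (x := y) (y := x)
  nlinarith [mul_le_mul_of_nonneg_left h1 ha, mul_le_mul_of_nonneg_left h2 hc,
    mul_le_mul_of_nonneg_right h3 hd]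

/-- One-variable chain rule for the local Lipschitz constant. -/
theorem lipSlope_comp_le {φ : ℝ → ℝ} {g : X → ℝ} {K : ℝ≥0} (hg : LipschitzWith K g) {x : X}
    {φ' : ℝ} (hφ : HasDerivAt φ φ' (g x)) :
    lipSlope (fun y => φ (g y)) x ≤ |φ'| * lipSlope g x := by
  refine lipSlope_le_of_eventually (mul_nonneg (abs_nonneg _) (lipSlope_nonneg _ _))
    fun ε hε => ?_
  set δ : ℝ := min 1 (ε / (|φ'| + lipSlope g x + 1)) with hδ
  have hs := lipSlope_nonneg g x
  have ha := abs_nonneg φ'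
  have hδ0 : 0 < δ := lt_min one_pos (by positivity)
  have hδ1 : δ ≤ 1 := min_le_left _ _
  have hδ2 : δ * (|φ'| + lipSlope g x + 1) ≤ ε := by
    rw [← le_div_iff₀ (by positivity)]; exact min_le_right _ _
  have h1 := (hasDerivAt_iff_isLittleO.1 hφ).bound hδ0
  have h2 := hg.continuous.continuousAt (x := x) |>.eventually h1
  filter_upwards [h2, eventually_le_lipSlope hg x hδ0] with y h3 h4
  simp only [Real.norm_eq_abs, smul_eq_mul] at h3
  have h5 : |φ (g y) - φ (g x)| ≤ (|φ'| + δ) * |g y - g x| := by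
    have : φ (g y) - φ (g x) = (φ (g y) - φ (g x) - (g y - g x) * φ') + (g y - g x) * φ' := by ring
    rw [this]
    refine (abs_add_le _ _).trans ?_
    rw [abs_mul]; linarith
  have hd := dist_nonneg (x := y) (y := x)
  calc _ ≤ (|φ'| + δ) * |g y - g x| := h5
    _ ≤ (|φ'| + δ) * ((lipSlope g x + δ) * dist y x) := by gcongr
    _ = ((|φ'| + δ) * (lipSlope g x + δ)) * dist y x := by ring
    _ ≤ _ := by
      gcongr
      nlinarith

theorem lipSlope_eq_zero_of_eventually_const {g : X → ℝ} {x : X}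
    (h : ∀ᶠ y in 𝓝 x, g y = g x) : lipSlope g x = 0 := by
  refine le_antisymm (lipSlope_le_of_eventually le_rfl fun ε hε => ?_) (lipSlope_nonneg _ _)
  filter_upwards [h] with y hy
  simp only [hy, sub_self, abs_zero]; positivity

end LipSlope

/-! ### Regularized power entropies -/

/-- The weight `(|r| + w)^{-b}`, the second derivative in `r` of `entropy b w`. -/
def entropyWeight (b w r : ℝ) : ℝ := (|r| + w) ^ (-b)

/-- The odd primitive in `r` of `entropyWeight b w`. -/
def entropyDeriv (b w r : ℝ) : ℝ :=
  Real.sign r * (((|r| + w) ^ (1 - b) - w ^ (1 - b)) / (1 - b))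

/-- The convex even function of `r` with second derivative `(|r| + w)^{-b}` that vanishes to
first order at `0`. For `w → 0` and `b = p - 1` it is, up to a linear term and a factor, the Rényi
entropy density `r^{3-p}`; the shift `w > 0` makes its derivative Lipschitz. -/
def entropy (b w r : ℝ) : ℝ :=
  ((|r| + w) ^ (2 - b) - w ^ (2 - b)) / ((1 - b) * (2 - b)) - w ^ (1 - b) * |r| / (1 - b)

section Scalar

variable {b w : ℝ}

theorem entropyWeight_nonneg (hw : 0 < w) (r : ℝ) : 0 ≤ entropyWeight b w r := by
  unfold entropyWeight; positivity

theorem entropyWeight_pos (hw : 0 < w) (r : ℝ) : 0 < entropyWeight b w r := by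
  unfold entropyWeight; positivity

theorem entropyWeight_le (hb : 0 < b) (hw : 0 < w) (r : ℝ) : entropyWeight b w r ≤ w ^ (-b) :=
  Real.rpow_le_rpow_of_nonpos hw (by linarith [abs_nonneg r]) (by linarith)

theorem entropyWeight_le_of_le {w₀ : ℝ} (hb : 0 < b) (hw₀ : 0 < w₀) (hw : w₀ ≤ w) (r : ℝ) :
    entropyWeight b w r ≤ w₀ ^ (-b) :=
  Real.rpow_le_rpow_of_nonpos hw₀ (by linarith [abs_nonneg r]) (by linarith)

@[simp] theorem entropyDeriv_zero : entropyDeriv b w 0 = 0 := by simp [entropyDeriv]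

@[simp] theorem entropy_zero : entropy b w 0 = 0 := by simp [entropy]

theorem entropyDeriv_neg (r : ℝ) : entropyDeriv b w (-r) = -entropyDeriv b w r := by
  rcases lt_trichotomy r 0 with h | h | h
  · simp [entropyDeriv, Real.sign_of_neg h, Real.sign_of_pos (neg_pos.2 h)]
  · simp [h]
  · simp [entropyDeriv, Real.sign_of_pos h, Real.sign_of_neg (neg_lt_zero.2 h)]

theorem entropy_neg (r : ℝ) : entropy b w (-r) = entropy b w r := by simp [entropy]

theorem hasDerivAt_add_rpow (hw : 0 < w) {c r : ℝ} (hr : 0 ≤ r) :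
    HasDerivAt (fun s => (s + w) ^ c) (c * (r + w) ^ (c - 1)) r := by
  have := ((hasDerivAt_id r).add_const w).rpow_const (p := c) (Or.inl (by simp; linarith))
  simpa using this

theorem hasDerivAt_entropyDeriv_of_pos (hb : b ≠ 1) (hw : 0 < w) {r : ℝ} (hr : 0 < r) :
    HasDerivAt (entropyDeriv b w) (entropyWeight b w r) r := by
  have hb' : 1 - b ≠ 0 := sub_ne_zero.2 hb.symm
  have h := ((hasDerivAt_add_rpow hw (c := 1 - b) hr.le).sub_const (w ^ (1 - b))).div_const (1 - b)
  have e : entropyDeriv b w =ᶠ[𝓝 r] fun s => ((s + w) ^ (1 - b) - w ^ (1 - b)) / (1 - b) := by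
    filter_upwards [lt_mem_nhds hr] with s hs
    simp [entropyDeriv, Real.sign_of_pos hs, abs_of_pos hs]
  refine (h.congr_of_eventuallyEq e).congr_deriv ?_
  rw [entropyWeight, abs_of_pos hr, mul_div_cancel_left₀ _ hb']
  congr 1; ring

theorem continuousAt_entropyWeight (hw : 0 < w) (r : ℝ) :
    ContinuousAt (fun z : ℝ × ℝ => entropyWeight b z.1 z.2) (w, r) := by
  unfold entropyWeight
  refine ContinuousAt.rpow_const (by fun_prop) (Or.inl ?_)
  have := abs_nonneg r
  simp; linarith

theorem hasDerivAt_entropyDeriv (hb : b ≠ 1) (hw : 0 < w) (r : ℝ) :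
    HasDerivAt (entropyDeriv b w) (entropyWeight b w r) r := by
  have hneg : ∀ r < 0, HasDerivAt (entropyDeriv b w) (entropyWeight b w r) r := by
    intro r h
    have h1 := hasDerivAt_entropyDeriv_of_pos hb hw (neg_pos.2 h)
    have h2 := (h1.scomp r (hasDerivAt_neg r)).neg
    have e : (-(entropyDeriv b w ∘ Neg.neg)) = entropyDeriv b w := by
      funext s; simp [entropyDeriv_neg]
    rw [e] at h2
    simpa [entropyWeight] using h2
  rcases lt_trichotomy r 0 with h | h | h
  · exact hneg r h
  · subst h
    have hc : ContinuousAt (entropyDeriv b w) 0 := by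
      rw [ContinuousAt, entropyDeriv_zero, tendsto_zero_iff_abs_tendsto_zero]
      have h1 : ContinuousAt (fun s : ℝ => |((|s| + w) ^ (1 - b) - w ^ (1 - b)) / (1 - b)|) 0 := by
        have : ContinuousAt (fun s : ℝ => (|s| + w) ^ (1 - b)) 0 :=
          ContinuousAt.rpow_const (by fun_prop) (Or.inl (by simp; linarith))
        exact ((this.sub continuousAt_const).div_const _).abs
      have h2 : Tendsto (fun s : ℝ => |((|s| + w) ^ (1 - b) - w ^ (1 - b)) / (1 - b)|) (𝓝 0)
          (𝓝 0) := by
        have := h1.tendsto; simpa using this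
      refine squeeze_zero (fun _ => abs_nonneg _) (fun s => ?_) h2
      simp only [Function.comp, entropyDeriv, abs_mul]
      refine mul_le_of_le_one_left (abs_nonneg _) ?_
      rcases Real.sign_apply_eq s with h | h | h <;> rw [h] <;> norm_num
    refine hasDerivAt_of_hasDerivAt_of_ne (f := entropyDeriv b w)
      (g := fun r => entropyWeight b w r) (x := 0) ?_ hc ?_
    · intro y hy
      rcases lt_or_gt_of_ne hy with h | h
      · exact hneg y h
      · exact hasDerivAt_entropyDeriv_of_pos hb hw h
    · exact (continuousAt_entropyWeight hw 0).comp
        (f := fun s : ℝ => (w, s)) (by fun_prop)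
  · exact hasDerivAt_entropyDeriv_of_pos hb hw h

theorem continuous_entropyDeriv (hb : b ≠ 1) (hw : 0 < w) : Continuous (entropyDeriv b w) :=
  continuous_iff_continuousAt.2 fun r => (hasDerivAt_entropyDeriv hb hw r).continuousAt

theorem hasDerivAt_entropy (hb : b ≠ 1) (hb2 : b ≠ 2) (hw : 0 < w) (r : ℝ) :
    HasDerivAt (entropy b w) (entropyDeriv b w r) r := by
  have hb' : 1 - b ≠ 0 := sub_ne_zero.2 hb.symm
  have hb2' : 2 - b ≠ 0 := sub_ne_zero.2 hb2.symm
  have hpos : ∀ r > 0, HasDerivAt (entropy b w) (entropyDeriv b w r) r := by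
    intro r hr
    have h := (((hasDerivAt_add_rpow hw (c := 2 - b) hr.le).sub_const (w ^ (2 - b))).div_const
      ((1 - b) * (2 - b))).sub (((hasDerivAt_id r).const_mul (w ^ (1 - b))).div_const (1 - b))
    have e : entropy b w =ᶠ[𝓝 r] fun s => ((s + w) ^ (2 - b) - w ^ (2 - b)) / ((1 - b) * (2 - b))
        - w ^ (1 - b) * s / (1 - b) := by
      filter_upwards [lt_mem_nhds hr] with s hs
      simp [entropy, abs_of_pos hs]
    refine (h.congr_of_eventuallyEq e).congr_deriv ?_
    rw [entropyDeriv, Real.sign_of_pos hr, abs_of_pos hr, show 2 - b - 1 = 1 - b by ring]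
    field_simp
  have hneg : ∀ r < 0, HasDerivAt (entropy b w) (entropyDeriv b w r) r := by
    intro r h
    have h2 := (hpos _ (neg_pos.2 h)).scomp r (hasDerivAt_neg r)
    have e : (entropy b w ∘ Neg.neg) = entropy b w := by
      funext s; simp [entropy_neg]
    rw [e] at h2
    simpa [entropyDeriv_neg] using h2
  rcases lt_trichotomy r 0 with h | h | h
  · exact hneg r h
  · subst h
    have hc : ContinuousAt (entropy b w) 0 := by
      unfold entropy
      have : ContinuousAt (fun s : ℝ => (|s| + w) ^ (2 - b)) 0 :=
          ContinuousAt.rpow_const (by fun_prop) (Or.inl (by simp; linarith))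
      exact ((this.sub continuousAt_const).div_const _).sub (by fun_prop)
    refine hasDerivAt_of_hasDerivAt_of_ne (f := entropy b w)
      (g := fun r => entropyDeriv b w r) (x := 0) ?_ hc (continuous_entropyDeriv hb hw).continuousAt
    intro y hy
    rcases lt_or_gt_of_ne hy with h | h
    · exact hneg y h
    · exact hpos y h
  · exact hpos r h

theorem abs_entropyDeriv_sub_le (hb0 : 0 < b) (hb : b ≠ 1) (hw : 0 < w) (r s : ℝ) :
    |entropyDeriv b w s - entropyDeriv b w r| ≤ w ^ (-b) * |s - r| := by
  refine Convex.norm_image_sub_le_of_norm_hasDerivWithin_le (s := univ) (𝕜 := ℝ)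
    (f' := entropyWeight b w)
    (fun x _ => (hasDerivAt_entropyDeriv hb hw x).hasDerivWithinAt) (fun x _ => ?_) convex_univ
    (mem_univ r) (mem_univ s)
  rw [Real.norm_eq_abs, abs_of_nonneg (entropyWeight_nonneg hw x)]
  exact entropyWeight_le hb0 hw x

theorem abs_entropyDeriv_le (hb0 : 0 < b) (hb : b ≠ 1) (hw : 0 < w) (r : ℝ) :
    |entropyDeriv b w r| ≤ w ^ (-b) * |r| := by
  simpa using abs_entropyDeriv_sub_le hb0 hb hw 0 r

theorem monotone_entropyDeriv (hb : b ≠ 1) (hw : 0 < w) : Monotone (entropyDeriv b w) :=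
  monotone_of_deriv_nonneg (fun x => (hasDerivAt_entropyDeriv hb hw x).differentiableAt)
    fun x => (hasDerivAt_entropyDeriv hb hw x).deriv ▸ entropyWeight_nonneg hw x

theorem abs_entropy_sub_sub_le (hb0 : 0 < b) (hb : b ≠ 1) (hb2 : b ≠ 2) (hw : 0 < w) (r s : ℝ) :
    |entropy b w s - entropy b w r - entropyDeriv b w r * (s - r)| ≤ w ^ (-b) * (s - r) ^ 2 := by
  have h := Convex.norm_image_sub_le_of_norm_hasDerivWithin_le (s := uIcc r s) (𝕜 := ℝ)
    (f := fun t => entropy b w t - entropyDeriv b w r * t)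
    (f' := fun t => entropyDeriv b w t - entropyDeriv b w r) (C := w ^ (-b) * |s - r|)
    (x := r) (y := s)
    (fun x _ => ((hasDerivAt_entropy hb hb2 hw x).sub
      ((hasDerivAt_id x).const_mul (entropyDeriv b w r))).hasDerivWithinAt.congr_deriv (by simp))
    (fun x hx => ?_) (convex_uIcc r s) left_mem_uIcc right_mem_uIcc
  · rw [Real.norm_eq_abs, Real.norm_eq_abs, mul_assoc, abs_mul_abs_self, ← sq] at h
    convert h using 2
    ring
  · refine (abs_entropyDeriv_sub_le hb0 hb hw r x).trans ?_
    exact mul_le_mul_of_nonneg_left (abs_sub_left_of_mem_uIcc hx) (by positivity)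

theorem entropy_tangent_le (hb : b ≠ 1) (hb2 : b ≠ 2) (hw : 0 < w) (r s : ℝ) :
    entropy b w r + entropyDeriv b w r * (s - r) ≤ entropy b w s := by
  have hconv : ConvexOn ℝ univ (entropy b w) := by
    refine MonotoneOn.convexOn_of_deriv convex_univ ?_ ?_ ?_
    · exact fun x _ => (hasDerivAt_entropy hb hb2 hw x).continuousAt.continuousWithinAt
    · exact fun x _ => (hasDerivAt_entropy hb hb2 hw x).differentiableAt.differentiableWithinAt
    · intro x _ y _ hxy
      rw [(hasDerivAt_entropy hb hb2 hw x).deriv, (hasDerivAt_entropy hb hb2 hw y).deriv]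
      exact monotone_entropyDeriv hb hw hxy
  rcases lt_trichotomy r s with h | h | h
  · have h1 := hconv.le_slope_of_hasDerivAt (mem_univ r) (mem_univ s) h
      (hasDerivAt_entropy hb hb2 hw r)
    rw [slope_def_field, le_div_iff₀ (by linarith)] at h1
    linarith
  · simp [h]
  · have h1 := hconv.slope_le_of_hasDerivAt (mem_univ s) (mem_univ r) h
      (hasDerivAt_entropy hb hb2 hw r)
    rw [slope_def_field, div_le_iff₀ (by linarith)] at h1
    linarith

theorem entropy_nonneg (hb : b ≠ 1) (hb2 : b ≠ 2) (hw : 0 < w) (r : ℝ) : 0 ≤ entropy b w r := by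
  simpa using entropy_tangent_le hb hb2 hw 0 r

theorem entropy_le_sq (hb0 : 0 < b) (hb : b ≠ 1) (hb2 : b ≠ 2) (hw : 0 < w) (r : ℝ) :
    entropy b w r ≤ w ^ (-b) * r ^ 2 := by
  have := abs_entropy_sub_sub_le hb0 hb hb2 hw 0 r
  simp only [entropy_zero, entropyDeriv_zero, sub_zero, zero_mul] at this
  exact (le_abs_self _).trans this

/-- The dependence of `entropyDeriv` on the shift `w`; the bound does not involve `r`. -/
theorem abs_entropyDeriv_sub_shift_le (hb0 : 0 < b) (hb : b ≠ 1) {m w' : ℝ} (hm : 0 < m)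
    (hw : m ≤ w) (hw' : m ≤ w') (r : ℝ) :
    |entropyDeriv b w' r - entropyDeriv b w r| ≤ m ^ (-b) * |w' - w| := by
  have hb' : 1 - b ≠ 0 := sub_ne_zero.2 hb.symm
  have h := Convex.norm_image_sub_le_of_norm_hasDerivWithin_le (s := Ici m) (𝕜 := ℝ)
    (f := fun v => ((|r| + v) ^ (1 - b) - v ^ (1 - b)) / (1 - b))
    (f' := fun v => (|r| + v) ^ (-b) - v ^ (-b)) (C := m ^ (-b)) (x := w) (y := w')
    (fun v hv => ?_) (fun v hv => ?_) (convex_Ici m) hw hw'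
  · simp only [Real.norm_eq_abs] at h
    refine le_trans ?_ h
    rw [entropyDeriv, entropyDeriv, ← mul_sub, abs_mul]
    refine mul_le_of_le_one_left (abs_nonneg _) ?_
    rcases Real.sign_apply_eq r with h | h | h <;> rw [h] <;> norm_num
  · have hv0 : 0 < v := lt_of_lt_of_le hm hv
    have ha := abs_nonneg r
    have h1 : HasDerivAt (fun v => (|r| + v) ^ (1 - b)) ((1 - b) * (|r| + v) ^ (-b)) v := by
      have := ((hasDerivAt_id v).const_add |r|).rpow_const (p := 1 - b)
        (Or.inl (by simp; linarith))
      simpa using this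
    have h2 : HasDerivAt (fun v => v ^ (1 - b)) ((1 - b) * v ^ (-b)) v := by
      have := (hasDerivAt_id v).rpow_const (p := 1 - b) (Or.inl (by simpa using hv0.ne'))
      simpa using this
    refine ((h1.sub h2).div_const (1 - b)).hasDerivWithinAt.congr_deriv ?_
    field_simp
  · have hv0 : 0 < v := lt_of_lt_of_le hm hv
    have h1 : (|r| + v) ^ (-b) ≤ v ^ (-b) :=
      Real.rpow_le_rpow_of_nonpos hv0 (by linarith [abs_nonneg r]) (by linarith)
    have h2 : v ^ (-b) ≤ m ^ (-b) := Real.rpow_le_rpow_of_nonpos hm hv (by linarith)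
    have h3 : 0 ≤ (|r| + v) ^ (-b) := by positivity
    rw [Real.norm_eq_abs, abs_le]
    constructor <;> linarith

end Scalar

/-! ### The chain rule for the test functions -/

section Chain

variable {X : Type*} [MetricSpace X]

/-- The composite of Lipschitz functions with `entropyDeriv` is Lipschitz as long as the shift
stays away from `0`. -/
theorem exists_lipschitzWith_entropyDeriv {b w₀ : ℝ} (hb0 : 0 < b) (hb : b ≠ 1) (hw₀ : 0 < w₀)
    {w F : X → ℝ} {Kw KF : ℝ≥0} (hw : LipschitzWith Kw w) (hww : ∀ x, w₀ ≤ w x)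
    (hF : LipschitzWith KF F) :
    ∃ K : ℝ≥0, LipschitzWith K fun x => entropyDeriv b (w x) (F x) := by
  refine ⟨(w₀ ^ (-b)).toNNReal * (Kw + KF), LipschitzWith.of_dist_le_mul fun x y => ?_⟩
  have hp : 0 < w₀ ^ (-b) := by positivity
  rw [NNReal.coe_mul, Real.coe_toNNReal _ hp.le, NNReal.coe_add]
  have h1 := hw.dist_le_mul x y
  have h2 := hF.dist_le_mul x y
  rw [Real.dist_eq] at h1 h2 ⊢
  have h3 := abs_entropyDeriv_sub_shift_le hb0 hb hw₀ (hww y) (hww x) (F x)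
  have h4 := abs_entropyDeriv_sub_le hb0 hb (lt_of_lt_of_le hw₀ (hww y)) (F y) (F x)
  have h5 : w y ^ (-b) ≤ w₀ ^ (-b) := Real.rpow_le_rpow_of_nonpos hw₀ (hww y) (by linarith)
  have h6 := abs_sub_le (entropyDeriv b (w x) (F x)) (entropyDeriv b (w y) (F x))
    (entropyDeriv b (w y) (F y))
  have h7 : w y ^ (-b) * |F x - F y| ≤ w₀ ^ (-b) * |F x - F y| := by gcongr
  have h8 := mul_le_mul_of_nonneg_left h1 hp.le
  have h9 := mul_le_mul_of_nonneg_left h2 hp.le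
  linarith

/-- The chain rule behind all estimates: subtracting a small multiple of a nondecreasing function of
`F` decreases the slope by the corresponding factor. The nondecreasing function is
`c * entropyDeriv b (w x) (F x)`, and the slopes of the shift `w` and of the further
perturbation `u` enter as errors of order `τ`. -/
theorem lipSlope_perturb_le {b : ℝ} (hb0 : 0 < b) (hb : b ≠ 1) {w u F : X → ℝ} {Kw Ku KF : ℝ≥0}
    (hw : LipschitzWith Kw w) (hu : LipschitzWith Ku u) (hF : LipschitzWith KF F) {x : X}
    (hwx : 0 < w x) {τ c : ℝ} (hτ : 0 ≤ τ) (hc : 0 ≤ c) (hτc : τ * c * w x ^ (-b) ≤ 1) :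
    lipSlope (fun y => F y - τ * (c * entropyDeriv b (w y) (F y) + u y)) x ≤
      (1 - τ * c * entropyWeight b (w x) (F x)) * lipSlope F x +
        τ * (c * (w x ^ (-b) * lipSlope w x) + lipSlope u x) := by
  set A := entropyWeight b (w x) (F x) with hA
  have hA1 : 0 ≤ 1 - τ * c * A := by
    have := mul_le_mul_of_nonneg_left (entropyWeight_le hb0 hwx (F x)) (mul_nonneg hτ hc)
    linarith
  have hsF := lipSlope_nonneg F x
  have hsw := lipSlope_nonneg w x
  have hsu := lipSlope_nonneg u x
  have hwb : 0 < w x ^ (-b) := by positivity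
  refine lipSlope_le_of_eventually (by positivity) fun ε hε => ?_
  -- all first-order errors are absorbed into a single small `η`
  obtain ⟨η, hη0, hη⟩ : ∃ η > 0, (1 - τ * c * A) * (lipSlope F x + η) +
      τ * c * (η * (lipSlope F x + η)) + τ * c * ((w x ^ (-b) + η) * (lipSlope w x + η)) +
      τ * (lipSlope u x + η) ≤ (1 - τ * c * A) * lipSlope F x +
        τ * (c * (w x ^ (-b) * lipSlope w x) + lipSlope u x) + ε := by
    have hcont : Continuous fun η : ℝ => (1 - τ * c * A) * (lipSlope F x + η) +
      τ * c * (η * (lipSlope F x + η)) + τ * c * ((w x ^ (-b) + η) * (lipSlope w x + η)) +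
      τ * (lipSlope u x + η) := by fun_prop
    have h1 := (hcont.continuousAt (x := 0)).eventually_lt (continuousAt_const
      (y := (1 - τ * c * A) * lipSlope F x +
        τ * (c * (w x ^ (-b) * lipSlope w x) + lipSlope u x) + ε)) (by ring_nf; linarith)
    obtain ⟨η, h2, h3⟩ := ((h1.filter_mono nhdsWithin_le_nhds).and
      (self_mem_nhdsWithin : Ioi (0 : ℝ) ∈ 𝓝[>] 0)).exists
    exact ⟨η, h3, h2.le⟩
  have hw' := hw.continuous.continuousAt (x := x)
  have hF' := hF.continuous.continuousAt (x := x)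
  obtain ⟨δ, hδ, hδA⟩ := Metric.continuousAt_iff.1
    (continuousAt_entropyWeight (b := b) hwx (F x)) η hη0
  obtain ⟨δ', hδ', hδw⟩ := Metric.continuousAt_iff.1
    (Real.continuousAt_rpow_const (w x) (-b) (Or.inl hwx.ne')) η hη0
  filter_upwards [eventually_le_lipSlope hF x hη0, eventually_le_lipSlope hw x hη0,
    eventually_le_lipSlope hu x hη0, hw'.eventually (lt_mem_nhds hwx),
    hw'.eventually (Metric.ball_mem_nhds _ hδ), hF'.eventually (Metric.ball_mem_nhds _ hδ),
    hw'.eventually (Metric.ball_mem_nhds _ hδ')] with y h1 h2 h3 h4 h5 h6 h7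
  have hd := dist_nonneg (x := y) (y := x)
  -- the increment of `entropyDeriv b (w y) (F y)` splits into a part due to `F` (`k1`) and a part
  -- due to `w` (`k2`)
  have k1 : |entropyDeriv b (w y) (F y) - entropyDeriv b (w y) (F x) - A * (F y - F x)| ≤
      η * |F y - F x| := by
    have h := Convex.norm_image_sub_le_of_norm_hasDerivWithin_le (s := uIcc (F x) (F y)) (𝕜 := ℝ)
      (f := fun t => entropyDeriv b (w y) t - A * t)
      (f' := fun t => entropyWeight b (w y) t - A) (C := η) (x := F x) (y := F y)
      (fun t _ => ((hasDerivAt_entropyDeriv hb h4 t).sub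
        ((hasDerivAt_id t).const_mul A)).hasDerivWithinAt.congr_deriv (by simp))
      (fun t ht => ?_) (convex_uIcc _ _) left_mem_uIcc right_mem_uIcc
    · simp only [Real.norm_eq_abs] at h
      convert h using 2
      ring
    · have := @hδA (w y, t) (by
        rw [Prod.dist_eq]
        refine max_lt h5 (lt_of_le_of_lt ?_ h6)
        simpa [Real.dist_eq] using abs_sub_left_of_mem_uIcc ht)
      rw [Real.dist_eq] at this
      exact this.le
  have k2 : |entropyDeriv b (w y) (F x) - entropyDeriv b (w x) (F x)| ≤
      (w x ^ (-b) + η) * |w y - w x| := by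
    refine (abs_entropyDeriv_sub_shift_le hb0 hb (lt_min hwx h4) (min_le_left _ _)
      (min_le_right _ _) (F x)).trans ?_
    gcongr
    rcases le_total (w x) (w y) with h | h
    · rw [min_eq_left h]; linarith
    · rw [min_eq_right h]
      have := hδw h7
      rw [Real.dist_eq] at this
      linarith [le_abs_self (w y ^ (-b) - w x ^ (-b))]
  have k3 : |F y - τ * (c * entropyDeriv b (w y) (F y) + u y) -
      (F x - τ * (c * entropyDeriv b (w x) (F x) + u x))| ≤
      (1 - τ * c * A) * |F y - F x| + τ * c * (η * |F y - F x|) +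
      τ * c * ((w x ^ (-b) + η) * |w y - w x|) + τ * |u y - u x| := by
    have e : F y - τ * (c * entropyDeriv b (w y) (F y) + u y) -
      (F x - τ * (c * entropyDeriv b (w x) (F x) + u x)) =
      (1 - τ * c * A) * (F y - F x) -
      τ * c * (entropyDeriv b (w y) (F y) - entropyDeriv b (w y) (F x) - A * (F y - F x)) -
      τ * c * (entropyDeriv b (w y) (F x) - entropyDeriv b (w x) (F x)) -
      τ * (u y - u x) := by ring
    rw [e]
    refine (abs_sub _ _).trans (add_le_add ((abs_sub _ _).trans (add_le_add
      ((abs_sub _ _).trans (add_le_add ?_ ?_)) ?_)) ?_)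
    · rw [abs_mul, abs_of_nonneg hA1]
    · rw [abs_mul, abs_of_nonneg (mul_nonneg hτ hc)]; gcongr
    · rw [abs_mul, abs_of_nonneg (mul_nonneg hτ hc)]; gcongr
    · rw [abs_mul, abs_of_nonneg hτ]
  refine k3.trans (le_trans ?_ (mul_le_mul_of_nonneg_right hη hd))
  calc _ ≤ (1 - τ * c * A) * ((lipSlope F x + η) * dist y x) +
        τ * c * (η * ((lipSlope F x + η) * dist y x)) +
        τ * c * ((w x ^ (-b) + η) * ((lipSlope w x + η) * dist y x)) +
        τ * ((lipSlope u x + η) * dist y x) := by gcongr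
    _ = _ := by ring

end Chain

/-! ### Uniform convexity of `L^q` -/

section Convexity

theorem abs_half_add_rpow_lt {q : ℝ} (hq : 1 < q) {a b : ℝ} (hab : a ≠ b) :
    |2⁻¹ * (a + b)| ^ q < 2⁻¹ * (|a| ^ q + |b| ^ q) := by
  have h0 : 0 ≤ |a| := abs_nonneg a
  have h1 : 0 ≤ |b| := abs_nonneg b
  have hle : |2⁻¹ * (a + b)| ≤ 2⁻¹ * |a| + 2⁻¹ * |b| := by
    rw [abs_mul, abs_of_pos (by norm_num : (0 : ℝ) < 2⁻¹), ← mul_add]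
    gcongr
    exact abs_add_le a b
  by_cases h : |a| = |b|
  · have hb : b = -a := by
      rcases abs_eq_abs.1 h with h | h
      · exact absurd h hab
      · linarith
    have ha : 0 < |a| := abs_pos.2 fun h => hab (by simp [hb, h])
    rw [hb]
    simp only [add_neg_cancel, mul_zero, abs_zero, abs_neg]
    rw [Real.zero_rpow (by linarith)]
    positivity
  · have := (strictConvexOn_rpow hq).2 h0 h1 h (by norm_num : (0 : ℝ) < 2⁻¹)
      (by norm_num : (0 : ℝ) < 2⁻¹) (by norm_num)
    simp only [smul_eq_mul] at this
    calc |2⁻¹ * (a + b)| ^ q ≤ (2⁻¹ * |a| + 2⁻¹ * |b|) ^ q := by gcongr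
      _ < _ := by linarith

theorem abs_half_add_rpow_le {q : ℝ} (hq : 1 < q) (a b : ℝ) :
    |2⁻¹ * (a + b)| ^ q ≤ 2⁻¹ * (|a| ^ q + |b| ^ q) := by
  by_cases hab : a = b
  · subst hab
    rw [show 2⁻¹ * (a + a) = a by ring]; linarith
  · exact (abs_half_add_rpow_lt hq hab).le

/-- A pointwise form of the uniform convexity of `L^q`: up to a small multiple of `|a|^q + |b|^q`,
the distance `|a - b|^q` is controlled by the midpoint convexity gap of `|·|^q`. It follows from
strict convexity by homogeneity and compactness of the unit sphere of `ℝ × ℝ`. -/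
theorem exists_abs_sub_rpow_le {q : ℝ} (hq : 1 < q) {ε : ℝ} (hε : 0 < ε) :
    ∃ C, 0 ≤ C ∧ ∀ a b : ℝ, |a - b| ^ q ≤ ε * (|a| ^ q + |b| ^ q) +
      C * (2⁻¹ * (|a| ^ q + |b| ^ q) - |2⁻¹ * (a + b)| ^ q) := by
  have hq0 : 0 < q := by linarith
  set Δ : ℝ × ℝ → ℝ := fun z => 2⁻¹ * (|z.1| ^ q + |z.2| ^ q) - |2⁻¹ * (z.1 + z.2)| ^ q with hΔ
  have cr : Continuous fun t : ℝ => t ^ q := Real.continuous_rpow_const hq0.le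
  have hΔc : Continuous Δ := by
    have c1 : Continuous fun z : ℝ × ℝ => |z.1| ^ q := cr.comp (by fun_prop)
    have c2 : Continuous fun z : ℝ × ℝ => |z.2| ^ q := cr.comp (by fun_prop)
    have c3 : Continuous fun z : ℝ × ℝ => |2⁻¹ * (z.1 + z.2)| ^ q :=
      cr.comp (g := fun t : ℝ => t ^ q) (f := fun z : ℝ × ℝ => |2⁻¹ * (z.1 + z.2)|) (by fun_prop)
    exact (continuous_const.mul (c1.add c2)).sub c3
  have hDc : Continuous fun z : ℝ × ℝ => |z.1 - z.2| ^ q :=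
    cr.comp (g := fun t : ℝ => t ^ q) (f := fun z : ℝ × ℝ => |z.1 - z.2|) (by fun_prop)
  have hΔ0 : ∀ z, 0 ≤ Δ z := fun z => sub_nonneg.2 (abs_half_add_rpow_le hq z.1 z.2)
  set S : Set (ℝ × ℝ) := Metric.sphere 0 1 ∩ {z | ε ≤ |z.1 - z.2| ^ q} with hS
  have hScomp : IsCompact S :=
    (isCompact_sphere _ _).inter_right (isClosed_le continuous_const hDc)
  obtain ⟨C, hC0, hC⟩ : ∃ C, 0 ≤ C ∧ ∀ z ∈ S, |z.1 - z.2| ^ q ≤ C * Δ z := by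
    rcases S.eq_empty_or_nonempty with h | h
    · exact ⟨0, le_rfl, by simp [h]⟩
    · have hpos : ∀ z ∈ S, 0 < Δ z := by
        intro z hz
        refine sub_pos.2 (abs_half_add_rpow_lt hq fun h => ?_)
        have : ε ≤ |z.1 - z.2| ^ q := hz.2
        rw [h, sub_self, abs_zero, Real.zero_rpow hq0.ne'] at this
        linarith
      obtain ⟨z₀, hz₀, hmax⟩ := hScomp.exists_isMaxOn h
        (f := fun z => |z.1 - z.2| ^ q / Δ z)
        (hDc.continuousOn.div hΔc.continuousOn fun z hz => (hpos z hz).ne')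
      refine ⟨|z₀.1 - z₀.2| ^ q / Δ z₀, div_nonneg (by positivity) (hpos z₀ hz₀).le,
        fun z hz => ?_⟩
      rw [← div_le_iff₀ (hpos z hz)]
      exact hmax hz
  have hsphere : ∀ z : ℝ × ℝ, ‖z‖ = 1 → |z.1 - z.2| ^ q ≤
      ε * (|z.1| ^ q + |z.2| ^ q) + C * Δ z := by
    intro z hz
    by_cases h : ε ≤ |z.1 - z.2| ^ q
    · have := hC z ⟨by simpa using hz, h⟩
      have : 0 ≤ ε * (|z.1| ^ q + |z.2| ^ q) := by positivity
      linarith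
    · have h1 : 1 ≤ |z.1| ^ q + |z.2| ^ q := by
        have p1 : 0 ≤ |z.1| ^ q := by positivity
        have p2 : 0 ≤ |z.2| ^ q := by positivity
        rw [Prod.norm_def] at hz
        rcases max_choice ‖z.1‖ ‖z.2‖ with h' | h' <;> rw [h', Real.norm_eq_abs] at hz <;>
          rw [hz, Real.one_rpow] <;> linarith
      have h2 := mul_nonneg hC0 (hΔ0 z)
      nlinarith
  refine ⟨C, hC0, fun a b => ?_⟩
  set z : ℝ × ℝ := (a, b) with hz
  by_cases h0 : z = 0
  · have ha : a = 0 := congrArg Prod.fst h0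
    have hb : b = 0 := congrArg Prod.snd h0
    simp [ha, hb, Real.zero_rpow hq0.ne']
  have hn : 0 < ‖z‖ := norm_pos_iff.2 h0
  have h := hsphere (‖z‖⁻¹ • z) (norm_smul_inv_norm (𝕜 := ℝ) h0)
  have hs : ∀ t : ℝ, |‖z‖⁻¹ * t| ^ q = (‖z‖⁻¹) ^ q * |t| ^ q := fun t => by
    rw [abs_mul, abs_of_pos (inv_pos.2 hn), Real.mul_rpow (by positivity) (abs_nonneg _)]
  have hp : 0 < (‖z‖⁻¹) ^ q := by positivity
  simp only [hΔ, Prod.smul_fst, Prod.smul_snd, smul_eq_mul, ← mul_sub, ← mul_add] at h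
  rw [mul_left_comm 2⁻¹, hs, hs, hs, hs] at h
  simp only [hz] at h
  rw [hz] at hp
  refine le_of_mul_le_mul_left (h.trans (le_of_eq ?_)) hp
  ring

end Convexity

section Lq

variable {X : Type*} [MeasurableSpace X] {μ : Measure X} {q : ℝ}

theorem integrable_abs_rpow (hq : 0 < q) {f : X → ℝ} (hf : MemLp f (ENNReal.ofReal q) μ) :
    Integrable (fun x => |f x| ^ q) μ := by
  have := hf.integrable_norm_rpow (by simpa using hq) ENNReal.ofReal_ne_top
  rwa [ENNReal.toReal_ofReal hq.le] at this

theorem Lp_norm_rpow (hq : 0 < q) (f : Lp ℝ (ENNReal.ofReal q) μ) :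
    ‖f‖ ^ q = ∫ x, |f x| ^ q ∂μ := by
  have h := (Lp.memLp f).eLpNorm_eq_integral_rpow_norm (by simpa using hq) ENNReal.ofReal_ne_top
  rw [ENNReal.toReal_ofReal hq.le] at h
  have hI : 0 ≤ ∫ x, ‖f x‖ ^ q ∂μ := integral_nonneg fun x => by positivity
  rw [Lp.norm_def, h, ENNReal.toReal_ofReal (by positivity), ← Real.rpow_mul hI,
    inv_mul_cancel₀ hq.ne', Real.rpow_one]
  simp only [Real.norm_eq_abs]

theorem lintegral_ofReal_rpow (hq : 0 < q) (f : Lp ℝ (ENNReal.ofReal q) μ) (hf : 0 ≤ᵐ[μ] f) :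
    ∫⁻ x, ENNReal.ofReal (f x) ^ q ∂μ = ENNReal.ofReal (‖f‖ ^ q) := by
  rw [Lp_norm_rpow hq, ofReal_integral_eq_lintegral_ofReal (integrable_abs_rpow hq (Lp.memLp f))
    (ae_of_all _ fun x => by positivity)]
  refine lintegral_congr_ae ?_
  filter_upwards [hf] with x hx
  have hx' : 0 ≤ f x := hx
  rw [ENNReal.ofReal_rpow_of_nonneg hx' hq.le, abs_of_nonneg hx']

theorem Lp_half_add_ae (f g : Lp ℝ (ENNReal.ofReal q) μ) :
    ((2⁻¹ : ℝ) • (f + g) : Lp ℝ (ENNReal.ofReal q) μ) =ᵐ[μ] fun x => 2⁻¹ * (f x + g x) := by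
  filter_upwards [Lp.coeFn_smul (2⁻¹ : ℝ) (f + g), Lp.coeFn_add f g] with x h1 h2
  rw [h1, Pi.smul_apply, h2, Pi.add_apply, smul_eq_mul]

theorem exists_norm_sub_rpow_le (hq : 1 < q) {ε : ℝ} (hε : 0 < ε) :
    ∃ C, 0 ≤ C ∧ ∀ f g : Lp ℝ (ENNReal.ofReal q) μ, ‖f - g‖ ^ q ≤ ε * (‖f‖ ^ q + ‖g‖ ^ q) +
      C * (2⁻¹ * (‖f‖ ^ q + ‖g‖ ^ q) - ‖(2⁻¹ : ℝ) • (f + g)‖ ^ q) := by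
  have hq0 : 0 < q := by linarith
  obtain ⟨C, hC0, hC⟩ := exists_abs_sub_rpow_le hq hε
  refine ⟨C, hC0, fun f g => ?_⟩
  have i1 := integrable_abs_rpow hq0 (Lp.memLp f)
  have i2 := integrable_abs_rpow hq0 (Lp.memLp g)
  have i3 := integrable_abs_rpow hq0 (Lp.memLp ((2⁻¹ : ℝ) • (f + g)))
  rw [Lp_norm_rpow hq0, Lp_norm_rpow hq0, Lp_norm_rpow hq0, Lp_norm_rpow hq0]
  have i12 : Integrable (fun x => |f x| ^ q + |g x| ^ q) μ := i1.add i2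
  have i4 : Integrable (fun x => ε * (|f x| ^ q + |g x| ^ q)) μ := i12.const_mul ε
  have i5 : Integrable (fun x => 2⁻¹ * (|f x| ^ q + |g x| ^ q) -
      |((2⁻¹ : ℝ) • (f + g) : Lp ℝ (ENNReal.ofReal q) μ) x| ^ q) μ :=
    (i12.const_mul _).sub i3
  have e : ε * (∫ x, |f x| ^ q ∂μ + ∫ x, |g x| ^ q ∂μ) +
      C * (2⁻¹ * (∫ x, |f x| ^ q ∂μ + ∫ x, |g x| ^ q ∂μ) -
        ∫ x, |((2⁻¹ : ℝ) • (f + g) : Lp ℝ (ENNReal.ofReal q) μ) x| ^ q ∂μ) =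
      ∫ x, (ε * (|f x| ^ q + |g x| ^ q) + C * (2⁻¹ * (|f x| ^ q + |g x| ^ q) -
      |((2⁻¹ : ℝ) • (f + g) : Lp ℝ (ENNReal.ofReal q) μ) x| ^ q)) ∂μ := by
    rw [integral_add i4 (i5.const_mul C), integral_const_mul, integral_const_mul,
      integral_sub (i12.const_mul _) i3, integral_const_mul, integral_add i1 i2]
  rw [e]
  refine integral_mono_ae (integrable_abs_rpow hq0 (Lp.memLp (f - g)))
    (i4.add (i5.const_mul C)) ?_
  filter_upwards [Lp_half_add_ae f g, Lp.coeFn_sub f g] with x h1 h2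
  rw [h1, h2, Pi.sub_apply]
  exact hC (f x) (g x)

variable [Fact (1 ≤ ENNReal.ofReal q)]

/-- A sequence in `L^q` is a Cauchy sequence if its norms converge to `m` and the norms of its
midpoints are bounded below by a sequence that converges to `m`. -/
theorem cauchySeq_of_norm_half_add (hq : 1 < q) {Y : ℕ → Lp ℝ (ENNReal.ofReal q) μ} {e : ℕ → ℝ}
    {m : ℝ} (he0 : ∀ n, 0 ≤ e n) (hY : Tendsto (fun n => ‖Y n‖) atTop (𝓝 m))
    (he : Tendsto e atTop (𝓝 m)) (hmid : ∀ N i j, N ≤ i → N ≤ j →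
      e N ≤ ‖(2⁻¹ : ℝ) • (Y i + Y j)‖) : CauchySeq Y := by
  have hq0 : 0 < q := by linarith
  have hm : 0 ≤ m := ge_of_tendsto' he he0
  have hY' : Tendsto (fun n => ‖Y n‖ ^ q) atTop (𝓝 (m ^ q)) :=
    ((Real.continuous_rpow_const hq0.le).tendsto m).comp hY
  have he' : Tendsto (fun n => e n ^ q) atTop (𝓝 (m ^ q)) :=
    ((Real.continuous_rpow_const hq0.le).tendsto m).comp he
  rw [Metric.cauchySeq_iff]
  intro ε hε
  have hmq : 0 ≤ m ^ q := by positivity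
  have hεq : 0 < ε ^ q := by positivity
  obtain ⟨C, hC0, hC⟩ := exists_norm_sub_rpow_le (μ := μ) hq
    (ε := ε ^ q / (8 * (m ^ q + 1))) (by positivity)
  set η : ℝ := min 1 (ε ^ q / (8 * (C + 1))) with hη
  have hη0 : 0 < η := lt_min one_pos (by positivity)
  obtain ⟨N₁, hN₁⟩ := eventually_atTop.1 (hY'.eventually (gt_mem_nhds (lt_add_of_pos_right _ hη0)))
  obtain ⟨N₂, hN₂⟩ := eventually_atTop.1 (he'.eventually (lt_mem_nhds (sub_lt_self _ hη0)))
  refine ⟨max N₁ N₂, fun i hi j hj => ?_⟩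
  have a1 := hN₁ i (le_trans (le_max_left _ _) hi)
  have a2 := hN₁ j (le_trans (le_max_left _ _) hj)
  have a3 := hN₂ (max N₁ N₂) (le_max_right _ _)
  have a4 := Real.rpow_le_rpow (he0 _) (hmid (max N₁ N₂) i j hi hj) hq0.le
  have a5 := hC (Y i) (Y j)
  have b1 : η ≤ 1 := min_le_left _ _
  have b2 : η * (8 * (C + 1)) ≤ ε ^ q := by
    rw [← le_div_iff₀ (by positivity)]; exact min_le_right _ _
  rw [dist_eq_norm]
  refine lt_of_not_ge fun hcon => ?_
  have a6 := Real.rpow_le_rpow hε.le hcon hq0.le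
  have a7 : ε ^ q / (8 * (m ^ q + 1)) * (‖Y i‖ ^ q + ‖Y j‖ ^ q) ≤ ε ^ q / 4 := by
    calc _ ≤ ε ^ q / (8 * (m ^ q + 1)) * (2 * (m ^ q + 1)) := by gcongr; linarith
      _ = ε ^ q / 4 := by field_simp; norm_num
  have a8 : C * (2⁻¹ * (‖Y i‖ ^ q + ‖Y j‖ ^ q) - ‖(2⁻¹ : ℝ) • (Y i + Y j)‖ ^ q) ≤
      C * (2 * η) := by gcongr; linarith
  nlinarith

/-- The closure of a nonempty convex subset of `L^q` contains a point whose norm is the distance of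
the set from `0`. -/
theorem exists_mem_closure_norm_eq (hq : 1 < q) {K : Set (Lp ℝ (ENNReal.ofReal q) μ)}
    (hK : Convex ℝ K) (hne : K.Nonempty) : ∃ k ∈ closure K, ‖k‖ = Metric.infDist 0 K := by
  have h : ∀ n : ℕ, ∃ b ∈ K, ‖b‖ < Metric.infDist 0 K + 1 / ((n : ℝ) + 1) := fun n => by
    obtain ⟨b, hb, hb'⟩ := (Metric.infDist_lt_iff hne).1
      (lt_add_of_pos_right (Metric.infDist 0 K) (Nat.one_div_pos_of_nat (n := n) (α := ℝ)))
    exact ⟨b, hb, by simpa using hb'⟩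
  choose Y hYK hY using h
  have hge : ∀ b ∈ K, Metric.infDist 0 K ≤ ‖b‖ := fun b hb => by
    simpa using Metric.infDist_le_dist_of_mem (x := (0 : Lp ℝ (ENNReal.ofReal q) μ)) hb
  have hlim : Tendsto (fun n => ‖Y n‖) atTop (𝓝 (Metric.infDist 0 K)) := by
    refine tendsto_of_tendsto_of_tendsto_of_le_of_le tendsto_const_nhds ?_
      (fun n => hge _ (hYK n)) (fun n => (hY n).le)
    simpa using tendsto_const_nhds.add (tendsto_one_div_add_atTop_nhds_zero_nat (𝕜 := ℝ))
  have hc : CauchySeq Y := cauchySeq_of_norm_half_add hq (e := fun _ => Metric.infDist 0 K)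
    (fun _ => Metric.infDist_nonneg) hlim tendsto_const_nhds fun N i j _ _ => by
      refine hge _ ?_
      rw [smul_add]
      exact hK (hYK i) (hYK j) (by norm_num) (by norm_num) (by norm_num)
  obtain ⟨k, hk⟩ := cauchySeq_tendsto_of_complete hc
  exact ⟨k, mem_closure_of_tendsto hk (Eventually.of_forall hYK),
    tendsto_nhds_unique hk.norm hlim⟩

end Lq

/-! ### First variation of the `L^q` energy -/

section FirstVariation

/-- The power `t ^ q` lies above its tangents. -/
theorem rpow_add_mul_sub_le {q : ℝ} (hq : 1 < q) {x y : ℝ} (hx : 0 ≤ x) (hy : 0 ≤ y) :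
    x ^ q + q * x ^ (q - 1) * (y - x) ≤ y ^ q := by
  rcases hx.eq_or_lt with h | h
  · rw [← h, Real.zero_rpow (by linarith), Real.zero_rpow (by linarith)]
    simpa using by positivity
  · have h1 := one_add_mul_self_le_rpow_one_add (s := y / x - 1) (by
      have : 0 ≤ y / x := by positivity
      linarith) hq.le
    rw [add_sub_cancel, Real.div_rpow hy hx, le_div_iff₀ (by positivity)] at h1
    refine le_trans (le_of_eq ?_) h1
    rw [show x ^ q = x ^ (q - 1) * x by
      rw [← Real.rpow_add_one h.ne', sub_add_cancel]]
    field_simp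

variable {X : Type*} [MeasurableSpace X] {μ : Measure X} {q : ℝ}

theorem integrable_rpow_mul (hq : 1 < q) {g d : X → ℝ} (hg : MemLp g (ENNReal.ofReal q) μ)
    (hg0 : ∀ᵐ x ∂μ, 0 ≤ g x) (hd : MemLp d (ENNReal.ofReal q) μ) :
    Integrable (fun x => g x ^ (q - 1) * d x) μ := by
  have hsum := integrable_abs_rpow (by linarith) (hg.norm.add hd.norm)
  refine hsum.mono' ((hg.1.aemeasurable.pow_const _).mul hd.1.aemeasurable).aestronglyMeasurable ?_
  filter_upwards [hg0] with x hx
  have h1 := abs_nonneg (d x)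
  rw [Real.norm_eq_abs, abs_mul, abs_of_nonneg (Real.rpow_nonneg hx _)]
  simp only [Pi.add_apply, Real.norm_eq_abs, abs_of_nonneg hx]
  rw [abs_of_nonneg (add_nonneg hx h1)]
  rcases (add_nonneg hx h1).eq_or_lt with h | h
  · have e1 : g x = 0 := by linarith
    have e2 : |d x| = 0 := by linarith
    rw [e1, e2]; simp [Real.zero_rpow (show q ≠ 0 by linarith)]
  · calc g x ^ (q - 1) * |d x| ≤ (g x + |d x|) ^ (q - 1) * (g x + |d x|) := by
          gcongr <;> linarith
      _ = _ := by rw [← Real.rpow_add_one h.ne', sub_add_cancel]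

/-- First variation of `∫ G^q`: an inequality for the difference quotients in the direction `D`
passes to the derivative. -/
theorem integral_rpow_mul_nonneg_of_forall (hq : 1 < q) {G D : X → ℝ}
    (hG : MemLp G (ENNReal.ofReal q) μ) (hG0 : ∀ᵐ x ∂μ, 0 ≤ G x)
    (hD : MemLp D (ENNReal.ofReal q) μ) {τ₀ c : ℝ} (hτ₀ : 0 < τ₀)
    (hpos : ∀ τ, 0 < τ → τ ≤ τ₀ → ∀ᵐ x ∂μ, 0 ≤ G x + τ * D x)
    (hle : ∀ τ, 0 < τ → τ ≤ τ₀ →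
      ∫ x, G x ^ q ∂μ ≤ ∫ x, (G x + τ * D x) ^ q ∂μ + q * τ * c) :
    0 ≤ ∫ x, G x ^ (q - 1) * D x ∂μ + c := by
  have hq0 : 0 < q := by linarith
  set τ : ℕ → ℝ := fun n => min 1 τ₀ * (1 / ((n : ℝ) + 1)) with hτ
  have hm : 0 < min 1 τ₀ := lt_min one_pos hτ₀
  have hτ0 : ∀ n, 0 < τ n := fun n => mul_pos hm Nat.one_div_pos_of_nat
  have h1n : ∀ n : ℕ, 1 / ((n : ℝ) + 1) ≤ 1 := fun n => by
    rw [div_le_one (by positivity)]; linarith [n.cast_nonneg (α := ℝ)]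
  have hτm : ∀ n, τ n ≤ min 1 τ₀ := fun n => mul_le_of_le_one_right hm.le (h1n n)
  have hτlim : Tendsto τ atTop (𝓝 0) := by
    simpa [hτ] using (tendsto_one_div_add_atTop_nhds_zero_nat (𝕜 := ℝ)).const_mul (min 1 τ₀)
  have hz : ∀ n, MemLp (fun x => G x + τ n * D x) (ENNReal.ofReal q) μ := fun n =>
    hG.add (hD.const_mul (τ n))
  have hp := fun n => hpos (τ n) (hτ0 n) ((hτm n).trans (min_le_right _ _))
  have hint : ∀ n, Integrable (fun x => (G x + τ n * D x) ^ (q - 1) * D x) μ := fun n =>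
    integrable_rpow_mul hq (hz n) (hp n) hD
  have hIG : Integrable (fun x => G x ^ q) μ := (integrable_abs_rpow hq0 hG).congr
    (hG0.mono fun x hx => by simp only [abs_of_nonneg hx])
  have hIz : ∀ n, Integrable (fun x => (G x + τ n * D x) ^ q) μ := fun n =>
    (integrable_abs_rpow hq0 (hz n)).congr ((hp n).mono fun x hx => by simp only [abs_of_nonneg hx])
  have key : ∀ n, 0 ≤ ∫ x, (G x + τ n * D x) ^ (q - 1) * D x ∂μ + c := by
    intro n
    have h1 := hle (τ n) (hτ0 n) ((hτm n).trans (min_le_right _ _))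
    have h2 : ∫ x, (G x + τ n * D x) ^ q ∂μ - ∫ x, G x ^ q ∂μ ≤
        ∫ x, q * τ n * ((G x + τ n * D x) ^ (q - 1) * D x) ∂μ := by
      rw [← integral_sub (hIz n) hIG]
      refine integral_mono_ae ((hIz n).sub hIG) ((hint n).const_mul _) ?_
      filter_upwards [hG0, hp n] with x h3 h4
      have := rpow_add_mul_sub_le hq h4 h3
      nlinarith
    rw [integral_const_mul] at h2
    have h3 : 0 < q * τ n := mul_pos hq0 (hτ0 n)
    -- by convexity, the derivative at `G + τ D` dominates the difference quotient
    refine nonneg_of_mul_nonneg_right (a := q * τ n) ?_ h3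
    linarith
  have hlim : Tendsto (fun n => ∫ x, (G x + τ n * D x) ^ (q - 1) * D x ∂μ) atTop
      (𝓝 (∫ x, G x ^ (q - 1) * D x ∂μ)) := by
    refine tendsto_integral_of_dominated_convergence
      (fun x => (|G x| + |D x|) ^ (q - 1) * (|D x|)) (fun n => (hint n).1) ?_ (fun n => ?_) ?_
    · exact integrable_rpow_mul hq (hG.norm.add hD.norm) (ae_of_all _ fun x => by
        positivity) hD.norm
    · filter_upwards [hp n] with x hx
      rw [Real.norm_eq_abs, abs_mul, abs_of_nonneg (Real.rpow_nonneg hx _)]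
      refine mul_le_mul_of_nonneg_right (Real.rpow_le_rpow hx ?_ (by linarith)) (abs_nonneg _)
      have h1 : τ n * D x ≤ 1 * |D x| := by
        refine (le_abs_self _).trans ?_
        rw [abs_mul, abs_of_pos (hτ0 n)]
        exact mul_le_mul_of_nonneg_right ((hτm n).trans (min_le_left _ _)) (abs_nonneg _)
      linarith [le_abs_self (G x)]
    · refine ae_of_all _ fun x => ?_
      have h1 : Tendsto (fun n => G x + τ n * D x) atTop (𝓝 (G x)) := by
        simpa using (hτlim.mul_const (D x)).const_add (G x)
      exact (((Real.continuous_rpow_const (by linarith)).tendsto (G x)).comp h1).mul_const _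
  exact ge_of_tendsto' (hlim.add_const c) key

variable [Fact (1 ≤ ENNReal.ofReal q)]

/-- Variational inequality for the point of minimal norm of a convex set of nonnegative
functions. -/
theorem norm_rpow_le_integral_of_minimal (hq : 1 < q) {K : Set (Lp ℝ (ENNReal.ofReal q) μ)}
    (hK : Convex ℝ K) (hpos : ∀ b ∈ K, 0 ≤ᵐ[μ] b) {k : Lp ℝ (ENNReal.ofReal q) μ}
    (hk0 : 0 ≤ᵐ[μ] k) (hk : k ∈ closure K) (hkn : ‖k‖ = Metric.infDist 0 K)
    {b : Lp ℝ (ENNReal.ofReal q) μ} (hb : b ∈ K) :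
    ‖k‖ ^ q ≤ ∫ x, k x ^ (q - 1) * b x ∂μ := by
  have hq0 : 0 < q := by linarith
  have hkL := Lp.memLp k
  have hbL := Lp.memLp b
  have hne : K.Nonempty := ⟨b, hb⟩
  have hab : ∀ τ : ℝ, τ ≤ 1 → 0 < τ → ∀ᵐ x ∂μ, 0 ≤ k x + τ * (b x - k x) := by
    intro τ h1 h0
    filter_upwards [hk0, hpos b hb] with x hx1 hx2
    have hx1' : 0 ≤ k x := hx1
    have hx2' : 0 ≤ b x := hx2
    have := mul_nonneg h0.le hx2'
    have := mul_nonneg (sub_nonneg.2 h1) hx1'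
    linarith
  have hkk : (fun x => |k x| ^ q) =ᵐ[μ] fun x => k x ^ q := hk0.mono fun x hx => by
    simp only [abs_of_nonneg (show 0 ≤ k x from hx)]
  have h := integral_rpow_mul_nonneg_of_forall hq hkL hk0 (hbL.sub hkL) (τ₀ := 1) (c := 0) one_pos
    (fun τ h0 h1 => by simpa using hab τ h1 h0) (fun τ h0 h1 => ?_)
  · have e : ∫ x, k x ^ (q - 1) * (b x - k x) ∂μ =
        ∫ x, k x ^ (q - 1) * b x ∂μ - ‖k‖ ^ q := by
      rw [Lp_norm_rpow hq0, integral_congr_ae hkk, ← integral_sub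
        (integrable_rpow_mul hq hkL hk0 hbL)
        ((integrable_abs_rpow hq0 hkL).congr hkk)]
      refine integral_congr_ae ?_
      filter_upwards [hk0] with x hx
      rcases (show 0 ≤ k x from hx).eq_or_lt with h | h
      · rw [← h, Real.zero_rpow (by linarith), Real.zero_rpow (by linarith)]; simp
      · rw [mul_sub, ← Real.rpow_add_one h.ne', sub_add_cancel]
    simp only [Pi.sub_apply] at h
    linarith
  · set z : Lp ℝ (ENNReal.ofReal q) μ := (1 - τ) • k + τ • b with hz
    have hzK : z ∈ closure K := hK.closure hk (subset_closure hb) (by linarith) h0.le (by ring)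
    have hzn : ‖k‖ ≤ ‖z‖ := by
      rw [hkn, ← Metric.infDist_closure]
      simpa using Metric.infDist_le_dist_of_mem (x := (0 : Lp ℝ (ENNReal.ofReal q) μ)) hzK
    have h2 := Real.rpow_le_rpow (norm_nonneg _) hzn hq0.le
    rw [Lp_norm_rpow hq0, Lp_norm_rpow hq0, integral_congr_ae hkk] at h2
    refine h2.trans (le_of_eq ?_)
    rw [mul_zero, add_zero]
    refine integral_congr_ae ?_
    filter_upwards [hab τ h1 h0, Lp.coeFn_add ((1 - τ) • k) (τ • b), Lp.coeFn_smul (1 - τ) k,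
      Lp.coeFn_smul τ b] with x h3 h4 h5 h6
    simp only [hz, h4, Pi.add_apply, h5, h6, Pi.smul_apply, smul_eq_mul, Pi.sub_apply]
    rw [show (1 - τ) * k x + τ * b x = k x + τ * (b x - k x) by ring, abs_of_nonneg h3]

/-- Lower semicontinuity along weak convergence, tested with the power `k^{q-1}` of the
minimizer `k`: this replaces Mazur's lemma. -/
theorem infDist_le_norm_of_tendstoWeakly (hq : 1 < q) {K : Set (Lp ℝ (ENNReal.ofReal q) μ)}
    (hK : Convex ℝ K) (hpos : ∀ b ∈ K, 0 ≤ᵐ[μ] b) {B : ℕ → X → ℝ} {G : X → ℝ}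
    (hB : ∀ᶠ n in atTop, ∃ b ∈ K, b =ᵐ[μ] B n) (hw : TendstoWeakly q μ B G)
    {g : Lp ℝ (ENNReal.ofReal q) μ} (hg : G ≤ᵐ[μ] g) : Metric.infDist 0 K ≤ ‖g‖ := by
  have hq0 : 0 < q := by linarith
  obtain ⟨n₀, b₀, hb₀, -⟩ := hB.exists
  obtain ⟨k, hk, hkn⟩ := exists_mem_closure_norm_eq hq hK ⟨b₀, hb₀⟩
  have hk0 : 0 ≤ᵐ[μ] k := by
    have hsub : closure K ⊆ Ici 0 := closure_minimal
      (fun b hb => (Lp.coeFn_nonneg b).1 (hpos b hb)) isClosed_Ici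
    exact (Lp.coeFn_nonneg k).2 (hsub hk)
  have hkL := Lp.memLp k
  have hh : MemLp (fun x => k x ^ (q - 1)) (ENNReal.ofReal q.conjExponent) μ := by
    have hc : 0 < q.conjExponent := by unfold Real.conjExponent; exact div_pos hq0 (by linarith)
    have hm : AEStronglyMeasurable (fun x => k x ^ (q - 1)) μ :=
      (hkL.1.aemeasurable.pow_const _).aestronglyMeasurable
    rw [← integrable_norm_rpow_iff hm (by simpa using hc) ENNReal.ofReal_ne_top,
      ENNReal.toReal_ofReal hc.le]
    refine (integrable_abs_rpow hq0 hkL).congr ?_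
    filter_upwards [hk0] with x hx
    have hx' : 0 ≤ k x := hx
    rw [Real.norm_eq_abs, abs_of_nonneg hx', abs_of_nonneg (by positivity), ← Real.rpow_mul hx']
    congr 1
    rw [Real.conjExponent, mul_div_cancel₀]
    linarith
  have h1 := hw.2.2 _ hh
  have h2 : ‖k‖ ^ q ≤ ∫ x, G x * k x ^ (q - 1) ∂μ := by
    refine ge_of_tendsto h1 ?_
    filter_upwards [hB] with n hn
    obtain ⟨b, hb, hbB⟩ := hn
    refine (norm_rpow_le_integral_of_minimal hq hK hpos hk0 hk hkn hb).trans (le_of_eq ?_)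
    refine integral_congr_ae ?_
    filter_upwards [hbB] with x hx
    rw [hx, mul_comm]
  have h3 : q * ∫ x, G x * k x ^ (q - 1) ∂μ ≤ ‖g‖ ^ q + (q - 1) * ‖k‖ ^ q := by
    have i1 := integrable_abs_rpow hq0 (Lp.memLp g)
    have i2 := integrable_abs_rpow hq0 hkL
    rw [Lp_norm_rpow hq0, Lp_norm_rpow hq0, ← integral_const_mul, ← integral_const_mul,
      ← integral_add i1 (i2.const_mul _)]
    refine integral_mono_ae (((integrable_rpow_mul hq hkL hk0 hw.2.1).congr
      (ae_of_all _ fun x => mul_comm _ _)).const_mul q) (i1.add (i2.const_mul _)) ?_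
    filter_upwards [hg, hk0] with x h4 h5
    have h5' : 0 ≤ k x := h5
    have h6 := rpow_add_mul_sub_le hq h5' (abs_nonneg (g x))
    have h7 : 0 ≤ k x ^ (q - 1) := by positivity
    have h8 : k x ^ (q - 1) * k x = k x ^ q := by
      rcases h5'.eq_or_lt with h | h
      · rw [← h, Real.zero_rpow (by linarith), Real.zero_rpow (by linarith)]; simp
      · rw [← Real.rpow_add_one h.ne', sub_add_cancel]
    have h9 := mul_le_mul_of_nonneg_right (h4.trans (le_abs_self (g x))) h7
    rw [abs_of_nonneg h5']
    nlinarith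
  have h4 : ‖k‖ ^ q ≤ ‖g‖ ^ q := by nlinarith
  rw [← hkn]
  exact (Real.rpow_le_rpow_iff (norm_nonneg _) (norm_nonneg _) hq0).1 h4

end FirstVariation

/-! ### The Cheeger energy -/

section LqAux

variable {X : Type*} [MeasurableSpace X] {μ : Measure X} {q : ℝ}

theorem tendsto_integral_mul_of_tendsto_eLpNorm (hq : 1 < q) {B : ℕ → X → ℝ} {G h : X → ℝ}
    (hB : ∀ n, MemLp (B n) (ENNReal.ofReal q) μ) (hG : MemLp G (ENNReal.ofReal q) μ)
    (hlim : Tendsto (fun n => eLpNorm (B n - G) (ENNReal.ofReal q) μ) atTop (𝓝 0))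
    (hh : MemLp h (ENNReal.ofReal q.conjExponent) μ) :
    Tendsto (fun n => ∫ x, B n x * h x ∂μ) atTop (𝓝 (∫ x, G x * h x ∂μ)) := by
  have : ENNReal.HolderConjugate (ENNReal.ofReal q) (ENNReal.ofReal q.conjExponent) :=
    (Real.HolderConjugate.conjExponent hq).ennrealOfReal
  refine tendsto_integral_of_L1' (fun x => G x * h x) (hG.integrable_mul hh).1
    (Eventually.of_forall fun n => (hB n).integrable_mul hh) ?_
  have hle : ∀ n, eLpNorm ((fun x => B n x * h x) - fun x => G x * h x) 1 μ ≤
      eLpNorm (B n - G) (ENNReal.ofReal q) μ * eLpNorm h (ENNReal.ofReal q.conjExponent) μ := by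
    intro n
    have e : ((fun x => B n x * h x) - fun x => G x * h x) = (B n - G) • h := by
      funext x; simp [sub_mul]
    rw [e]
    exact eLpNorm_smul_le_mul_eLpNorm hh.1 ((hB n).1.sub hG.1)
  refine tendsto_of_tendsto_of_tendsto_of_le_of_le tendsto_const_nhds ?_
    (fun _ => zero_le) hle
  simpa using ENNReal.Tendsto.mul_const hlim (Or.inr hh.2.ne)

theorem eLpNorm_le_eLpNorm_iff_norm_le {f g : Lp ℝ (ENNReal.ofReal q) μ} :
    eLpNorm f (ENNReal.ofReal q) μ ≤ eLpNorm g (ENNReal.ofReal q) μ ↔ ‖f‖ ≤ ‖g‖ := by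
  rw [Lp.norm_def, Lp.norm_def, ENNReal.toReal_le_toReal (Lp.memLp f).2.ne (Lp.memLp g).2.ne]

end LqAux

section Cheeger

variable {X : Type*} [MetricSpace X] [MeasurableSpace X] {μ : Measure X} {q : ℝ}

/-- The `L^q` upper bounds for the slopes of the Lipschitz functions at `L²`-distance at most `δ`
from `f`. Allowing upper bounds, and not only the slopes themselves, makes the set convex. -/
def slopeSet (q : ℝ) (μ : Measure X) (f : Lp ℝ 2 μ) (δ : ℝ) : Set (Lp ℝ (ENNReal.ofReal q) μ) :=
  {b | ∃ (F : X → ℝ) (K : ℝ≥0), LipschitzWith K F ∧ MemLp F 2 μ ∧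
    eLpNorm (fun x => F x - f x) 2 μ ≤ ENNReal.ofReal δ ∧ ∀ᵐ x ∂μ, lipSlope F x ≤ b x}

/-- `F` consists of Lipschitz functions that converge to `f` in `L²` and whose slopes converge
strongly to `G` in `L^q`. -/
structure IsSlopeApprox (q : ℝ) (μ : Measure X) (f : Lp ℝ 2 μ) (F : ℕ → X → ℝ) (G : X → ℝ) :
    Prop where
  lipschitz : ∀ n, ∃ K : ℝ≥0, LipschitzWith K (F n)
  memLp_two : ∀ n, MemLp (F n) 2 μ
  tendsto : Tendsto (fun n => eLpNorm (fun x => F n x - f x) 2 μ) atTop (𝓝 0)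
  memLp_slope : ∀ n, MemLp (lipSlope (F n)) (ENNReal.ofReal q) μ
  memLp : MemLp G (ENNReal.ofReal q) μ
  tendsto_slope : Tendsto (fun n => eLpNorm (lipSlope (F n) - G) (ENNReal.ofReal q) μ) atTop (𝓝 0)

theorem slopeSet_mono {f : Lp ℝ 2 μ} {δ δ' : ℝ} (h : δ ≤ δ') :
    slopeSet q μ f δ ⊆ slopeSet q μ f δ' := by
  rintro b ⟨F, K, hF, hF2, hFf, hb⟩
  exact ⟨F, K, hF, hF2, hFf.trans (ENNReal.ofReal_le_ofReal h), hb⟩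

theorem nonneg_of_mem_slopeSet {f : Lp ℝ 2 μ} {δ : ℝ} {b : Lp ℝ (ENNReal.ofReal q) μ}
    (hb : b ∈ slopeSet q μ f δ) : 0 ≤ᵐ[μ] b := by
  obtain ⟨F, K, -, -, -, h⟩ := hb
  exact h.mono fun x hx => (lipSlope_nonneg F x).trans hx

theorem convex_slopeSet (f : Lp ℝ 2 μ) (δ : ℝ) : Convex ℝ (slopeSet q μ f δ) := by
  rintro b ⟨F, K, hF, hF2, hFf, hb⟩ b' ⟨F', K', hF', hF2', hFf', hb'⟩ s t hs ht hst
  have hl : LipschitzWith (‖s‖₊ * K + ‖t‖₊ * K') (fun x => s * F x + t * F' x) :=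
    ((lipschitzWith_smul s).comp hF).add ((lipschitzWith_smul t).comp hF')
  refine ⟨fun x => s * F x + t * F' x, _, hl, (hF2.const_mul s).add (hF2'.const_mul t), ?_, ?_⟩
  · have e : (fun x => s * F x + t * F' x - f x) =
        (s • fun x => F x - f x) + (t • fun x => F' x - f x) := by
      funext x
      simp only [Pi.add_apply, Pi.smul_apply, smul_eq_mul]
      linear_combination f x * hst
    rw [e]
    refine (eLpNorm_add_le ((hF2.1.sub (Lp.memLp f).1).const_smul s)
      ((hF2'.1.sub (Lp.memLp f).1).const_smul t) (by norm_num)).trans ?_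
    rw [eLpNorm_const_smul, eLpNorm_const_smul, Real.enorm_of_nonneg hs, Real.enorm_of_nonneg ht]
    calc _ ≤ ENNReal.ofReal s * ENNReal.ofReal δ + ENNReal.ofReal t * ENNReal.ofReal δ :=
          add_le_add (mul_le_mul' le_rfl hFf) (mul_le_mul' le_rfl hFf')
      _ = ENNReal.ofReal δ := by
        rw [← add_mul, ← ENNReal.ofReal_add hs ht, hst, ENNReal.ofReal_one, one_mul]
  · filter_upwards [hb, hb', Lp.coeFn_add (s • b) (t • b'), Lp.coeFn_smul s b,
      Lp.coeFn_smul t b'] with x h1 h2 h3 h4 h5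
    refine (lipSlope_add_smul_le hF hF' hs ht x).trans ?_
    simp only [h3, Pi.add_apply, h4, h5, Pi.smul_apply, smul_eq_mul]
    gcongr

theorem toLp_mem_slopeSet {f : Lp ℝ 2 μ} {δ : ℝ} {F B : X → ℝ} {K : ℝ≥0} (hF : LipschitzWith K F)
    (hF2 : MemLp F 2 μ) (hFf : eLpNorm (fun x => F x - f x) 2 μ ≤ ENNReal.ofReal δ)
    (hB : MemLp B (ENNReal.ofReal q) μ) (hFB : ∀ᵐ x ∂μ, lipSlope F x ≤ B x) :
    hB.toLp B ∈ slopeSet q μ f δ :=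
  ⟨F, K, hF, hF2, hFf, by filter_upwards [hFB, hB.coeFn_toLp] with x h1 h2; rwa [h2]⟩

theorem infDist_slopeSet_le {f : Lp ℝ 2 μ} {δ : ℝ} [Fact (1 ≤ ENNReal.ofReal q)]
    {b : Lp ℝ (ENNReal.ofReal q) μ} (hb : b ∈ slopeSet q μ f δ) :
    Metric.infDist 0 (slopeSet q μ f δ) ≤ ‖b‖ := by
  simpa using Metric.infDist_le_dist_of_mem (x := (0 : Lp ℝ (ENNReal.ofReal q) μ)) hb

/-- If the approximate energies of `f` stay bounded, a sequence of Lipschitz functions of almost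
minimal energy has strongly converging slopes, by uniform convexity. The limit has the least
possible norm. -/
theorem exists_isSlopeApprox_of_infDist_le [BorelSpace X] [Fact (1 ≤ ENNReal.ofReal q)]
    (hq : 1 < q) {f : Lp ℝ 2 μ} {C : ℝ}
    (h : ∀ δ > 0, (slopeSet q μ f δ).Nonempty ∧ Metric.infDist 0 (slopeSet q μ f δ) ≤ C) :
    ∃ (F : ℕ → X → ℝ) (G : Lp ℝ (ENNReal.ofReal q) μ), IsSlopeApprox q μ f F G ∧ 0 ≤ᵐ[μ] G ∧
      ∀ D, (∀ δ > 0, Metric.infDist 0 (slopeSet q μ f δ) ≤ D) → ‖G‖ ≤ D := by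
  set r : ℕ → ℝ := fun n => 1 / ((n : ℝ) + 1) with hr
  have hr0 : ∀ n, 0 < r n := fun n => Nat.one_div_pos_of_nat
  have hra : Antitone r := fun i j hij => Nat.one_div_le_one_div hij
  have hrlim : Tendsto r atTop (𝓝 0) := tendsto_one_div_add_atTop_nhds_zero_nat
  set e : ℕ → ℝ := fun n => Metric.infDist 0 (slopeSet q μ f (r n)) with he
  have hemono : Monotone e := fun i j hij =>
    Metric.infDist_le_infDist_of_subset (slopeSet_mono (hra hij)) (h _ (hr0 j)).1
  have hebdd : BddAbove (range e) := ⟨C, by rintro _ ⟨n, rfl⟩; exact (h _ (hr0 n)).2⟩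
  have helim := tendsto_atTop_ciSup hemono hebdd
  set m := ⨆ n, e n with hm
  have hex : ∀ n, ∃ F : X → ℝ, (∃ K : ℝ≥0, LipschitzWith K F) ∧ MemLp F 2 μ ∧
      eLpNorm (fun x => F x - f x) 2 μ ≤ ENNReal.ofReal (r n) ∧
      ∃ hF : MemLp (lipSlope F) (ENNReal.ofReal q) μ, ‖hF.toLp (lipSlope F)‖ ≤ e n + r n := by
    intro n
    obtain ⟨b, ⟨F, K, hF, hF2, hFf, hb⟩, hbn⟩ := (Metric.infDist_lt_iff (h _ (hr0 n)).1).1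
      (lt_add_of_pos_right (e n) (hr0 n))
    rw [dist_zero_left] at hbn
    have hle : ∀ᵐ x ∂μ, ‖lipSlope F x‖ ≤ ‖b x‖ := hb.mono fun x hx => by
      rw [Real.norm_eq_abs, Real.norm_eq_abs, abs_of_nonneg (lipSlope_nonneg F x)]
      exact hx.trans (le_abs_self _)
    have hFq : MemLp (lipSlope F) (ENNReal.ofReal q) μ := (Lp.memLp b).mono
      (measurable_lipSlope hF.continuous).aestronglyMeasurable hle
    refine ⟨F, ⟨K, hF⟩, hF2, hFf, hFq, le_trans ?_ hbn.le⟩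
    refine Lp.norm_le_norm_of_ae_le ?_
    filter_upwards [hle, hFq.coeFn_toLp] with x h1 h2
    rwa [h2]
  choose F hFl hF2 hFf hFq hFn using hex
  set Y : ℕ → Lp ℝ (ENNReal.ofReal q) μ := fun n => (hFq n).toLp (lipSlope (F n)) with hY
  have hYmem : ∀ N n, N ≤ n → Y n ∈ slopeSet q μ f (r N) := fun N n hn => by
    obtain ⟨K, hK⟩ := hFl n
    exact toLp_mem_slopeSet hK (hF2 n) ((hFf n).trans (ENNReal.ofReal_le_ofReal (hra hn))) _
      (ae_of_all _ fun x => le_rfl)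
  have hYlim : Tendsto (fun n => ‖Y n‖) atTop (𝓝 m) := by
    refine tendsto_of_tendsto_of_tendsto_of_le_of_le helim ?_
      (fun n => infDist_slopeSet_le (hYmem n n le_rfl)) hFn
    simpa using helim.add hrlim
  -- the midpoint of `Y i` and `Y j` stays in the convex set `slopeSet q μ f (r N)`
  have hc : CauchySeq Y := cauchySeq_of_norm_half_add hq (e := e)
    (fun _ => Metric.infDist_nonneg) hYlim helim fun N i j hi hj => by
      refine infDist_slopeSet_le ?_
      rw [smul_add]
      exact convex_slopeSet f (r N) (hYmem N i hi) (hYmem N j hj) (by norm_num)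
        (by norm_num) (by norm_num)
  obtain ⟨G, hG⟩ := cauchySeq_tendsto_of_complete hc
  have hGn : ‖G‖ = m := tendsto_nhds_unique hG.norm hYlim
  refine ⟨F, G, ⟨hFl, hF2, ?_, hFq, Lp.memLp G, ?_⟩, ?_, fun D hD => ?_⟩
  · refine tendsto_of_tendsto_of_tendsto_of_le_of_le tendsto_const_nhds ?_
      (fun _ => zero_le) hFf
    simpa using ENNReal.tendsto_ofReal hrlim
  · have := (Lp.tendsto_Lp_iff_tendsto_eLpNorm' Y G).1 hG
    refine this.congr fun n => eLpNorm_congr_ae ?_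
    filter_upwards [(hFq n).coeFn_toLp] with x hx
    simp [hY, hx]
  · refine (Lp.coeFn_nonneg G).2 ?_
    exact (isClosed_Ici (a := (0 : Lp ℝ (ENNReal.ofReal q) μ))).mem_of_tendsto hG
      (Eventually.of_forall fun n =>
        (Lp.coeFn_nonneg (Y n)).1 (nonneg_of_mem_slopeSet (hYmem n n le_rfl)))
  · rw [hGn]
    exact ciSup_le fun n => hD _ (hr0 n)

theorem IsSlopeApprox.isRelaxedSlope (hq : 1 < q) {f : Lp ℝ 2 μ} {F : ℕ → X → ℝ} {G : X → ℝ}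
    (h : IsSlopeApprox q μ f F G) : IsRelaxedSlope q μ f G :=
  ⟨h.memLp, F, G, h.lipschitz, h.memLp_two, h.tendsto, ⟨h.memLp_slope, h.memLp, fun _ hφ =>
    tendsto_integral_mul_of_tendsto_eLpNorm hq h.memLp_slope h.memLp h.tendsto_slope hφ⟩,
    EventuallyLE.rfl⟩

theorem eventually_mem_slopeSet {f : Lp ℝ 2 μ} {F B : ℕ → X → ℝ}
    (hF : ∀ n, ∃ K : ℝ≥0, LipschitzWith K (F n)) (hF2 : ∀ n, MemLp (F n) 2 μ)
    (hlim : Tendsto (fun n => eLpNorm (fun x => F n x - f x) 2 μ) atTop (𝓝 0))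
    (hB : ∀ n, MemLp (B n) (ENNReal.ofReal q) μ) (hFB : ∀ n, ∀ᵐ x ∂μ, lipSlope (F n) x ≤ B n x)
    {δ : ℝ} (hδ : 0 < δ) : ∀ᶠ n in atTop, (hB n).toLp (B n) ∈ slopeSet q μ f δ := by
  filter_upwards [hlim.eventually (ge_mem_nhds (ENNReal.ofReal_pos.2 hδ))] with n hn
  obtain ⟨K, hK⟩ := hF n
  exact toLp_mem_slopeSet hK (hF2 n) hn _ (hFB n)

/-- The norm of a relaxed slope bounds the approximate energies of `f`. -/
theorem IsRelaxedSlope.nonempty_and_infDist_le (hq : 1 < q) [Fact (1 ≤ ENNReal.ofReal q)]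
    {f : Lp ℝ 2 μ} {g : Lp ℝ (ENNReal.ofReal q) μ} (h : IsRelaxedSlope q μ f g) {δ : ℝ}
    (hδ : 0 < δ) :
    (slopeSet q μ f δ).Nonempty ∧ Metric.infDist 0 (slopeSet q μ f δ) ≤ ‖g‖ := by
  obtain ⟨-, F, G, hF, hF2, hlim, hw, hG⟩ := h
  have hev := eventually_mem_slopeSet hF hF2 hlim hw.1
    (fun n => ae_of_all _ fun x => le_rfl) hδ
  obtain ⟨n, hn⟩ := hev.exists
  exact ⟨⟨_, hn⟩, infDist_le_norm_of_tendstoWeakly hq (convex_slopeSet f δ)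
    (fun b hb => nonneg_of_mem_slopeSet hb)
    (hev.mono fun n hn => ⟨_, hn, (hw.1 n).coeFn_toLp⟩) hw hG⟩

theorem IsRelaxedSlope.congr {f : Lp ℝ 2 μ} {g g' : X → ℝ} (h : IsRelaxedSlope q μ f g)
    (hg : g =ᵐ[μ] g') : IsRelaxedSlope q μ f g' := by
  obtain ⟨h1, F, G, hF, hF2, hlim, hw, hG⟩ := h
  exact ⟨h1.ae_eq hg, F, G, hF, hF2, hlim, hw, hG.trans hg.le⟩

/-- Existence and uniqueness of the minimal relaxed slope, and its approximation by slopes of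
Lipschitz functions in the strong topology. -/
theorem exists_isSlopeApprox_relaxedSlope [BorelSpace X] [Fact (1 ≤ ENNReal.ofReal q)]
    (hq : 1 < q) {f : Lp ℝ 2 μ} {C : ℝ}
    (h : ∀ δ > 0, (slopeSet q μ f δ).Nonempty ∧ Metric.infDist 0 (slopeSet q μ f δ) ≤ C) :
    ∃ (F : ℕ → X → ℝ) (G : Lp ℝ (ENNReal.ofReal q) μ), IsSlopeApprox q μ f F G ∧ 0 ≤ᵐ[μ] G ∧
      ‖G‖ ≤ C ∧ relaxedSlope q μ f =ᵐ[μ] fun x => ENNReal.ofReal (G x) := by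
  have hq0 : 0 < q := by linarith
  obtain ⟨F, G, hFG, hG0, hGmin⟩ := exists_isSlopeApprox_of_infDist_le hq h
  have hmin : IsMinimalRelaxedSlope q μ f G := by
    refine ⟨hFG.isRelaxedSlope hq, fun g' hg' => ?_⟩
    have hg'L := hg'.congr hg'.1.coeFn_toLp.symm
    have := hGmin _ fun δ hδ => (hg'L.nonempty_and_infDist_le hq hδ).2
    rw [← eLpNorm_le_eLpNorm_iff_norm_le] at this
    rwa [eLpNorm_congr_ae hg'.1.coeFn_toLp] at this
  have huniq : ∀ g : X → ℝ, IsMinimalRelaxedSlope q μ f g → g =ᵐ[μ] G := by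
    intro g hg
    set gL : Lp ℝ (ENNReal.ofReal q) μ := hg.1.1.toLp g with hgL
    have hgLe : gL =ᵐ[μ] g := hg.1.1.coeFn_toLp
    have hn : ‖gL‖ ≤ ‖G‖ := by
      rw [← eLpNorm_le_eLpNorm_iff_norm_le, eLpNorm_congr_ae hgLe]
      exact hg.2 _ hmin.1
    -- the midpoint of two minimal slopes is again a relaxed slope, hence not shorter
    have hmid : ‖G‖ ≤ ‖(2⁻¹ : ℝ) • (gL + G)‖ := by
      refine hGmin _ fun δ hδ => ?_
      obtain ⟨-, F', G', hF', hF2', hlim', hw', hG'⟩ := hg.1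
      have hev := eventually_mem_slopeSet hF' hF2' hlim' hw'.1
        (fun n => ae_of_all _ fun x => le_rfl) hδ
      have hev' := eventually_mem_slopeSet hFG.lipschitz hFG.memLp_two hFG.tendsto
        hFG.memLp_slope (fun n => ae_of_all _ fun x => le_rfl) hδ
      refine infDist_le_norm_of_tendstoWeakly hq (convex_slopeSet f δ)
        (fun b hb => nonneg_of_mem_slopeSet hb)
        (B := fun n x => 2⁻¹ * ((localLip (F' n) x).toReal + lipSlope (F n) x))
        (G := fun x => 2⁻¹ * (G' x + G x)) ?_ ⟨fun n => ?_, ?_, fun φ hφ => ?_⟩ ?_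
      · filter_upwards [hev, hev'] with n h1 h2
        refine ⟨_, convex_slopeSet f δ h1 h2 (by norm_num : (0 : ℝ) ≤ 2⁻¹)
          (by norm_num : (0 : ℝ) ≤ 2⁻¹) (by norm_num), ?_⟩
        rw [← smul_add]
        filter_upwards [Lp_half_add_ae ((hw'.1 n).toLp _) ((hFG.memLp_slope n).toLp _),
          (hw'.1 n).coeFn_toLp, (hFG.memLp_slope n).coeFn_toLp] with x h3 h4 h5
        rw [h3, h4, h5]
      · exact ((hw'.1 n).add (hFG.memLp_slope n)).const_mul _
      · exact (hw'.2.1.add hFG.memLp).const_mul _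
      · have : ENNReal.HolderConjugate (ENNReal.ofReal q) (ENNReal.ofReal q.conjExponent) :=
          (Real.HolderConjugate.conjExponent hq).ennrealOfReal
        have l1 := hw'.2.2 φ hφ
        have l2 := tendsto_integral_mul_of_tendsto_eLpNorm hq hFG.memLp_slope hFG.memLp
          hFG.tendsto_slope hφ
        have e : ∀ u v : X → ℝ, MemLp u (ENNReal.ofReal q) μ → MemLp v (ENNReal.ofReal q) μ →
            2⁻¹ * (∫ x, u x * φ x ∂μ + ∫ x, v x * φ x ∂μ) =
            ∫ x, 2⁻¹ * (u x + v x) * φ x ∂μ := by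
          intro u v hu hv
          have := integral_add (hu.integrable_mul hφ) (hv.integrable_mul hφ)
          simp only [Pi.mul_apply] at this
          rw [← this, ← integral_const_mul]
          congr 1; funext x; ring
        rw [← e _ _ hw'.2.1 hFG.memLp]
        exact ((l1.add l2).const_mul 2⁻¹).congr fun n => e _ _ (hw'.1 n) (hFG.memLp_slope n)
      · filter_upwards [Lp_half_add_ae gL G, hG', hgLe] with x h1 h2 h3
        rw [h1, h3]; linarith
    have hz : ‖gL - G‖ ^ q ≤ 0 := by
      refine le_of_forall_pos_le_add fun ε hε => ?_
      obtain ⟨C', hC0, hC'⟩ := exists_norm_sub_rpow_le (μ := μ) hq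
        (ε := ε / (2 * ‖G‖ ^ q + 1)) (by positivity)
      have h1 := hC' gL G
      have h2 := Real.rpow_le_rpow (norm_nonneg _) hn hq0.le
      have h3 := Real.rpow_le_rpow (norm_nonneg _) hmid hq0.le
      have h4 : ε / (2 * ‖G‖ ^ q + 1) * (‖gL‖ ^ q + ‖G‖ ^ q) ≤ ε := by
        rw [div_mul_eq_mul_div, div_le_iff₀ (by positivity)]
        have : 0 ≤ ‖G‖ ^ q := by positivity
        nlinarith
      have h5 : C' * (2⁻¹ * (‖gL‖ ^ q + ‖G‖ ^ q) - ‖(2⁻¹ : ℝ) • (gL + G)‖ ^ q) ≤ 0 :=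
        mul_nonpos_of_nonneg_of_nonpos hC0 (by linarith)
      linarith
    have hzero : ‖gL - G‖ = 0 := by
      by_contra hne
      have : 0 < ‖gL - G‖ := lt_of_le_of_ne (norm_nonneg _) (Ne.symm hne)
      have := Real.rpow_pos_of_pos this q
      linarith
    rw [norm_eq_zero, sub_eq_zero] at hzero
    rw [← hzero]
    exact hgLe.symm
  refine ⟨F, G, hFG, hG0, hGmin C fun δ hδ => (h δ hδ).2, ?_⟩
  have hex : ∃ g : X → ℝ, IsMinimalRelaxedSlope q μ f g := ⟨G, hmin⟩
  rw [relaxedSlope, dif_pos hex]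
  filter_upwards [huniq _ hex.choose_spec] with x hx
  rw [hx]

theorem cheeger_eq_of_ae_eq (hq : 1 < q) {f : Lp ℝ 2 μ} {G : Lp ℝ (ENNReal.ofReal q) μ}
    (hG0 : 0 ≤ᵐ[μ] G) (h : relaxedSlope q μ f =ᵐ[μ] fun x => ENNReal.ofReal (G x)) :
    cheeger q μ f = ENNReal.ofReal (1 / q * ‖G‖ ^ q) := by
  have hq0 : 0 < q := by linarith
  rw [cheeger, ENNReal.ofReal_mul (by positivity), ← lintegral_ofReal_rpow hq0 G hG0]
  congr 1
  exact lintegral_congr_ae (h.mono fun x hx => by simp only [hx])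

/-- A function of finite energy is approximated by Lipschitz functions whose slopes converge
strongly to the minimal relaxed slope. -/
theorem exists_isSlopeApprox_of_cheeger_ne_top [BorelSpace X] (hq : 1 < q) {f : Lp ℝ 2 μ}
    (hf : cheeger q μ f ≠ ∞) :
    ∃ (F : ℕ → X → ℝ) (G : X → ℝ), IsSlopeApprox q μ f F G ∧ (∀ᵐ x ∂μ, 0 ≤ G x) ∧
      (relaxedSlope q μ f =ᵐ[μ] fun x => ENNReal.ofReal (G x)) ∧
      (cheeger q μ f).toReal = 1 / q * ∫ x, G x ^ q ∂μ := by
  have hq0 : 0 < q := by linarith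
  have : Fact (1 ≤ ENNReal.ofReal q) := ⟨by simpa using hq.le⟩
  obtain ⟨C, hC⟩ : ∃ C : ℝ, ∀ δ > 0, (slopeSet q μ f δ).Nonempty ∧
      Metric.infDist 0 (slopeSet q μ f δ) ≤ C := by
    by_cases hex : ∃ g : X → ℝ, IsMinimalRelaxedSlope q μ f g
    · obtain ⟨g, hg⟩ := hex
      exact ⟨_, fun δ hδ => (hg.1.congr hg.1.1.coeFn_toLp.symm).nonempty_and_infDist_le hq hδ⟩
    · -- without a minimal slope the energy is `∞ * μ univ`, so that `μ = 0`
      have hμ : μ = 0 := by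
        by_contra hμ
        refine hf ?_
        rw [cheeger, relaxedSlope, dif_neg hex]
        rw [ENNReal.top_rpow_of_pos hq0, lintegral_const,
          ENNReal.top_mul (by simpa using hμ), ENNReal.mul_top]
        simpa using hq0
      subst hμ
      exact ⟨0, fun δ hδ => ⟨⟨0, 0, 0, LipschitzWith.const 0, by simp, by simp, by simp⟩,
        (infDist_slopeSet_le (b := 0) ⟨0, 0, LipschitzWith.const 0, by simp, by simp,
          by simp⟩).trans (by simp)⟩⟩
  obtain ⟨F, G, hFG, hG0, -, hGs⟩ := exists_isSlopeApprox_relaxedSlope hq hC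
  refine ⟨F, G, hFG, hG0, hGs, ?_⟩
  rw [cheeger_eq_of_ae_eq hq hG0 hGs, ENNReal.toReal_ofReal (by positivity), Lp_norm_rpow hq0]
  congr 1
  refine integral_congr_ae (hG0.mono fun x hx => ?_)
  simp only [abs_of_nonneg (show 0 ≤ G x from hx)]

/-- The energy is bounded by the limit of the energies of any Lipschitz approximation. -/
theorem cheeger_le_of_tendsto [BorelSpace X] (hq : 1 < q) {f : Lp ℝ 2 μ} {F B : ℕ → X → ℝ}
    {G : X → ℝ} (hF : ∀ n, ∃ K : ℝ≥0, LipschitzWith K (F n)) (hF2 : ∀ n, MemLp (F n) 2 μ)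
    (hlim : Tendsto (fun n => eLpNorm (fun x => F n x - f x) 2 μ) atTop (𝓝 0))
    (hB : ∀ n, MemLp (B n) (ENNReal.ofReal q) μ) (hFB : ∀ n, ∀ᵐ x ∂μ, lipSlope (F n) x ≤ B n x)
    (hG : MemLp G (ENNReal.ofReal q) μ)
    (hBG : Tendsto (fun n => eLpNorm (B n - G) (ENNReal.ofReal q) μ) atTop (𝓝 0)) :
    cheeger q μ f ≠ ∞ ∧ (cheeger q μ f).toReal ≤ 1 / q * ∫ x, |G x| ^ q ∂μ := by
  have hq0 : 0 < q := by linarith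
  have : Fact (1 ≤ ENNReal.ofReal q) := ⟨by simpa using hq.le⟩
  have hlimL := ((Lp.tendsto_Lp_iff_tendsto_eLpNorm'' B hB G hG).2 hBG).norm
  have h : ∀ δ > 0, (slopeSet q μ f δ).Nonempty ∧
      Metric.infDist 0 (slopeSet q μ f δ) ≤ ‖hG.toLp G‖ := by
    intro δ hδ
    have hev := eventually_mem_slopeSet hF hF2 hlim hB hFB hδ
    obtain ⟨n, hn⟩ := hev.exists
    exact ⟨⟨_, hn⟩, ge_of_tendsto hlimL (hev.mono fun n hn => infDist_slopeSet_le hn)⟩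
  obtain ⟨F', G', -, hG0, hGn, hGs⟩ := exists_isSlopeApprox_relaxedSlope hq h
  rw [cheeger_eq_of_ae_eq hq hG0 hGs, ENNReal.toReal_ofReal (by positivity)]
  refine ⟨ENNReal.ofReal_ne_top, ?_⟩
  gcongr
  have h1 := Real.rpow_le_rpow (norm_nonneg _) hGn hq0.le
  rw [Lp_norm_rpow hq0 (hG.toLp G)] at h1
  refine h1.trans (le_of_eq (integral_congr_ae ?_))
  filter_upwards [hG.coeFn_toLp] with x hx
  rw [hx]

end Cheeger

/-! ### Test functions and the functionals they generate -/

/-- Dominated convergence in `L^q`. -/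
theorem tendsto_eLpNorm_of_dominated {X : Type*} [MeasurableSpace X] {μ : Measure X} {q : ℝ}
    (hq : 0 < q) {h : ℕ → X → ℝ} {g : X → ℝ} (hm : ∀ n, AEStronglyMeasurable (h n) μ)
    (hg : MemLp g (ENNReal.ofReal q) μ) (hle : ∀ n, ∀ᵐ x ∂μ, |h n x| ≤ |g x|)
    (hlim : ∀ᵐ x ∂μ, Tendsto (fun n => h n x) atTop (𝓝 0)) :
    Tendsto (fun n => eLpNorm (h n) (ENNReal.ofReal q) μ) atTop (𝓝 0) := by
  have hq0 : ENNReal.ofReal q ≠ 0 := by simpa using hq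
  have e : ∀ n, eLpNorm (h n) (ENNReal.ofReal q) μ =
      (∫⁻ x, ‖h n x‖ₑ ^ q ∂μ) ^ (1 / q) := fun n => by
    rw [eLpNorm_eq_lintegral_rpow_enorm_toReal hq0 ENNReal.ofReal_ne_top,
      ENNReal.toReal_ofReal hq.le]
  have hfin := lintegral_rpow_enorm_lt_top_of_eLpNorm_lt_top hq0 ENNReal.ofReal_ne_top hg.2
  rw [ENNReal.toReal_ofReal hq.le] at hfin
  have h1 : Tendsto (fun n => ∫⁻ x, ‖h n x‖ₑ ^ q ∂μ) atTop (𝓝 (∫⁻ _, 0 ∂μ)) := by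
    refine tendsto_lintegral_of_dominated_convergence' (fun x => ‖g x‖ₑ ^ q)
      (fun n => (hm n).enorm.pow_const q) (fun n => ?_) hfin.ne ?_
    · filter_upwards [hle n] with x hx
      refine ENNReal.rpow_le_rpow ?_ hq.le
      rwa [enorm_le_iff_norm_le, Real.norm_eq_abs, Real.norm_eq_abs]
    · filter_upwards [hlim] with x hx
      have h2 := (hx.enorm).ennrpow_const q
      simpa [ENNReal.zero_rpow_of_pos hq] using h2
  simp only [e]
  have h2 := h1.ennrpow_const (1 / q)
  simpa [ENNReal.zero_rpow_of_pos (inv_pos.2 hq)] using h2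

section TestFunctions

variable {X : Type*} [MetricSpace X] [MeasurableSpace X] {μ : Measure X} {q : ℝ}

/-- The data of a test function `c · entropyDeriv b (w x) (f x) + u x`: a Lipschitz shift
`w ≥ w₀ > 0`, a Lipschitz function `u ∈ L²`, and a bound `B ∈ L^q` for the part of its slope that
does not come from `f`. -/
structure IsTestData (q : ℝ) (μ : Measure X) (b w₀ c : ℝ) (w u B : X → ℝ) : Prop where
  b_pos : 0 < b
  b_ne_one : b ≠ 1
  b_ne_two : b ≠ 2
  w₀_pos : 0 < w₀
  c_nonneg : 0 ≤ c
  lipschitz_w : ∃ K : ℝ≥0, LipschitzWith K w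
  le_w : ∀ x, w₀ ≤ w x
  lipschitz_u : ∃ K : ℝ≥0, LipschitzWith K u
  memLp_u : MemLp u 2 μ
  memLp_B : MemLp B (ENNReal.ofReal q) μ
  le_B : ∀ x, c * (w x ^ (-b) * lipSlope w x) + lipSlope u x ≤ B x

/-- The test function `c · entropyDeriv b (w x) (f x) + u x`. -/
def testFun (b c : ℝ) (w u f : X → ℝ) (x : X) : ℝ := c * entropyDeriv b (w x) (f x) + u x

/-- The functional on `L²` with gradient `testFun b c w u`. -/
def testFunctional (μ : Measure X) (b c : ℝ) (w u : X → ℝ) (f : X → ℝ) : ℝ :=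
  ∫ x, (c * entropy b (w x) (f x) + u x * f x) ∂μ

theorem measurable_entropyDeriv (b : ℝ) :
    Measurable fun z : ℝ × ℝ => entropyDeriv b z.1 z.2 := by
  have hs : Measurable Real.sign := by
    unfold Real.sign
    exact Measurable.ite measurableSet_Iio measurable_const
      (Measurable.ite measurableSet_Ioi measurable_const measurable_const)
  unfold entropyDeriv
  exact (hs.comp measurable_snd).mul ((((continuous_abs.measurable.comp measurable_snd).add
    measurable_fst).pow_const _ |>.sub (measurable_fst.pow_const _)).div_const _)

theorem measurable_entropy (b : ℝ) : Measurable fun z : ℝ × ℝ => entropy b z.1 z.2 := by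
  have ha : Measurable fun z : ℝ × ℝ => |z.2| := continuous_abs.measurable.comp measurable_snd
  unfold entropy
  exact ((((ha.add measurable_fst).pow_const _).sub (measurable_fst.pow_const _)).div_const _).sub
    (((measurable_fst.pow_const _).mul ha).div_const _)

theorem measurable_entropyWeight (b : ℝ) :
    Measurable fun z : ℝ × ℝ => entropyWeight b z.1 z.2 := by
  unfold entropyWeight
  exact ((continuous_abs.measurable.comp measurable_snd).add measurable_fst).pow_const _

namespace IsTestData

variable {b w₀ c : ℝ} {w u B : X → ℝ} (T : IsTestData q μ b w₀ c w u B)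

include T

theorem w_pos (x : X) : 0 < w x := T.w₀_pos.trans_le (T.le_w x)

theorem rpow_w_le (x : X) : w x ^ (-b) ≤ w₀ ^ (-b) :=
  Real.rpow_le_rpow_of_nonpos T.w₀_pos (T.le_w x) (by linarith [T.b_pos])

theorem B_nonneg (x : X) : 0 ≤ B x := by
  refine le_trans ?_ (T.le_B x)
  have := T.w_pos x
  have := T.c_nonneg
  have := lipSlope_nonneg w x
  have := lipSlope_nonneg u x
  positivity

theorem abs_testFun_sub_le (f g : X → ℝ) (x : X) :
    |testFun b c w u g x - testFun b c w u f x| ≤ c * w₀ ^ (-b) * |g x - f x| := by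
  rw [testFun, testFun, add_sub_add_right_eq_sub, ← mul_sub, abs_mul, abs_of_nonneg T.c_nonneg,
    mul_assoc]
  refine mul_le_mul_of_nonneg_left ?_ T.c_nonneg
  refine (abs_entropyDeriv_sub_le T.b_pos T.b_ne_one (T.w_pos x) _ _).trans ?_
  exact mul_le_mul_of_nonneg_right (T.rpow_w_le x) (abs_nonneg _)

theorem lipschitzWith_testFun {F : X → ℝ} {K : ℝ≥0} (hF : LipschitzWith K F) :
    ∃ K' : ℝ≥0, LipschitzWith K' (testFun b c w u F) := by
  obtain ⟨Kw, hw⟩ := T.lipschitz_w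
  obtain ⟨Ku, hu⟩ := T.lipschitz_u
  obtain ⟨K', h⟩ := exists_lipschitzWith_entropyDeriv T.b_pos T.b_ne_one T.w₀_pos hw T.le_w hF
  exact ⟨_, ((lipschitzWith_smul c).comp h).add hu⟩

variable [BorelSpace X]

theorem measurable_w : Measurable w := by
  obtain ⟨K, hK⟩ := T.lipschitz_w
  exact hK.continuous.measurable

theorem memLp_testFun {f : X → ℝ} (hf : MemLp f 2 μ) : MemLp (testFun b c w u f) 2 μ := by
  have hm : AEStronglyMeasurable (fun x => c * entropyDeriv b (w x) (f x)) μ :=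
    (((measurable_entropyDeriv b).comp_aemeasurable
      (T.measurable_w.aemeasurable.prodMk hf.1.aemeasurable)).const_mul c).aestronglyMeasurable
  refine MemLp.add ((hf.const_mul (c * w₀ ^ (-b))).mono hm (ae_of_all _ fun x => ?_)) T.memLp_u
  have h1 := T.w₀_pos
  have h2 := T.c_nonneg
  rw [Real.norm_eq_abs, Real.norm_eq_abs, abs_mul, abs_mul, abs_of_nonneg h2,
    abs_of_nonneg (by positivity : 0 ≤ c * w₀ ^ (-b)), mul_assoc]
  refine mul_le_mul_of_nonneg_left ?_ h2
  exact (abs_entropyDeriv_le T.b_pos T.b_ne_one (T.w_pos x) _).trans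
    (mul_le_mul_of_nonneg_right (T.rpow_w_le x) (abs_nonneg _))

theorem integrable_testFunctional {f : X → ℝ} (hf : MemLp f 2 μ) :
    Integrable (fun x => c * entropy b (w x) (f x) + u x * f x) μ := by
  have hm : AEStronglyMeasurable (fun x => c * entropy b (w x) (f x)) μ :=
    (((measurable_entropy b).comp_aemeasurable
      (T.measurable_w.aemeasurable.prodMk hf.1.aemeasurable)).const_mul c).aestronglyMeasurable
  refine Integrable.add ((hf.integrable_sq.const_mul (c * w₀ ^ (-b))).mono' hm
    (ae_of_all _ fun x => ?_)) (T.memLp_u.integrable_mul hf)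
  have h2 := T.c_nonneg
  rw [Real.norm_eq_abs, abs_mul, abs_of_nonneg h2, mul_assoc,
    abs_of_nonneg (entropy_nonneg T.b_ne_one T.b_ne_two (T.w_pos x) _)]
  refine mul_le_mul_of_nonneg_left ?_ h2
  exact (entropy_le_sq T.b_pos T.b_ne_one T.b_ne_two (T.w_pos x) _).trans
    (mul_le_mul_of_nonneg_right (T.rpow_w_le x) (sq_nonneg _))

/-- Second-order Taylor estimate for `testFunctional`. -/
theorem abs_testFunctional_sub_le (f g : Lp ℝ 2 μ) :
    |testFunctional μ b c w u g - testFunctional μ b c w u f -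
      inner ℝ ((T.memLp_testFun (Lp.memLp f)).toLp _) (g - f)| ≤ c * w₀ ^ (-b) * ‖g - f‖ ^ 2 := by
  have i1 := T.integrable_testFunctional (Lp.memLp g)
  have i2 := T.integrable_testFunctional (Lp.memLp f)
  have hin : inner ℝ ((T.memLp_testFun (Lp.memLp f)).toLp _) (g - f) =
      ∫ x, testFun b c w u f x * (g x - f x) ∂μ := by
    rw [L2.inner_def]
    refine integral_congr_ae ?_
    filter_upwards [(T.memLp_testFun (Lp.memLp f)).coeFn_toLp, Lp.coeFn_sub g f] with x h1 h2
    rw [h1, h2]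
    simp [mul_comm]
  have i3 : Integrable (fun x => testFun b c w u f x * (g x - f x)) μ :=
    (T.memLp_testFun (Lp.memLp f)).integrable_mul ((Lp.memLp g).sub (Lp.memLp f))
  have hn : ‖g - f‖ ^ 2 = ∫ x, (g x - f x) ^ 2 ∂μ := by
    rw [← real_inner_self_eq_norm_sq, L2.inner_def]
    refine integral_congr_ae ?_
    filter_upwards [Lp.coeFn_sub g f] with x h
    rw [h]
    simp [sq]
  have i4 : Integrable (fun x => (g x - f x) ^ 2) μ :=
    ((Lp.memLp g).sub (Lp.memLp f)).integrable_sq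
  have i5 : Integrable (fun x => c * entropy b (w x) (g x) + u x * g x -
      (c * entropy b (w x) (f x) + u x * f x)) μ := i1.sub i2
  rw [hin, testFunctional, testFunctional, ← integral_sub i1 i2, ← integral_sub i5 i3, hn,
    ← integral_const_mul]
  refine (abs_integral_le_integral_abs).trans (integral_mono (i5.sub i3).abs
    (i4.const_mul _) fun x => ?_)
  have h1 := abs_entropy_sub_sub_le T.b_pos T.b_ne_one T.b_ne_two (T.w_pos x) (f x) (g x)
  have e : c * entropy b (w x) (g x) + u x * g x - (c * entropy b (w x) (f x) + u x * f x) -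
      testFun b c w u f x * (g x - f x) = c * (entropy b (w x) (g x) - entropy b (w x) (f x) -
        entropyDeriv b (w x) (f x) * (g x - f x)) := by
    rw [testFun]; ring
  simp only
  rw [e, abs_mul, abs_of_nonneg T.c_nonneg, mul_assoc]
  exact mul_le_mul_of_nonneg_left (h1.trans
    (mul_le_mul_of_nonneg_right (T.rpow_w_le x) (sq_nonneg _))) T.c_nonneg

theorem hasDerivAt_testFunctional {f : ℝ → Lp ℝ 2 μ} {f' : Lp ℝ 2 μ} {t : ℝ}
    (hf : HasDerivAt f f' t) :
    HasDerivAt (fun s => testFunctional μ b c w u (f s))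
      (inner ℝ ((T.memLp_testFun (Lp.memLp (f t))).toLp _) f') t := by
  have hF : HasFDerivAt (fun g : Lp ℝ 2 μ => testFunctional μ b c w u g)
      (innerSL ℝ ((T.memLp_testFun (Lp.memLp (f t))).toLp _)) (f t) := by
    rw [hasFDerivAt_iff_isLittleO]
    have h1 : (fun g : Lp ℝ 2 μ => testFunctional μ b c w u g - testFunctional μ b c w u (f t) -
        innerSL ℝ ((T.memLp_testFun (Lp.memLp (f t))).toLp _) (g - f t)) =O[𝓝 (f t)]
        fun g => ‖g - f t‖ ^ 2 := by
      refine Asymptotics.IsBigO.of_bound (c * w₀ ^ (-b)) (Eventually.of_forall fun g => ?_)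
      rw [innerSL_apply_apply, Real.norm_eq_abs, Real.norm_eq_abs,
        abs_of_nonneg (sq_nonneg ‖g - f t‖)]
      exact T.abs_testFunctional_sub_le (f t) g
    refine h1.trans_isLittleO ?_
    have h2 := Asymptotics.isLittleO_norm_pow_id (E' := Lp ℝ 2 μ) (n := 2) (by norm_num)
    have h3 : Tendsto (fun g : Lp ℝ 2 μ => g - f t) (𝓝 (f t)) (𝓝 0) := by
      have : Continuous fun g : Lp ℝ 2 μ => g - f t := continuous_id.sub continuous_const
      simpa using this.tendsto (f t)
    exact h2.comp_tendsto h3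
  have := hF.comp_hasDerivAt t hf
  rwa [innerSL_apply_apply] at this

theorem exists_lipschitzOnWith_testFunctional (R : ℝ) :
    ∃ K : ℝ≥0, LipschitzOnWith K (fun g : Lp ℝ 2 μ => testFunctional μ b c w u g)
      (Metric.closedBall 0 R) := by
  have hc := T.c_nonneg
  have hw := T.w₀_pos
  have hh : ∀ f : Lp ℝ 2 μ, ‖(T.memLp_testFun (Lp.memLp f)).toLp _‖ ≤
      c * w₀ ^ (-b) * ‖f‖ + ‖T.memLp_u.toLp u‖ := by
    intro f
    have h0 : ‖(T.memLp_testFun (Lp.memLp f)).toLp _ - T.memLp_u.toLp u‖ ≤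
        c * w₀ ^ (-b) * ‖f‖ := by
      refine Lp.norm_le_mul_norm_of_ae_le_mul ?_
      filter_upwards [Lp.coeFn_sub ((T.memLp_testFun (Lp.memLp f)).toLp _) (T.memLp_u.toLp u),
        (T.memLp_testFun (Lp.memLp f)).coeFn_toLp, T.memLp_u.coeFn_toLp] with x h1 h2 h3
      rw [h1, Pi.sub_apply, h2, h3]
      have := T.abs_testFun_sub_le (fun _ => 0) f x
      simpa [testFun] using this
    have := norm_le_insert' ((T.memLp_testFun (Lp.memLp f)).toLp _) (T.memLp_u.toLp u)
    linarith
  set M := c * w₀ ^ (-b) * |R| + ‖T.memLp_u.toLp u‖ + c * w₀ ^ (-b) * (2 * |R|) with hM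
  have hM0 : 0 ≤ M := by positivity
  refine ⟨M.toNNReal, LipschitzOnWith.of_dist_le_mul fun g hg f hf => ?_⟩
  rw [mem_closedBall_zero_iff] at hg hf
  have hg' := hg.trans (le_abs_self R)
  have hf' := hf.trans (le_abs_self R)
  rw [Real.coe_toNNReal _ hM0, Real.dist_eq, dist_eq_norm]
  have h1 := T.abs_testFunctional_sub_le f g
  have h2 := abs_real_inner_le_norm ((T.memLp_testFun (Lp.memLp f)).toLp _) (g - f)
  have h3 : ‖g - f‖ ≤ 2 * |R| := (norm_sub_le g f).trans (by linarith)
  have h4 : ‖(T.memLp_testFun (Lp.memLp f)).toLp _‖ ≤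
      c * w₀ ^ (-b) * |R| + ‖T.memLp_u.toLp u‖ := (hh f).trans (by gcongr)
  have h5 := abs_sub_abs_le_abs_sub (testFunctional μ b c w u g - testFunctional μ b c w u f)
    (inner ℝ ((T.memLp_testFun (Lp.memLp f)).toLp _) (g - f))
  have h6 : c * w₀ ^ (-b) * ‖g - f‖ ^ 2 ≤ c * w₀ ^ (-b) * (2 * |R|) * ‖g - f‖ := by
    rw [sq, mul_assoc (c * w₀ ^ (-b))]; gcongr
  have h7 := mul_le_mul_of_nonneg_right h4 (norm_nonneg (g - f))
  calc _ ≤ ‖(T.memLp_testFun (Lp.memLp f)).toLp _‖ * ‖g - f‖ +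
        c * w₀ ^ (-b) * ‖g - f‖ ^ 2 := by linarith
    _ ≤ _ := by rw [hM, add_mul]; linarith

end IsTestData

end TestFunctions

/-! ### Dissipation along subgradients -/

section Dissipation

variable {X : Type*} [MetricSpace X] [MeasurableSpace X] {μ : Measure X} {q : ℝ}

theorem IsSlopeApprox.exists_ae_tendsto {f : Lp ℝ 2 μ} {F : ℕ → X → ℝ} {G : X → ℝ}
    (h : IsSlopeApprox q μ f F G) : ∃ F' : ℕ → X → ℝ, IsSlopeApprox q μ f F' G ∧
      ∀ᵐ x ∂μ, Tendsto (fun n => F' n x) atTop (𝓝 (f x)) := by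
  have hm : TendstoInMeasure μ F atTop f := tendstoInMeasure_of_tendsto_eLpNorm (p := 2)
    (by norm_num) (fun n => (h.memLp_two n).1) (Lp.memLp f).1 h.tendsto
  obtain ⟨ns, hns, hlim⟩ := hm.exists_seq_tendsto_ae
  exact ⟨fun n => F (ns n), ⟨fun n => h.lipschitz _, fun n => h.memLp_two _,
    h.tendsto.comp hns.tendsto_atTop, fun n => h.memLp_slope _, h.memLp,
    h.tendsto_slope.comp hns.tendsto_atTop⟩, hlim⟩

variable [BorelSpace X]

namespace IsTestData

variable {b w₀ c : ℝ} {w u B : X → ℝ} (T : IsTestData q μ b w₀ c w u B)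

include T

/-- Moving from `f` against the test function changes the energy by no more than the chain rule
for smooth functions would give. -/
theorem cheeger_sub_le (hq : 1 < q) {f : Lp ℝ 2 μ} {F : ℕ → X → ℝ} {G : X → ℝ}
    (hFG : IsSlopeApprox q μ f F G) {τ : ℝ} (hτ : 0 ≤ τ)
    (hτ1 : τ * c * w₀ ^ (-b) ≤ 1) :
    let g := f - τ • (T.memLp_testFun (Lp.memLp f)).toLp _
    cheeger q μ g ≠ ∞ ∧ (cheeger q μ g).toReal ≤
      1 / q * ∫ x, |G x + τ * (B x - c * entropyWeight b (w x) (f x) * G x)| ^ q ∂μ := by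
  intro g
  have hq0 : 0 < q := by linarith
  obtain ⟨F, hF, hlim⟩ := hFG.exists_ae_tendsto
  have hτc : 0 ≤ τ * c := mul_nonneg hτ T.c_nonneg
  have hA : ∀ x r, τ * c * entropyWeight b (w x) r ≤ 1 := fun x r => le_trans
    (mul_le_mul_of_nonneg_left (entropyWeight_le_of_le T.b_pos T.w₀_pos (T.le_w x) r) hτc) hτ1
  have hA0 : ∀ x r, 0 ≤ τ * c * entropyWeight b (w x) r := fun x r =>
    mul_nonneg hτc (entropyWeight_nonneg (T.w_pos x) r)
  have hAm : ∀ φ : X → ℝ, AEStronglyMeasurable φ μ →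
      AEStronglyMeasurable (fun x => τ * c * entropyWeight b (w x) (φ x)) μ := fun φ hφ =>
    (((measurable_entropyWeight b).comp_aemeasurable
      (T.measurable_w.aemeasurable.prodMk hφ.aemeasurable)).const_mul _).aestronglyMeasurable
  have hAB : ∀ φ ψ : X → ℝ, AEStronglyMeasurable φ μ → MemLp ψ (ENNReal.ofReal q) μ →
      MemLp (fun x => (1 - τ * c * entropyWeight b (w x) (φ x)) * ψ x) (ENNReal.ofReal q) μ := by
    intro φ ψ hφ hψ
    refine hψ.mono ((aestronglyMeasurable_const.sub (hAm φ hφ)).mul hψ.1) (ae_of_all _ fun x => ?_)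
    rw [norm_mul, Real.norm_eq_abs]
    refine mul_le_of_le_one_left (norm_nonneg _) ?_
    rw [abs_le]
    constructor <;> linarith [hA x (φ x), hA0 x (φ x)]
  set B' : ℕ → X → ℝ := fun n x =>
    (1 - τ * c * entropyWeight b (w x) (F n x)) * lipSlope (F n) x + τ * B x with hB'
  set G' : X → ℝ := fun x => (1 - τ * c * entropyWeight b (w x) (f x)) * G x + τ * B x with hG'
  have hf2 := Lp.memLp f
  have hB'm : ∀ n, MemLp (B' n) (ENNReal.ofReal q) μ := fun n =>
    (hAB _ _ (hF.memLp_two n).1 (hF.memLp_slope n)).add (T.memLp_B.const_mul τ)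
  have hG'm : MemLp G' (ENNReal.ofReal q) μ := (hAB _ _ hf2.1 hF.memLp).add (T.memLp_B.const_mul τ)
  obtain ⟨Kw, hKw⟩ := T.lipschitz_w
  obtain ⟨Ku, hKu⟩ := T.lipschitz_u
  have hgae : ∀ᵐ x ∂μ, g x = f x - τ * testFun b c w u f x := by
    filter_upwards [Lp.coeFn_sub f (τ • (T.memLp_testFun hf2).toLp _),
      Lp.coeFn_smul τ ((T.memLp_testFun hf2).toLp _),
      (T.memLp_testFun hf2).coeFn_toLp] with x h1 h2 h3
    rw [h1, Pi.sub_apply, h2, Pi.smul_apply, h3, smul_eq_mul]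
  have hmain := cheeger_le_of_tendsto hq (f := g)
    (F := fun n x => F n x - τ * testFun b c w u (F n) x) (B := B') (G := G') (fun n => ?_)
    (fun n => ?_) ?_ hB'm (fun n => ae_of_all _ fun x => ?_) hG'm ?_
  · refine ⟨hmain.1, hmain.2.trans (le_of_eq ?_)⟩
    congr 2
    funext x
    rw [hG']
    congr 2
    ring
  · obtain ⟨K, hK⟩ := hF.lipschitz n
    obtain ⟨K', hK'⟩ := T.lipschitzWith_testFun hK
    exact ⟨_, hK.sub ((lipschitzWith_smul τ).comp hK')⟩
  · exact (hF.memLp_two n).sub ((T.memLp_testFun (hF.memLp_two n)).const_mul τ)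
  · -- `L²` convergence: the test function is Lipschitz in `f`
    have hle : ∀ n, eLpNorm (fun x => F n x - τ * testFun b c w u (F n) x - g x) 2 μ ≤
        ENNReal.ofReal (1 + τ * (c * w₀ ^ (-b))) * eLpNorm (fun x => F n x - f x) 2 μ := by
      intro n
      refine eLpNorm_le_mul_eLpNorm_of_ae_le_mul ?_ 2
      filter_upwards [hgae] with x hx
      rw [hx, Real.norm_eq_abs, Real.norm_eq_abs]
      have h1 := T.abs_testFun_sub_le f (F n) x
      have e : F n x - τ * testFun b c w u (F n) x - (f x - τ * testFun b c w u f x) =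
          (F n x - f x) - τ * (testFun b c w u (F n) x - testFun b c w u f x) := by ring
      rw [e]
      refine (abs_sub _ _).trans ?_
      rw [abs_mul, abs_of_nonneg hτ]
      nlinarith [mul_le_mul_of_nonneg_left h1 hτ]
    refine tendsto_of_tendsto_of_tendsto_of_le_of_le tendsto_const_nhds ?_
      (fun _ => zero_le) hle
    simpa using ENNReal.Tendsto.const_mul hF.tendsto (Or.inr ENNReal.ofReal_ne_top)
  · obtain ⟨K, hK⟩ := hF.lipschitz n
    have h1 := lipSlope_perturb_le T.b_pos T.b_ne_one hKw hKu hK (T.w_pos x) hτ T.c_nonneg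
      (le_trans (mul_le_mul_of_nonneg_left (T.rpow_w_le x) hτc) hτ1)
    refine h1.trans ?_
    rw [hB']
    have := mul_le_mul_of_nonneg_left (T.le_B x) hτ
    simp only
    linarith
  · -- convergence of the slope bounds: strongly converging slopes times bounded factors
    have h1 : Tendsto (fun n => eLpNorm (fun x => (τ * c * entropyWeight b (w x) (f x) -
        τ * c * entropyWeight b (w x) (F n x)) * G x) (ENNReal.ofReal q) μ) atTop (𝓝 0) := by
      refine tendsto_eLpNorm_of_dominated hq0 (g := G) (fun n =>
        ((hAm _ hf2.1).sub (hAm _ (hF.memLp_two n).1)).mul hF.memLp.1) hF.memLp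
        (fun n => ae_of_all _ fun x => ?_) ?_
      · rw [abs_mul]
        refine mul_le_of_le_one_left (abs_nonneg _) ?_
        rw [abs_le]
        constructor <;> linarith [hA x (f x), hA0 x (f x), hA x (F n x), hA0 x (F n x)]
      · filter_upwards [hlim] with x hx
        have hc : ContinuousAt (fun r => entropyWeight b (w x) r) (f x) :=
          (continuousAt_entropyWeight (T.w_pos x) (f x)).comp (f := fun s : ℝ => (w x, s))
            (by fun_prop)
        have h2 := (((hc.tendsto.comp hx).const_mul (τ * c)).const_sub
          (τ * c * entropyWeight b (w x) (f x))).mul_const (G x)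
        simpa using h2
    have hle : ∀ n, eLpNorm (B' n - G') (ENNReal.ofReal q) μ ≤
        eLpNorm (lipSlope (F n) - G) (ENNReal.ofReal q) μ +
        eLpNorm (fun x => (τ * c * entropyWeight b (w x) (f x) -
        τ * c * entropyWeight b (w x) (F n x)) * G x) (ENNReal.ofReal q) μ := by
      intro n
      have e : B' n - G' = (fun x => (1 - τ * c * entropyWeight b (w x) (F n x)) *
          (lipSlope (F n) x - G x)) + fun x => (τ * c * entropyWeight b (w x) (f x) -
        τ * c * entropyWeight b (w x) (F n x)) * G x := by
        funext x
        simp only [hB', hG', Pi.sub_apply, Pi.add_apply]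
        ring
      rw [e]
      refine (eLpNorm_add_le (hAB _ _ (hF.memLp_two n).1
        ((hF.memLp_slope n).sub hF.memLp)).1
        (((hAm _ hf2.1).sub (hAm _ (hF.memLp_two n).1)).mul hF.memLp.1)
        (by simpa using hq.le)).trans
        (add_le_add_left (eLpNorm_mono fun x => ?_) _)
      rw [norm_mul, Real.norm_eq_abs (1 - _)]
      refine mul_le_of_le_one_left (norm_nonneg _) ?_
      rw [abs_le]
      constructor <;> linarith [hA x (F n x), hA0 x (F n x)]
    refine tendsto_of_tendsto_of_tendsto_of_le_of_le tendsto_const_nhds ?_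
      (fun _ => zero_le) hle
    simpa using hF.tendsto_slope.add h1

/-- Testing the subdifferential inequality of the energy with `testFun` gives the formal
integration by parts as an inequality. -/
theorem inner_testFun_le (hq : 1 < q) {f f' : Lp ℝ 2 μ} (hf : IsSubgradient q μ f (-f')) :
    ∃ G : X → ℝ, MemLp G (ENNReal.ofReal q) μ ∧ (∀ᵐ x ∂μ, 0 ≤ G x) ∧
      (relaxedSlope q μ f =ᵐ[μ] fun x => ENNReal.ofReal (G x)) ∧
      inner ℝ ((T.memLp_testFun (Lp.memLp f)).toLp _) f' ≤
        ∫ x, G x ^ (q - 1) * (B x - c * entropyWeight b (w x) (f x) * G x) ∂μ := by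
  have hq0 : 0 < q := by linarith
  obtain ⟨F, G, hFG, hG0, hGs, hGc⟩ := exists_isSlopeApprox_of_cheeger_ne_top hq hf.1
  refine ⟨G, hFG.memLp, hG0, hGs, ?_⟩
  set h := (T.memLp_testFun (Lp.memLp f)).toLp (testFun b c w u f) with hh
  have hw₀ := T.w₀_pos
  have hc := T.c_nonneg
  have hwb : 0 ≤ c * w₀ ^ (-b) := by positivity
  set D : X → ℝ := fun x => B x - c * entropyWeight b (w x) (f x) * G x with hD
  have hcA : ∀ x, c * entropyWeight b (w x) (f x) ≤ c * w₀ ^ (-b) := fun x =>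
    mul_le_mul_of_nonneg_left (entropyWeight_le_of_le T.b_pos T.w₀_pos (T.le_w x) _) hc
  have hcA0 : ∀ x, 0 ≤ c * entropyWeight b (w x) (f x) := fun x =>
    mul_nonneg hc (entropyWeight_nonneg (T.w_pos x) _)
  have hDm : MemLp D (ENNReal.ofReal q) μ := by
    refine T.memLp_B.sub ((hFG.memLp.const_mul (c * w₀ ^ (-b))).mono ?_ (ae_of_all _ fun x => ?_))
    · exact (((measurable_entropyWeight b).comp_aemeasurable
        (T.measurable_w.aemeasurable.prodMk (Lp.memLp f).1.aemeasurable)).const_mul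
          _).aestronglyMeasurable.mul hFG.memLp.1
    · rw [norm_mul _ (G x), norm_mul _ (G x), Real.norm_of_nonneg (hcA0 x), Real.norm_of_nonneg hwb]
      exact mul_le_mul_of_nonneg_right (hcA x) (norm_nonneg _)
  -- up to `τ₀` the map `F ↦ F - τ * testFun b c w u F` does not reverse the order
  set τ₀ : ℝ := 1 / (c * w₀ ^ (-b) + 1) with hτ₀
  have hτ₀0 : 0 < τ₀ := by positivity
  have hτle : ∀ τ, 0 < τ → τ ≤ τ₀ → τ * (c * w₀ ^ (-b)) ≤ 1 := fun τ h0 h1 => by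
    rw [hτ₀, le_div_iff₀ (by positivity)] at h1
    nlinarith
  have hpos : ∀ τ, 0 < τ → τ ≤ τ₀ → ∀ᵐ x ∂μ, 0 ≤ G x + τ * D x := by
    intro τ h0 h1
    filter_upwards [hG0] with x hx
    have h2 := mul_le_mul_of_nonneg_left (hcA x) h0.le
    have h3 := hτle τ h0 h1
    have h4 := mul_nonneg h0.le (T.B_nonneg x)
    have h5 : 0 ≤ (1 - τ * (c * entropyWeight b (w x) (f x))) * G x :=
      mul_nonneg (by linarith) hx
    simp only [hD]
    linarith
  have hfv := integral_rpow_mul_nonneg_of_forall hq hFG.memLp hG0 hDm (c := -inner ℝ h f') hτ₀0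
    hpos fun τ h0 h1 => by
      obtain ⟨h2, h3⟩ := T.cheeger_sub_le hq hFG h0.le (by
        rw [mul_assoc]; exact hτle τ h0 h1)
      have h4 := hf.2 _ h2
      rw [hGc] at h4
      have e1 : (inner ℝ (-f') (f - τ • h - f) : ℝ) = τ * inner ℝ h f' := by
        rw [show f - τ • h - f = -(τ • h) by abel, inner_neg_neg, inner_smul_right,
          real_inner_comm]
      rw [e1] at h4
      have e2 : ∫ x, |G x + τ * D x| ^ q ∂μ = ∫ x, (G x + τ * D x) ^ q ∂μ :=
        integral_congr_ae ((hpos τ h0 h1).mono fun x hx => by simp only [abs_of_nonneg hx])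
      rw [e2] at h3
      have h5 : τ * inner ℝ h f' ≤
          1 / q * (∫ x, (G x + τ * D x) ^ q ∂μ - ∫ x, G x ^ q ∂μ) := by linarith
      rw [div_mul_eq_mul_div, one_mul, le_div_iff₀ hq0] at h5
      linarith
  linarith

end IsTestData

/-- Pointwise Young inequality; equality holds for the optimal `g`. -/
theorem rpow_mul_sub_le {p q : ℝ} (hpq : p.HolderConjugate q) {g B a : ℝ} (hg : 0 ≤ g)
    (hB : 0 ≤ B) (ha : 0 < a) :
    g ^ (q - 1) * (B - a * g) ≤ 1 / q * p ^ (1 - q) * (B ^ q * a ^ (1 - q)) := by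
  have hp0 := hpq.pos
  have hq0 := hpq.symm.pos
  have hq1 := hpq.symm.lt
  have hq1' : 0 < q - 1 := by linarith
  have hpq' : p * (q - 1) = q := by have := hpq.mul_eq_add; linarith
  have h := Real.young_inequality_of_nonneg (a := (a * p) ^ p⁻¹ * g ^ (q - 1))
    (b := (a * p) ^ (-p⁻¹) * B) (by positivity) (by positivity) hpq
  have hap : 0 < a * p := by positivity
  rw [Real.mul_rpow (x := (a * p) ^ p⁻¹) (by positivity) (by positivity),
    Real.mul_rpow (x := (a * p) ^ (-p⁻¹)) (by positivity) hB,
    ← Real.rpow_mul hap.le, ← Real.rpow_mul hap.le, ← Real.rpow_mul hg, inv_mul_cancel₀ hp0.ne',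
    Real.rpow_one, mul_comm (q - 1) p, hpq',
    show -p⁻¹ * q = 1 - q by
      have := hpq.inv_add_inv_eq_one
      field_simp at this ⊢
      linarith, Real.mul_rpow (z := 1 - q) ha.le hp0.le] at h
  have e1 : (a * p) ^ p⁻¹ * g ^ (q - 1) * ((a * p) ^ (-p⁻¹) * B) = g ^ (q - 1) * B := by
    have : (a * p) ^ p⁻¹ * (a * p) ^ (-p⁻¹) = 1 := by
      rw [← Real.rpow_add hap, add_neg_cancel, Real.rpow_zero]
    linear_combination (g ^ (q - 1) * B) * this
  rw [e1] at h
  have e2 : g ^ (q - 1) * (a * g) = a * g ^ q := by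
    rcases hg.eq_or_lt with h | h
    · rw [← h, Real.zero_rpow hq0.ne']; simp
    · rw [mul_left_comm, ← Real.rpow_add_one h.ne', sub_add_cancel]
  have e3 : a * p * g ^ q / p = a * g ^ q := by field_simp
  rw [e3] at h
  rw [mul_sub, e2]
  calc _ ≤ a ^ (1 - q) * p ^ (1 - q) * B ^ q / q := by linarith
    _ = _ := by ring

end Dissipation

/-! ### Absolute continuity and Grönwall inequalities -/

section AbsolutelyContinuous

/-- Functions on `[0, ∞)` that are continuous, and absolutely continuous on the compact subintervals
of `(0, ∞)`. -/
structure IsLocallyAC (Z : ℝ → ℝ) : Prop where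
  continuousOn : ContinuousOn Z (Ici 0)
  ac : ∀ s t, 0 < s → s ≤ t → AbsolutelyContinuousOnInterval Z s t

namespace IsLocallyAC

variable {Z : ℝ → ℝ}

/-- Integration of a differential inequality that holds almost everywhere. -/
theorem sub_le_integral (hZ : IsLocallyAC Z) {r : ℝ → ℝ} {t : ℝ} (ht : 0 ≤ t)
    (hr : IntervalIntegrable r volume 0 t)
    (h : ∀ᵐ s ∂(volume.restrict (Ioi (0 : ℝ))), s ≤ t → ∃ D, HasDerivAt Z D s ∧ D ≤ r s) :
    Z t - Z 0 ≤ ∫ s in (0 : ℝ)..t, r s := by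
  rcases ht.eq_or_lt with h0 | ht0
  · simp [← h0]
  have key : ∀ s ∈ Ioc (0 : ℝ) t, Z t - Z s ≤ ∫ x in s..t, r x := by
    intro s hs
    have hac := hZ.ac s t hs.1 hs.2
    rw [← hac.integral_deriv_eq_sub]
    refine intervalIntegral.integral_mono_ae_restrict hs.2 hac.intervalIntegrable_deriv
      (hr.mono_set ?_) ?_
    · rw [uIcc_of_le hs.2, uIcc_of_le ht]; exact Icc_subset_Icc_left hs.1.le
    · rw [Filter.EventuallyLE, ae_restrict_iff' measurableSet_Icc]
      rw [ae_restrict_iff' measurableSet_Ioi] at h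
      filter_upwards [h] with x hx hxs
      obtain ⟨D, hD, hDr⟩ := hx (hs.1.trans_le hxs.1) hxs.2
      rw [hD.deriv]; exact hDr
  have l1 : Tendsto (fun s => Z t - Z s) (𝓝[>] 0) (𝓝 (Z t - Z 0)) :=
    tendsto_const_nhds.sub (((hZ.continuousOn 0 (mem_Ici.2 le_rfl)).tendsto).mono_left
      (nhdsWithin_mono _ Ioi_subset_Ici_self))
  have l2 : Tendsto (fun s => ∫ x in s..t, r x) (𝓝[>] 0) (𝓝 (∫ x in (0 : ℝ)..t, r x)) := by
    have hI : IntegrableOn r (uIcc 0 t) := by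
      rw [uIcc_of_le ht, integrableOn_Icc_iff_integrableOn_Ioc]
      exact (intervalIntegrable_iff_integrableOn_Ioc_of_le ht).1 hr
    have hc := intervalIntegral.continuousOn_primitive_interval_left hI
    have h1 := (hc 0 left_mem_uIcc).tendsto
    rw [uIcc_of_le ht] at h1
    refine h1.mono_left ?_
    rw [← nhdsWithin_Ioo_eq_nhdsGT ht0]
    exact nhdsWithin_mono _ Ioo_subset_Icc_self
  refine le_of_tendsto_of_tendsto l1 l2 ?_
  filter_upwards [Ioc_mem_nhdsGT ht0] with s hs using key s hs

theorem le_of_deriv_nonpos (hZ : IsLocallyAC Z) {t : ℝ} (ht : 0 ≤ t)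
    (h : ∀ᵐ s ∂(volume.restrict (Ioi (0 : ℝ))), s ≤ t → ∃ D, HasDerivAt Z D s ∧ D ≤ 0) :
    Z t ≤ Z 0 := by
  have := hZ.sub_le_integral ht (r := fun _ => 0) intervalIntegrable_const h
  simp at this
  linarith

/-- Grönwall's inequality. -/
theorem add_le_exp_mul (hZ : IsLocallyAC Z) {κ d t : ℝ} (ht : 0 ≤ t)
    (h : ∀ᵐ s ∂(volume.restrict (Ioi (0 : ℝ))), s ≤ t →
      ∃ D, HasDerivAt Z D s ∧ D ≤ κ * (Z s + d)) :
    Z t + d ≤ Real.exp (κ * t) * (Z 0 + d) := by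
  have hY : IsLocallyAC fun s => Real.exp (-κ * s) * (Z s + d) := by
    refine ⟨ContinuousOn.mul (by fun_prop) (hZ.continuousOn.add continuousOn_const),
      fun s t hs hst => ?_⟩
    refine AbsolutelyContinuousOnInterval.mul (ContDiffOn.absolutelyContinuousOnInterval
      (by fun_prop)) ((hZ.ac s t hs hst).add ?_)
    exact (LipschitzWith.const d).lipschitzOnWith.absolutelyContinuousOnInterval
  have hle := hY.le_of_deriv_nonpos ht (by
    filter_upwards [h] with s hs hst
    obtain ⟨D, hD, hDle⟩ := hs hst
    have he : HasDerivAt (fun s => Real.exp (-κ * s)) (Real.exp (-κ * s) * (-κ)) s := by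
      have := ((hasDerivAt_id s).const_mul (-κ)).exp
      simpa using this
    refine ⟨_, he.mul (hD.add_const d), ?_⟩
    have := Real.exp_pos (-κ * s)
    nlinarith)
  simp only [mul_zero, Real.exp_zero, one_mul] at hle
  have h1 : Real.exp (κ * t) * Real.exp (-κ * t) = 1 := by
    rw [← Real.exp_add]; simp
  calc Z t + d = Real.exp (κ * t) * (Real.exp (-κ * t) * (Z t + d)) := by
        rw [← mul_assoc, h1, one_mul]
    _ ≤ _ := mul_le_mul_of_nonneg_left hle (Real.exp_pos _).le

/-- The dissipation of a nonincreasing function is at most its total decrease. -/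
theorem lintegral_deriv_le (hZ : IsLocallyAC Z) {t : ℝ}
    (h : ∀ᵐ s ∂(volume.restrict (Ioi (0 : ℝ))), ∃ D, HasDerivAt Z D s ∧ D ≤ 0) :
    ∫⁻ s in Ioc 0 t, ENNReal.ofReal (-deriv Z s) ≤ ENNReal.ofReal (Z 0 - Z t) := by
  have hU : Ioc 0 t = ⋃ n : ℕ, Ioc (1 / ((n : ℝ) + 1)) t := by
    ext x
    simp only [mem_Ioc, mem_iUnion]
    constructor
    · rintro ⟨h1, h2⟩
      obtain ⟨n, hn⟩ := exists_nat_one_div_lt h1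
      exact ⟨n, hn, h2⟩
    · rintro ⟨n, h1, h2⟩
      exact ⟨lt_trans Nat.one_div_pos_of_nat h1, h2⟩
  rw [hU, setLIntegral_iUnion_of_directed]
  · refine iSup_le fun n => ?_
    set s : ℝ := 1 / ((n : ℝ) + 1)
    have hs : 0 < s := Nat.one_div_pos_of_nat
    rcases le_or_gt s t with hst | hst
    · have hac := hZ.ac s t hs hst
      have hint := hac.intervalIntegrable_deriv
      rw [intervalIntegrable_iff_integrableOn_Ioc_of_le hst] at hint
      have hnn : ∀ᵐ x ∂(volume.restrict (Ioc s t)), 0 ≤ -deriv Z x := by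
        rw [ae_restrict_iff' measurableSet_Ioc]
        rw [ae_restrict_iff' measurableSet_Ioi] at h
        filter_upwards [h] with x hx hxs
        obtain ⟨D, hD, hD0⟩ := hx (hs.trans hxs.1)
        rw [hD.deriv]; linarith
      have hint' : Integrable (fun x => -deriv Z x) (volume.restrict (Ioc s t)) := hint.neg
      rw [← ofReal_integral_eq_lintegral_ofReal hint' hnn, integral_neg,
        ← intervalIntegral.integral_of_le hst, hac.integral_deriv_eq_sub]
      have := hZ.le_of_deriv_nonpos hs.le (by filter_upwards [h] with x hx _ using hx)
      exact ENNReal.ofReal_le_ofReal (by linarith)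
    · simp [Ioc_eq_empty (not_lt.2 hst.le)]
  · refine Monotone.directed_le fun i j hij => Ioc_subset_Ioc_left ?_
    exact Nat.one_div_le_one_div hij

end IsLocallyAC

/-- Grönwall's inequality in integral form, for a bounded measurable function. -/
theorem le_exp_mul_of_le_integral {y : ℝ → ℝ} {a κ C T : ℝ} (hκ : 0 ≤ κ) (hm : Measurable y)
    (hC : ∀ t ∈ Icc 0 T, |y t| ≤ C)
    (h : ∀ t ∈ Icc 0 T, y t ≤ a + κ * ∫ s in (0 : ℝ)..t, y s) {t : ℝ} (ht : t ∈ Icc 0 T) :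
    y t ≤ Real.exp (κ * t) * a := by
  have hT : 0 ≤ T := ht.1.trans ht.2
  have hint : IntervalIntegrable y volume 0 T := by
    rw [intervalIntegrable_iff_integrableOn_Ioc_of_le hT, ← integrableOn_Icc_iff_integrableOn_Ioc]
    refine Measure.integrableOn_of_bounded (M := C) (by simp) hm.aestronglyMeasurable ?_
    rw [ae_restrict_iff' measurableSet_Icc]
    exact ae_of_all _ fun s hs => by simpa using hC s hs
  have hintt : ∀ t ∈ Icc 0 T, IntervalIntegrable y volume 0 t := fun t ht => hint.mono_set (by
    rw [uIcc_of_le ht.1, uIcc_of_le hT]; exact Icc_subset_Icc_right ht.2)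
  -- unlike `y`, its iterate `P` under the integral operator is continuously differentiable, and
  -- it satisfies the same inequality
  set I : ℝ → ℝ := fun t => ∫ s in (0 : ℝ)..(max 0 (min t T)), y s with hI
  have hmem : ∀ t, max 0 (min t T) ∈ Icc 0 T := fun t =>
    ⟨le_max_left _ _, max_le hT (min_le_right _ _)⟩
  have hIc : Continuous I := by
    have hI : IntegrableOn y (uIcc 0 T) := by
      rw [uIcc_of_le hT, integrableOn_Icc_iff_integrableOn_Ioc]
      exact (intervalIntegrable_iff_integrableOn_Ioc_of_le hT).1 hint
    have hc := intervalIntegral.continuousOn_primitive_interval hI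
    rw [uIcc_of_le hT] at hc
    exact hc.comp_continuous (by fun_prop) hmem
  have hIe : ∀ t ∈ Icc 0 T, I t = ∫ s in (0 : ℝ)..t, y s := fun t ht => by
    simp only [hI, min_eq_left ht.2, max_eq_right ht.1]
  set P : ℝ → ℝ := fun t => ∫ s in (0 : ℝ)..t, (a + κ * I s) with hP
  have hPd : ∀ t, HasDerivAt P (a + κ * I t) t := fun t =>
    intervalIntegral.integral_hasDerivAt_right ((by fun_prop : Continuous fun s =>
      a + κ * I s).intervalIntegrable _ _)
      ((by fun_prop : Continuous fun s => a + κ * I s).stronglyMeasurableAtFilter _ _)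
      (by fun_prop : Continuous fun s => a + κ * I s).continuousAt
  have hIP : ∀ t ∈ Icc 0 T, I t ≤ P t := by
    intro t ht
    rw [hIe t ht]
    refine intervalIntegral.integral_mono_on ht.1 (hintt t ht)
      ((by fun_prop : Continuous fun s => a + κ * I s).intervalIntegrable _ _) fun s hs => ?_
    have hs' : s ∈ Icc 0 T := ⟨hs.1, hs.2.trans ht.2⟩
    rw [hIe s hs']
    exact h s hs'
  have hPC : ContDiff ℝ 1 P := by
    rw [contDiff_one_iff_deriv]
    refine ⟨fun t => (hPd t).differentiableAt, ?_⟩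
    rw [show deriv P = fun t => a + κ * I t from funext fun t => (hPd t).deriv]
    fun_prop
  have hZ : IsLocallyAC fun t => a + κ * P t := by
    have hc : ContDiff ℝ 1 fun t => a + κ * P t := contDiff_const.add (contDiff_const.mul hPC)
    exact ⟨hc.continuous.continuousOn, fun s t _ _ =>
      hc.contDiffOn.absolutelyContinuousOnInterval⟩
  have hg := hZ.add_le_exp_mul (κ := κ) (d := 0) ht.1 (by
    rw [ae_restrict_iff' measurableSet_Ioi]
    refine ae_of_all _ fun s hs hst => ⟨_, ((hPd s).const_mul κ).const_add a, ?_⟩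
    rw [add_zero]
    exact mul_le_mul_of_nonneg_left (add_le_add_right (mul_le_mul_of_nonneg_left
      (hIP s ⟨(mem_Ioi.1 hs).le, hst.trans ht.2⟩) hκ) a) hκ)
  have hP0 : P 0 = 0 := by simp [hP]
  rw [hP0] at hg
  simp only [mul_zero, add_zero] at hg
  refine (h t ht).trans (le_trans ?_ hg)
  rw [← hIe t ht]
  exact add_le_add_right (mul_le_mul_of_nonneg_left (hIP t ht) hκ) a

end AbsolutelyContinuous

/-! ### Evolution of the test functionals along the flow -/

section Evolution

variable {X : Type*} [MetricSpace X] [MeasurableSpace X] {μ : Measure X} {q : ℝ}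

theorem IsHeatFlow.continuousOn {f : ℝ → Lp ℝ 2 μ} (hf : IsHeatFlow q μ f) :
    ContinuousOn f (Ici 0) := by
  intro t ht
  rcases (mem_Ici.1 ht).eq_or_lt with h | h
  · subst h
    have h1 : ContinuousWithinAt f (Ioi 0) 0 := hf.tendsto_zero
    exact continuousWithinAt_Ioi_iff_Ici.1 h1
  · exact (hf.locallyLipschitz.continuousOn.continuousAt (Ioi_mem_nhds h)).continuousWithinAt

namespace IsTestData

variable [BorelSpace X] {b w₀ c : ℝ} {w u B : X → ℝ} (T : IsTestData q μ b w₀ c w u B)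

include T

theorem continuous_testFunctional :
    Continuous fun g : Lp ℝ 2 μ => testFunctional μ b c w u g := by
  rw [continuous_iff_continuousAt]
  intro g
  obtain ⟨K, hK⟩ := T.exists_lipschitzOnWith_testFunctional (‖g‖ + 1)
  exact hK.continuousOn.continuousAt (Metric.closedBall_mem_nhds_of_mem (by simp))

theorem isLocallyAC {f : ℝ → Lp ℝ 2 μ} (hf : IsHeatFlow q μ f) :
    IsLocallyAC fun t => testFunctional μ b c w u (f t) := by
  refine ⟨T.continuous_testFunctional.comp_continuousOn hf.continuousOn, fun s t hs hst => ?_⟩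
  have hsub : uIcc s t ⊆ Ioi 0 := by
    rw [uIcc_of_le hst]
    exact fun x hx => hs.trans_le hx.1
  obtain ⟨K, hK⟩ := (hf.locallyLipschitz.mono hsub).exists_lipschitzOnWith_of_compact
    isCompact_uIcc
  obtain ⟨R, hR⟩ := (isCompact_uIcc.image_of_continuousOn
    hK.continuousOn).isBounded.subset_closedBall (0 : Lp ℝ 2 μ)
  obtain ⟨K', hK'⟩ := T.exists_lipschitzOnWith_testFunctional R
  exact (hK'.comp hK (mapsTo_iff_image_subset.2 hR)).absolutelyContinuousOnInterval

/-- Evolution of `testFunctional` along the flow. -/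
theorem ae_hasDerivAt (hq : 1 < q) {f : ℝ → Lp ℝ 2 μ} (hf : IsHeatFlow q μ f) :
    ∀ᵐ t ∂(volume.restrict (Ioi (0 : ℝ))), ∃ (D : ℝ) (G : X → ℝ),
      HasDerivAt (fun t => testFunctional μ b c w u (f t)) D t ∧
      MemLp G (ENNReal.ofReal q) μ ∧ (∀ᵐ x ∂μ, 0 ≤ G x) ∧
      (relaxedSlope q μ (f t) =ᵐ[μ] fun x => ENNReal.ofReal (G x)) ∧
      Integrable (fun x => G x ^ (q - 1) *
        (B x - c * entropyWeight b (w x) (f t x) * G x)) μ ∧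
      D ≤ ∫ x, G x ^ (q - 1) * (B x - c * entropyWeight b (w x) (f t x) * G x) ∂μ := by
  filter_upwards [hf.deriv_mem] with t ht
  obtain ⟨f', hf', hsub⟩ := ht
  obtain ⟨G, hG, hG0, hGs, hle⟩ := T.inner_testFun_le hq hsub
  refine ⟨_, G, T.hasDerivAt_testFunctional hf', hG, hG0, hGs, ?_, hle⟩
  have hc := T.c_nonneg
  have hw₀ := T.w₀_pos
  refine integrable_rpow_mul hq hG hG0 (T.memLp_B.sub
    ((hG.const_mul (c * w₀ ^ (-b))).mono ?_ (ae_of_all _ fun x => ?_)))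
  · exact (((measurable_entropyWeight b).comp_aemeasurable
      (T.measurable_w.aemeasurable.prodMk (Lp.memLp (f t)).1.aemeasurable)).const_mul
        _).aestronglyMeasurable.mul hG.1
  · rw [norm_mul _ (G x), norm_mul _ (G x), Real.norm_of_nonneg
      (mul_nonneg hc (entropyWeight_nonneg (T.w_pos x) _)), Real.norm_of_nonneg
      (by positivity : 0 ≤ c * w₀ ^ (-b))]
    exact mul_le_mul_of_nonneg_right (mul_le_mul_of_nonneg_left
      (entropyWeight_le_of_le T.b_pos T.w₀_pos (T.le_w x) _) hc) (norm_nonneg _)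

/-- Evolution of `testFunctional` along the flow, after absorbing the perturbation `B` into the
dissipation. -/
theorem ae_hasDerivAt_le {p : ℝ} (hpq : p.HolderConjugate q) (hc : 0 < c) {f : ℝ → Lp ℝ 2 μ}
    (hf : IsHeatFlow q μ f) :
    ∀ᵐ t ∂(volume.restrict (Ioi (0 : ℝ))), ∃ D : ℝ,
      HasDerivAt (fun t => testFunctional μ b c w u (f t)) D t ∧
      ∀ y : X → ℝ, Integrable y μ → (∀ᵐ x ∂μ, 1 / q * p ^ (1 - q) * c ^ (1 - q) *
        (B x ^ q * (|f t x| + w x) ^ (b * (q - 1))) ≤ y x) → D ≤ ∫ x, y x ∂μ := by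
  filter_upwards [T.ae_hasDerivAt hpq.symm.lt hf] with t ht
  obtain ⟨D, G, hD, hG, hG0, -, hint, hle⟩ := ht
  refine ⟨D, hD, fun y hy hxy => hle.trans (integral_mono_ae hint hy ?_)⟩
  filter_upwards [hG0, hxy] with x h1 h2
  have hA := entropyWeight_pos (b := b) (T.w_pos x) (f t x)
  refine (rpow_mul_sub_le hpq h1 (T.B_nonneg x) (mul_pos hc hA)).trans (le_trans (le_of_eq ?_) h2)
  have hw := T.w_pos x
  have e : entropyWeight b (w x) (f t x) ^ (1 - q) = (|f t x| + w x) ^ (b * (q - 1)) := by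
    rw [entropyWeight, ← Real.rpow_mul (by positivity)]
    congr 1; ring
  rw [Real.mul_rpow hc.le hA.le, e]
  ring

end IsTestData

end Evolution

/-! ### Contraction in `L¹` -/

section Aux

/-- Fatou's lemma for nonnegative functions with convergent bounds on their integrals. -/
theorem integrable_of_tendsto_of_integral_le {X : Type*} [MeasurableSpace X] {μ : Measure X}
    {F : ℕ → X → ℝ} {f : X → ℝ} {c : ℕ → ℝ} {C : ℝ} (hF : ∀ n, Integrable (F n) μ)
    (h0 : ∀ n, ∀ᵐ x ∂μ, 0 ≤ F n x) (hc : ∀ n, ∫ x, F n x ∂μ ≤ c n)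
    (hC : Tendsto c atTop (𝓝 C)) (hf : AEStronglyMeasurable f μ)
    (hlim : ∀ᵐ x ∂μ, Tendsto (fun n => F n x) atTop (𝓝 (f x))) :
    Integrable f μ ∧ ∫ x, f x ∂μ ≤ C := by
  have hf0 : ∀ᵐ x ∂μ, 0 ≤ f x := by
    filter_upwards [hlim, ae_all_iff.2 h0] with x h1 h2
    exact ge_of_tendsto' h1 h2
  have hle : ∫⁻ x, ENNReal.ofReal (f x) ∂μ ≤ ENNReal.ofReal C := by
    calc ∫⁻ x, ENNReal.ofReal (f x) ∂μ
        = ∫⁻ x, liminf (fun n => ENNReal.ofReal (F n x)) atTop ∂μ := by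
          refine lintegral_congr_ae ?_
          filter_upwards [hlim] with x hx
          exact ((ENNReal.tendsto_ofReal hx).liminf_eq).symm
      _ ≤ liminf (fun n => ∫⁻ x, ENNReal.ofReal (F n x) ∂μ) atTop :=
          lintegral_liminf_le' fun n => (hF n).1.aemeasurable.ennreal_ofReal
      _ ≤ liminf (fun n => ENNReal.ofReal (c n)) atTop := by
          refine liminf_le_liminf (Eventually.of_forall fun n => ?_)
          rw [← ofReal_integral_eq_lintegral_ofReal (hF n) (h0 n)]
          exact ENNReal.ofReal_le_ofReal (hc n)
      _ = ENNReal.ofReal C := (ENNReal.tendsto_ofReal hC).liminf_eq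
  have hC0 : 0 ≤ C := ge_of_tendsto' hC fun n => (integral_nonneg_of_ae (h0 n)).trans (hc n)
  refine ⟨⟨hf, ?_⟩, ?_⟩
  · rw [hasFiniteIntegral_iff_ofReal hf0]
    exact hle.trans_lt ENNReal.ofReal_lt_top
  · rw [integral_eq_lintegral_of_nonneg_ae hf0 hf]
    exact ENNReal.toReal_le_of_le_ofReal hC0 hle

theorem integrable_entropy {X : Type*} [MeasurableSpace X] {μ : Measure X} {b w₀ : ℝ} {w f : X → ℝ}
    (hb0 : 0 < b) (hb1 : b ≠ 1) (hb2 : b ≠ 2) (hw₀ : 0 < w₀) (hw : ∀ x, w₀ ≤ w x)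
    (hwm : Measurable w) (hf : MemLp f 2 μ) : Integrable (fun x => entropy b (w x) (f x)) μ := by
  refine (hf.integrable_sq.const_mul (w₀ ^ (-b))).mono'
    ((measurable_entropy b).comp_aemeasurable
      (hwm.aemeasurable.prodMk hf.1.aemeasurable)).aestronglyMeasurable (ae_of_all _ fun x => ?_)
  have hwx := hw₀.trans_le (hw x)
  rw [Real.norm_of_nonneg (entropy_nonneg hb1 hb2 hwx _)]
  exact (entropy_le_sq hb0 hb1 hb2 hwx _).trans (mul_le_mul_of_nonneg_right
    (Real.rpow_le_rpow_of_nonpos hw₀ (hw x) (by linarith)) (sq_nonneg _))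

theorem memLp_of_abs_le_indicator {X : Type*} [MeasurableSpace X] {μ : Measure X} {u : X → ℝ}
    (hu : Measurable u) {s : Set X} (hs : MeasurableSet s) (hμ : μ s ≠ ∞) {C : ℝ}
    (h : ∀ x, |u x| ≤ s.indicator (fun _ => C) x)
    (r : ℝ≥0∞) : MemLp u r μ :=
  (memLp_indicator_const r hs C (Or.inr hμ)).mono hu.aestronglyMeasurable (ae_of_all _ fun x =>
    (h x).trans (le_abs_self _))

variable {X : Type*} [MetricSpace X]

@[simp] theorem lipSlope_const (a : ℝ) (x : X) : lipSlope (fun _ : X => a) x = 0 :=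
  lipSlope_eq_zero_of_eventually_const (Eventually.of_forall fun _ => rfl)

/-- For `b < 1` the entropies are bounded uniformly in the shift `w`. -/
theorem entropy_le_of_lt_one {b w : ℝ} (hb0 : 0 < b) (hb1 : b < 1) (hw : 0 < w) (r : ℝ) :
    entropy b w r ≤ (|r| + r ^ 2) / (1 - b) := by
  have hb' : 0 < 1 - b := by linarith
  have key : ∀ r : ℝ, 0 ≤ r → entropy b w r ≤ (|r| + r ^ 2) / (1 - b) := by
    intro r hr
    rcases hr.eq_or_lt with h | h
    · rw [← h]; simp
    have h1 := entropy_tangent_le hb1.ne (by linarith : b ≠ 2) hw r 0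
    rw [entropy_zero] at h1
    have h2 : entropyDeriv b w r ≤ (1 + r) / (1 - b) := by
      rw [entropyDeriv, Real.sign_of_pos h, one_mul, abs_of_pos h]
      refine div_le_div_of_nonneg_right ?_ hb'.le
      have h3 := Real.rpow_add_le_add_rpow h.le hw.le hb'.le (by linarith)
      have h4 : r ^ (1 - b) ≤ 1 + r := by
        calc r ^ (1 - b) ≤ (1 + r) ^ (1 - b) :=
              Real.rpow_le_rpow h.le (by linarith) hb'.le
          _ ≤ (1 + r) ^ (1 : ℝ) :=
              Real.rpow_le_rpow_of_exponent_le (by linarith) (by linarith)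
          _ = _ := Real.rpow_one _
      linarith
    have h5 := mul_le_mul_of_nonneg_left h2 h.le
    rw [abs_of_pos h, show (r + r ^ 2) / (1 - b) = r * ((1 + r) / (1 - b)) by ring]
    linarith
  rcases le_total 0 r with h | h
  · exact key r h
  · have := key (-r) (by linarith)
    rwa [entropy_neg, abs_neg, neg_sq] at this

variable [MeasurableSpace X] {μ : Measure X} {q : ℝ}

theorem IsTestData.of_const {b w c : ℝ} {u B : X → ℝ} (hb0 : 0 < b) (hb1 : b ≠ 1) (hb2 : b ≠ 2)
    (hw : 0 < w) (hc : 0 ≤ c) (hu : ∃ K : ℝ≥0, LipschitzWith K u) (hu2 : MemLp u 2 μ)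
    (hB : MemLp B (ENNReal.ofReal q) μ) (h : ∀ x, lipSlope u x ≤ B x) :
    IsTestData q μ b w c (fun _ => w) u B where
  b_pos := hb0
  b_ne_one := hb1
  b_ne_two := hb2
  w₀_pos := hw
  c_nonneg := hc
  lipschitz_w := ⟨0, LipschitzWith.const w⟩
  le_w := fun _ => le_rfl
  lipschitz_u := hu
  memLp_u := hu2
  memLp_B := hB
  le_B := fun x => by simpa using h x

theorem IsTestData.of_const_zero {b w c : ℝ} (hb0 : 0 < b) (hb1 : b ≠ 1) (hb2 : b ≠ 2)
    (hw : 0 < w) (hc : 0 ≤ c) :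
    IsTestData q μ b w c (fun _ => w) (fun _ => 0) (fun _ => 0) :=
  .of_const hb0 hb1 hb2 hw hc ⟨0, LipschitzWith.const 0⟩ (MemLp.zero (ε := ℝ)) (MemLp.zero (ε := ℝ))
    fun x => by simp

variable [BorelSpace X]

theorem IsTestData.testFunctional_eq {b w₀ c : ℝ} {w u B : X → ℝ}
    (T : IsTestData q μ b w₀ c w u B) {f : X → ℝ} (hf : MemLp f 2 μ) :
    testFunctional μ b c w u f = c * (∫ x, entropy b (w x) (f x) ∂μ) + ∫ x, u x * f x ∂μ := by
  have hu : Integrable (fun x => u x * f x) μ := T.memLp_u.integrable_mul hf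
  rw [testFunctional, integral_add ((integrable_entropy T.b_pos T.b_ne_one T.b_ne_two T.w₀_pos
    T.le_w T.measurable_w hf).const_mul c) hu, integral_const_mul]

/-- Entropies with a constant shift do not increase along the flow. -/
theorem IsHeatFlow.integral_entropy_le (hq : 1 < q) {f : ℝ → Lp ℝ 2 μ} (hf : IsHeatFlow q μ f)
    {b w : ℝ} (hb0 : 0 < b) (hb1 : b ≠ 1) (hb2 : b ≠ 2) (hw : 0 < w) {t : ℝ} (ht : 0 ≤ t) :
    ∫ x, entropy b w (f t x) ∂μ ≤ ∫ x, entropy b w (f 0 x) ∂μ := by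
  have T : IsTestData q μ b w 1 (fun _ => w) (fun _ => 0) (fun _ => 0) :=
    .of_const_zero hb0 hb1 hb2 hw zero_le_one
  have h := (T.isLocallyAC hf).le_of_deriv_nonpos ht (by
    filter_upwards [T.ae_hasDerivAt hq hf] with s hs _
    obtain ⟨D, G, hD, -, hG0, -, -, hle⟩ := hs
    refine ⟨D, hD, hle.trans (integral_nonpos_of_ae ?_)⟩
    filter_upwards [hG0] with x hx
    have h1 := entropyWeight_pos (b := b) hw (f s x)
    have h2 := Real.rpow_nonneg hx (q - 1)
    have h3 : 0 ≤ entropyWeight b w (f s x) * G x := mul_nonneg h1.le hx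
    simp only [zero_sub, one_mul, mul_neg, Pi.zero_apply, neg_nonpos]
    exact mul_nonneg h2 h3)
  simpa only [T.testFunctional_eq (Lp.memLp (f _)), one_mul, zero_mul, integral_zero,
    add_zero] using h

/-- The flow does not increase the `L¹`-norm: `√w / 2 * entropy (3 / 2) w` is bounded by the
absolute value and converges to it as `w → 0`. -/
theorem IsHeatFlow.integral_abs_le (hq : 1 < q) {f : ℝ → Lp ℝ 2 μ} (hf : IsHeatFlow q μ f)
    (h0 : Integrable (f 0) μ) {t : ℝ} (ht : 0 ≤ t) :
    Integrable (f t) μ ∧ ∫ x, |f t x| ∂μ ≤ ∫ x, |f 0 x| ∂μ := by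
  have key : ∀ w r : ℝ, 0 < w → w ^ (1 / 2 : ℝ) / 2 * entropy (3 / 2) w r =
      |r| - 2 * (w ^ (1 / 2 : ℝ) * ((|r| + w) ^ (1 / 2 : ℝ) - w ^ (1 / 2 : ℝ))) := by
    intro w r hw
    have h1 : w ^ (1 / 2 : ℝ) * w ^ (-(1 / 2) : ℝ) = 1 := by
      rw [← Real.rpow_add hw]; norm_num
    rw [entropy, show (2 - 3 / 2 : ℝ) = 1 / 2 by norm_num,
      show (1 - 3 / 2 : ℝ) = -(1 / 2) by norm_num]
    linear_combination |r| * h1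
  have hle : ∀ w r : ℝ, 0 < w → w ^ (1 / 2 : ℝ) / 2 * entropy (3 / 2) w r ≤ |r| := by
    intro w r hw
    rw [key w r hw]
    have h1 : w ^ (1 / 2 : ℝ) ≤ (|r| + w) ^ (1 / 2 : ℝ) :=
      Real.rpow_le_rpow hw.le (by linarith [abs_nonneg r]) (by norm_num)
    have h2 : 0 ≤ w ^ (1 / 2 : ℝ) := by positivity
    nlinarith [mul_nonneg h2 (sub_nonneg.2 h1)]
  have hw : ∀ n : ℕ, (0 : ℝ) < 1 / ((n : ℝ) + 1) := fun n => Nat.one_div_pos_of_nat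
  have hi : ∀ (n : ℕ) s, Integrable (fun x => (1 / ((n : ℝ) + 1)) ^ (1 / 2 : ℝ) / 2 *
      entropy (3 / 2) (1 / ((n : ℝ) + 1)) (f s x)) μ := fun n s =>
    (integrable_entropy (by norm_num) (by norm_num) (by norm_num) (hw n) (fun _ => le_rfl)
      measurable_const (Lp.memLp (f s))).const_mul _
  have h := integrable_of_tendsto_of_integral_le (fun n => hi n t)
    (fun n => ae_of_all _ fun x => mul_nonneg (by positivity)
      (entropy_nonneg (by norm_num) (by norm_num) (hw n) _))
    (c := fun _ => ∫ x, |f 0 x| ∂μ) (f := fun x => |f t x|) (fun n => ?_) tendsto_const_nhds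
    (Lp.memLp (f t)).1.norm (ae_of_all _ fun x => ?_)
  · exact ⟨(integrable_norm_iff (Lp.memLp (f t)).1).1 h.1, h.2⟩
  · refine le_trans ?_ (integral_mono (hi n 0) h0.abs fun x => hle _ _ (hw n))
    rw [integral_const_mul, integral_const_mul]
    exact mul_le_mul_of_nonneg_left (hf.integral_entropy_le hq (by norm_num) (by norm_num)
      (by norm_num) (hw n) ht) (by positivity)
  · simp only [key _ _ (hw _)]
    have hlim : Tendsto (fun w : ℝ => |f t x| - 2 * (w ^ (1 / 2 : ℝ) *
        ((|f t x| + w) ^ (1 / 2 : ℝ) - w ^ (1 / 2 : ℝ)))) (𝓝 0) (𝓝 |f t x|) := by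
      have hc : Continuous (fun w : ℝ => |f t x| - 2 * (w ^ (1 / 2 : ℝ) *
        ((|f t x| + w) ^ (1 / 2 : ℝ) - w ^ (1 / 2 : ℝ)))) := by
        have h1 : Continuous fun w : ℝ => w ^ (1 / 2 : ℝ) :=
          Real.continuous_rpow_const (by norm_num)
        have h2 : Continuous fun w : ℝ => (|f t x| + w) ^ (1 / 2 : ℝ) :=
          h1.comp (by fun_prop)
        fun_prop
      have := hc.tendsto 0
      simpa using this
    exact hlim.comp tendsto_one_div_add_atTop_nhds_zero_nat

end Aux

/-! ### Cutoff functions -/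

section Mass

variable {X : Type*} [MetricSpace X]

/-- The cutoff function that is `1` on the ball of radius `R` and `0` off the ball of radius
`2R`. -/
def cutoff (x₀ : X) (R : ℝ) (x : X) : ℝ := max 0 (min 1 (2 - R⁻¹ * dist x x₀))

theorem cutoff_nonneg (x₀ : X) (R : ℝ) (x : X) : 0 ≤ cutoff x₀ R x := le_max_left _ _

theorem cutoff_le_one (x₀ : X) (R : ℝ) (x : X) : cutoff x₀ R x ≤ 1 :=
  max_le zero_le_one (min_le_left _ _)

theorem cutoff_eq_zero {x₀ : X} {R : ℝ} (hR : 0 < R) {x : X}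
    (hx : x ∉ Metric.closedBall x₀ (2 * R)) : cutoff x₀ R x = 0 := by
  rw [Metric.mem_closedBall, not_le] at hx
  refine max_eq_left ((min_le_right _ _).trans ?_)
  rw [sub_nonpos, inv_mul_eq_div, le_div_iff₀ hR]
  exact hx.le

theorem tendsto_cutoff (x₀ x : X) :
    Tendsto (fun n : ℕ => cutoff x₀ ((n : ℝ) + 1) x) atTop (𝓝 1) := by
  refine tendsto_const_nhds.congr' ?_
  filter_upwards [eventually_ge_atTop ⌈dist x x₀⌉₊] with n hn
  have h1 : dist x x₀ ≤ n := Nat.ceil_le.1 hn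
  have h2 : (((n : ℝ) + 1))⁻¹ * dist x x₀ ≤ 1 := by
    rw [inv_mul_eq_div, div_le_one (by positivity)]; linarith
  rw [cutoff, min_eq_left (by linarith), max_eq_right zero_le_one]

theorem lipschitzWith_cutoff (x₀ : X) {R : ℝ} (hR : 0 < R) :
    LipschitzWith (R⁻¹).toNNReal (cutoff x₀ R) := by
  have h1 : LipschitzWith (R⁻¹).toNNReal fun x : X => 2 - R⁻¹ * dist x x₀ := by
    refine LipschitzWith.of_dist_le_mul fun x y => ?_
    rw [Real.coe_toNNReal _ (by positivity), Real.dist_eq, sub_sub_sub_cancel_left, ← mul_sub,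
      abs_mul, abs_of_pos (by positivity), abs_sub_comm]
    exact mul_le_mul_of_nonneg_left (abs_dist_sub_le x y x₀) (by positivity)
  exact (h1.const_min 1).const_max 0

theorem lipSlope_cutoff_le (x₀ : X) {R : ℝ} (hR : 0 < R) (x : X) :
    lipSlope (cutoff x₀ R) x ≤ (Metric.closedBall x₀ (2 * R)).indicator (fun _ => R⁻¹) x := by
  by_cases hx : x ∈ Metric.closedBall x₀ (2 * R)
  · rw [indicator_of_mem hx]
    refine (lipSlope_le (lipschitzWith_cutoff x₀ hR) x).trans_eq ?_
    rw [Real.coe_toNNReal _ (by positivity)]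
  · rw [indicator_of_notMem hx]
    refine (lipSlope_eq_zero_of_eventually_const ?_).le
    filter_upwards [Metric.isClosed_closedBall.isOpen_compl.mem_nhds hx] with y hy
    rw [cutoff_eq_zero hR hx, cutoff_eq_zero hR hy]

theorem lipSlope_const_mul_le {g : X → ℝ} {K : ℝ≥0} (hg : LipschitzWith K g) (a : ℝ) (x : X) :
    lipSlope (fun y => a * g y) x ≤ |a| * lipSlope g x :=
  lipSlope_comp_le (φ := fun s => a * s) hg (by simpa using (hasDerivAt_id (g x)).const_mul a)

end Mass

/-! ### Mass preservation -/

section Mass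

variable {X : Type*} [MetricSpace X] [MeasurableSpace X] [BorelSpace X] {μ : Measure X} {p q : ℝ}

theorem memLp_cutoff [ProperSpace X] [IsLocallyFiniteMeasure μ] (x₀ : X) {R : ℝ} (hR : 0 < R) :
    MemLp (cutoff x₀ R) 2 μ := by
  refine memLp_of_abs_le_indicator (lipschitzWith_cutoff x₀ hR).continuous.measurable
    (s := Metric.closedBall x₀ (2 * R)) (C := 1) Metric.isClosed_closedBall.measurableSet
    (isCompact_closedBall _ _).measure_lt_top.ne (fun x => ?_) 2
  by_cases hx : x ∈ Metric.closedBall x₀ (2 * R)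
  · rw [indicator_of_mem hx, abs_of_nonneg (cutoff_nonneg _ _ _)]
    exact cutoff_le_one _ _ _
  · rw [indicator_of_notMem hx, cutoff_eq_zero hR hx, abs_zero]

/-- Localized mass balance. The error term is the integral of `R ^ (-q) * (|f| + w) ^ (b * (q - 1))`
over the ball of radius `2 * R`, which the hypothesis `h` bounds by the `L¹`-norm and `∫ Y`. -/
theorem IsHeatFlow.integral_cutoff_le [ProperSpace X] [IsLocallyFiniteMeasure μ]
    (hpq : p.HolderConjugate q) {f : ℝ → Lp ℝ 2 μ} (hf : IsHeatFlow q μ f)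
    (h0 : Integrable (f 0) μ) {t : ℝ} (ht : 0 ≤ t) {b K θ : ℝ} {Y : X → ℝ} {x₀ : X}
    (hb0 : 0 < b) (hb1 : b < 1) (hK : 0 ≤ K) (hY : Integrable Y μ) (hY0 : ∀ x, 0 ≤ Y x)
    (h : ∀ R, 1 ≤ R → ∀ x ∈ Metric.closedBall x₀ (2 * R), ∀ s, 0 ≤ s →
      s ^ (b * (q - 1)) ≤ K * R ^ θ * (s + Y x))
    {σ c R : ℝ} (hσ : |σ| = 1) (hc : 0 < c) (hR : 1 ≤ R) :
    σ * ∫ x, cutoff x₀ R x * f t x ∂μ ≤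
      c * (∫ x, (|f 0 x| + f 0 x ^ 2) / (1 - b) ∂μ) + σ * (∫ x, cutoff x₀ R x * f 0 x ∂μ) +
        t * (1 / q * p ^ (1 - q) * c ^ (1 - q) * K * R ^ (θ - q) *
          (∫ x, |f 0 x| ∂μ + 1 + ∫ x, Y x ∂μ)) := by
  have hR0 : 0 < R := by linarith
  have hq0 := hpq.symm.pos
  have hp0 := hpq.pos
  set S := Metric.closedBall x₀ (2 * R) with hS
  have hSm : MeasurableSet S := Metric.isClosed_closedBall.measurableSet
  have hSf : μ S ≠ ∞ := (isCompact_closedBall _ _).measure_lt_top.ne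
  -- the shift is so small that `∫ w` over the ball is at most `1`
  set w : ℝ := 1 / (μ.real S + 1) with hw
  have hw0 : 0 < w := by positivity
  have hwS : w * μ.real S ≤ 1 := by
    rw [hw, div_mul_eq_mul_div, one_mul, div_le_one (by positivity)]; linarith
  have T : IsTestData q μ b w c (fun _ => w) (fun x => σ * cutoff x₀ R x)
      (S.indicator fun _ => R⁻¹) :=
    .of_const hb0 hb1.ne (by linarith) hw0 hc.le
      ⟨_, (lipschitzWith_smul σ).comp (lipschitzWith_cutoff x₀ hR0)⟩
      ((memLp_cutoff x₀ hR0).const_mul σ) (memLp_indicator_const _ hSm _ (Or.inr hSf)) fun x => by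
        refine (lipSlope_const_mul_le (lipschitzWith_cutoff x₀ hR0) σ x).trans ?_
        rw [hσ, one_mul]
        exact lipSlope_cutoff_le x₀ hR0 x
  set κ : ℝ := 1 / q * p ^ (1 - q) * c ^ (1 - q) * K * R ^ (θ - q) with hκ
  have hκ0 : 0 ≤ κ := by positivity
  have hN : ∀ s, 0 ≤ s → Integrable (f s) μ ∧ ∫ x, |f s x| ∂μ ≤ ∫ x, |f 0 x| ∂μ := fun s hs =>
    hf.integral_abs_le hpq.symm.lt h0 hs
  have hint := (T.isLocallyAC hf).sub_le_integral ht
    (r := fun _ => κ * (∫ x, |f 0 x| ∂μ + 1 + ∫ x, Y x ∂μ)) intervalIntegrable_const (by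
    filter_upwards [T.ae_hasDerivAt_le hpq hc hf, ae_restrict_mem measurableSet_Ioi] with s hs hs0 _
    obtain ⟨D, hD, hle⟩ := hs
    obtain ⟨i1, i2⟩ := hN s (mem_Ioi.1 hs0).le
    have iw : IntegrableOn (fun _ : X => w) S μ := integrableOn_const hSf
    have i4 : IntegrableOn (fun x => |f s x| + w) S μ := i1.abs.integrableOn.add iw
    have i3 : IntegrableOn (fun x => κ * (|f s x| + w + Y x)) S μ :=
      (i4.add hY.integrableOn).const_mul κ
    refine ⟨D, hD, (hle (S.indicator fun x => κ * (|f s x| + w + Y x))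
      ((integrable_indicator_iff hSm).2 i3) (ae_of_all _ fun x => ?_)).trans ?_⟩
    · by_cases hx : x ∈ S
      · rw [indicator_of_mem hx, indicator_of_mem hx]
        have h1 := h R hR x hx (|f s x| + w) (by positivity)
        have e : R⁻¹ ^ q * R ^ θ = R ^ (θ - q) := by
          rw [Real.inv_rpow hR0.le, Real.rpow_sub hR0]; field_simp
        calc _ ≤ 1 / q * p ^ (1 - q) * c ^ (1 - q) *
              (R⁻¹ ^ q * (K * R ^ θ * (|f s x| + w + Y x))) := by gcongr
          _ = _ := by rw [hκ, ← e]; ring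
      · rw [indicator_of_notMem hx, indicator_of_notMem hx, Real.zero_rpow hq0.ne']
        simp
    · rw [integral_indicator hSm, integral_const_mul,
        integral_add i4 hY.integrableOn,
        integral_add i1.abs.integrableOn iw, setIntegral_const, smul_eq_mul]
      refine mul_le_mul_of_nonneg_left (add_le_add (add_le_add ?_ ?_) ?_) hκ0
      · exact (setIntegral_le_integral i1.abs (ae_of_all _ fun x => abs_nonneg _)).trans i2
      · rw [mul_comm]; exact hwS
      · exact setIntegral_le_integral hY (ae_of_all _ hY0))
  rw [intervalIntegral.integral_const, sub_zero, smul_eq_mul, T.testFunctional_eq (Lp.memLp _),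
    T.testFunctional_eq (Lp.memLp _)] at hint
  have e1 : ∀ s, ∫ x, σ * cutoff x₀ R x * f s x ∂μ = σ * ∫ x, cutoff x₀ R x * f s x ∂μ :=
      fun s => by
    rw [← integral_const_mul]
    exact integral_congr_ae (ae_of_all _ fun x => mul_assoc _ _ _)
  rw [e1, e1] at hint
  have h3 : 0 ≤ ∫ x, entropy b w (f t x) ∂μ := integral_nonneg fun x =>
    entropy_nonneg hb1.ne (by linarith) hw0 _
  have h4 : ∫ x, entropy b w (f 0 x) ∂μ ≤ ∫ x, (|f 0 x| + f 0 x ^ 2) / (1 - b) ∂μ :=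
    integral_mono (integrable_entropy hb0 hb1.ne (by linarith) hw0 (fun _ => le_rfl)
      measurable_const (Lp.memLp (f 0))) ((h0.abs.add (Lp.memLp (f 0)).integrable_sq).div_const _)
      fun x => entropy_le_of_lt_one hb0 hb1 hw0 _
  have h5 := mul_le_mul_of_nonneg_left h4 hc.le
  have h6 := mul_nonneg hc.le h3
  linarith

theorem tendsto_integral_cutoff {g : X → ℝ} (hg : Integrable g μ) (x₀ : X) :
    Tendsto (fun n : ℕ => ∫ x, cutoff x₀ ((n : ℝ) + 1) x * g x ∂μ) atTop (𝓝 (∫ x, g x ∂μ)) := by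
  refine tendsto_integral_of_dominated_convergence (fun x => |g x|) (fun n => ?_) hg.abs
    (fun n => ae_of_all _ fun x => ?_) (ae_of_all _ fun x => ?_)
  · exact (lipschitzWith_cutoff x₀ (by positivity)).continuous.measurable.aestronglyMeasurable.mul
      hg.1
  · rw [norm_mul, Real.norm_eq_abs, Real.norm_eq_abs, abs_of_nonneg (cutoff_nonneg _ _ _)]
    exact mul_le_of_le_one_left (abs_nonneg _) (cutoff_le_one _ _ _)
  · simpa using (tendsto_cutoff x₀ x).mul_const (g x)

/-- Mass preservation under a growth condition: in the localized mass balance the radius tends to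
`∞` first, which removes the error term because `θ < q`, and then the factor `c` of the entropy
tends to `0`. -/
theorem IsHeatFlow.integral_eq_of_le_rpow [ProperSpace X] [IsLocallyFiniteMeasure μ]
    (hpq : p.HolderConjugate q) {f : ℝ → Lp ℝ 2 μ} (hf : IsHeatFlow q μ f)
    (h0 : Integrable (f 0) μ) {t : ℝ} (ht : 0 ≤ t) {b K θ : ℝ} {Y : X → ℝ} {x₀ : X}
    (hb0 : 0 < b) (hb1 : b < 1) (hK : 0 ≤ K) (hθ : θ < q) (hY : Integrable Y μ)
    (hY0 : ∀ x, 0 ≤ Y x) (h : ∀ R, 1 ≤ R → ∀ x ∈ Metric.closedBall x₀ (2 * R), ∀ s, 0 ≤ s →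
      s ^ (b * (q - 1)) ≤ K * R ^ θ * (s + Y x)) :
    ∫ x, f t x ∂μ = ∫ x, f 0 x ∂μ := by
  -- the two signs give the two inequalities
  have key : ∀ σ : ℝ, |σ| = 1 → σ * ∫ x, f t x ∂μ ≤ σ * ∫ x, f 0 x ∂μ := by
    intro σ hσ
    have hc : ∀ c : ℝ, 0 < c → σ * ∫ x, f t x ∂μ ≤
        c * (∫ x, (|f 0 x| + f 0 x ^ 2) / (1 - b) ∂μ) + σ * ∫ x, f 0 x ∂μ := by
      intro c hc
      have hR : Tendsto (fun n : ℕ => ((n : ℝ) + 1) ^ (θ - q)) atTop (𝓝 0) := by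
        have h1 := tendsto_rpow_neg_atTop (y := q - θ) (by linarith)
        rw [neg_sub] at h1
        exact h1.comp (tendsto_atTop_add_const_right _ _ tendsto_natCast_atTop_atTop)
      have l1 := ((tendsto_integral_cutoff (hf.integral_abs_le hpq.symm.lt h0 ht).1 x₀).const_mul σ)
      have l2 := (((tendsto_integral_cutoff h0 x₀).const_mul σ).const_add
        (c * (∫ x, (|f 0 x| + f 0 x ^ 2) / (1 - b) ∂μ))).add
        (((hR.const_mul (1 / q * p ^ (1 - q) * c ^ (1 - q) * K)).mul_const
          (∫ x, |f 0 x| ∂μ + 1 + ∫ x, Y x ∂μ)).const_mul t)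
      rw [mul_zero, zero_mul, mul_zero, add_zero] at l2
      exact le_of_tendsto_of_tendsto' l1 l2 fun n =>
        hf.integral_cutoff_le hpq h0 ht hb0 hb1 hK hY hY0 h hσ hc
          (by linarith [n.cast_nonneg (α := ℝ)])
    have l : Tendsto (fun c : ℝ => c * (∫ x, (|f 0 x| + f 0 x ^ 2) / (1 - b) ∂μ) +
        σ * ∫ x, f 0 x ∂μ) (𝓝[>] 0) (𝓝 (σ * ∫ x, f 0 x ∂μ)) := by
      have h1 : Continuous fun c : ℝ => c * (∫ x, (|f 0 x| + f 0 x ^ 2) / (1 - b) ∂μ) +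
        σ * ∫ x, f 0 x ∂μ := by fun_prop
      have h2 := h1.tendsto 0
      rw [zero_mul, zero_add] at h2
      exact h2.mono_left nhdsWithin_le_nhds
    refine ge_of_tendsto l ?_
    filter_upwards [self_mem_nhdsWithin] with c hc' using hc c hc'
  have h1 := key 1 (by simp)
  have h2 := key (-1) (by simp)
  linarith

theorem rpow_le_rpow_sub_one_mul_add {a s T : ℝ} (ha : 0 < a) (ha1 : a ≤ 1) (hs : 0 ≤ s)
    (hT : 0 < T) : s ^ a ≤ T ^ (a - 1) * (s + T) := by
  have e : T ^ (a - 1) * T = T ^ a := by rw [← Real.rpow_add_one hT.ne', sub_add_cancel]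
  have h0 : 0 ≤ T ^ (a - 1) := by positivity
  rcases le_total s T with h | h
  · have := Real.rpow_le_rpow hs h ha.le
    have := mul_nonneg h0 hs
    rw [mul_add, e]; linarith
  · have hs' : 0 < s := hT.trans_le h
    have h1 : s ^ (a - 1) ≤ T ^ (a - 1) := Real.rpow_le_rpow_of_nonpos hT h (by linarith)
    have e' : s ^ (a - 1) * s = s ^ a := by rw [← Real.rpow_add_one hs'.ne', sub_add_cancel]
    have := mul_le_mul_of_nonneg_right h1 hs
    have := mul_nonneg h0 hT.le
    rw [mul_add]; linarith

theorem pexp_neg_pos {p s : ℝ} (hp : 2 < p) (hs : 0 ≤ s) : 0 < pexp p (-s) := by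
  have : 0 < 1 + (2 - p) * -s := by nlinarith
  exact Real.rpow_pos_of_pos this _

theorem pexp_neg_rpow {p s : ℝ} (hp : 2 < p) (hs : 0 ≤ s) :
    pexp p (-s) ^ (2 - p) = 1 + (p - 2) * s := by
  have h : 0 ≤ 1 + (2 - p) * -s := by nlinarith
  have h2 : 2 - p ≠ 0 := by linarith
  rw [pexp, ← Real.rpow_mul h, one_div, inv_mul_cancel₀ h2, Real.rpow_one]
  ring

/-- Mass preservation. For `p > 2` the elementary bound `s ^ a ≤ T ^ (a - 1) * (s + T)` is used with
`a = 3 - p` and `T = V ^ p * pexp p (-V ^ p)`; then `T ^ (a - 1)` is comparable to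
`V ^ (p * (3 - p))`, which grows like `R ^ (p * (3 - p))` at most, and `p * (3 - p) < q`. -/
theorem IsHeatFlow.integral_eq [ProperSpace X] [IsLocallyFiniteMeasure μ]
    (hpq : p.HolderConjugate q) (hp3 : p < 3) (hp2 : p ≠ 2) {V : X → ℝ} {L : ℝ≥0}
    (hV : LipschitzWith L V) {ε : ℝ} (hε : 0 < ε) (hVε : ∀ x, ε ≤ V x)
    (hρ : 2 < p → Integrable (fun x => V x ^ p * pexp p (-(V x ^ p))) μ)
    {f : ℝ → Lp ℝ 2 μ} (hf : IsHeatFlow q μ f)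
    (h0 : Integrable (f 0) μ) {t : ℝ} (ht : 0 ≤ t) :
    ∫ x, f t x ∂μ = ∫ x, f 0 x ∂μ := by
  rcases isEmpty_or_nonempty X with hX | ⟨⟨x₀⟩⟩
  · exact integral_congr_ae (ae_of_all _ fun x => isEmptyElim x)
  have hp1 := hpq.lt
  have hpq1 : (p - 1) * (q - 1) = 1 := by have := hpq.mul_eq_add; linarith
  have hV0 : ∀ x, 0 < V x := fun x => hε.trans_le (hVε x)
  rcases lt_or_gt_of_ne hp2 with hp | hp
  · refine hf.integral_eq_of_le_rpow hpq h0 ht (b := p - 1) (K := 1) (θ := 0) (Y := fun _ => 0)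
      (x₀ := x₀) (by linarith) (by linarith) zero_le_one hpq.symm.pos (integrable_zero _ _ _)
      (fun _ => le_rfl) fun R _ x _ s _ => ?_
    rw [hpq1]; simp
  · -- the choice of `b` makes the exponent of `s` equal to `3 - p`
    have hb : (3 - p) * (p - 1) * (q - 1) = 3 - p := by rw [mul_assoc, hpq1, mul_one]
    set A : ℝ := V x₀ + 2 * L with hA
    have hA0 : 0 < A := by have := hV0 x₀; positivity
    refine hf.integral_eq_of_le_rpow hpq h0 ht (b := (3 - p) * (p - 1))
      (K := (ε ^ (-p) + (p - 2)) * A ^ (p * (3 - p)))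
      (θ := p * (3 - p)) (x₀ := x₀) (Y := fun x => V x ^ p * pexp p (-(V x ^ p)))
      (by nlinarith) (by nlinarith) ?_ ?_ (hρ hp)
      (fun x => mul_nonneg (Real.rpow_nonneg (hV0 x).le _)
        (pexp_neg_pos hp (Real.rpow_nonneg (hV0 x).le _)).le) fun R hR x hx s hs => ?_
    · have : 0 < ε ^ (-p) := by positivity
      have : 0 < A ^ (p * (3 - p)) := by positivity
      have : 0 < p - 2 := by linarith
      positivity
    · have e : q = p / (p - 1) := hpq.conjugate_eq
      rw [e, lt_div_iff₀ (by linarith), mul_assoc]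
      nlinarith [sq_pos_of_pos (by linarith : 0 < p - 2)]
    · rw [hb]
      have hVx := hV0 x
      have hVp : 0 < V x ^ p := by positivity
      have hρx := pexp_neg_pos hp hVp.le
      refine (rpow_le_rpow_sub_one_mul_add (by linarith) (by linarith) hs
        (mul_pos hVp hρx)).trans (mul_le_mul_of_nonneg_right ?_ (by positivity))
      rw [show 3 - p - 1 = 2 - p by ring, Real.mul_rpow hVp.le hρx.le, pexp_neg_rpow hp hVp.le]
      have h1 : V x ≤ A * R := by
        have h2 := hV.dist_le_mul x x₀
        rw [Real.dist_eq] at h2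
        have h3 := mul_le_mul_of_nonneg_left (Metric.mem_closedBall.1 hx) L.2
        have h4 := le_abs_self (V x - V x₀)
        have h5 : V x₀ ≤ V x₀ * R := le_mul_of_one_le_right (hV0 x₀).le hR
        have : A * R = V x₀ * R + L * (2 * R) := by rw [hA]; ring
        rw [this]
        have h6 : (L : ℝ) * dist x x₀ ≤ L * (2 * R) := h3
        linarith
      have e1 : (V x ^ p) ^ (2 - p) * (V x ^ p) = V x ^ (p * (3 - p)) := by
        rw [← Real.rpow_mul hVx.le, ← Real.rpow_add hVx]; congr 1; ring
      have h7 : 1 ≤ ε ^ (-p) * V x ^ p := by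
        rw [Real.rpow_neg hε.le, inv_mul_eq_div, one_le_div (by positivity)]
        exact Real.rpow_le_rpow hε.le (hVε x) (by linarith)
      have h8 : V x ^ (p * (3 - p)) ≤ A ^ (p * (3 - p)) * R ^ (p * (3 - p)) := by
        rw [← Real.mul_rpow hA0.le (by linarith)]
        exact Real.rpow_le_rpow hVx.le h1 (by nlinarith)
      have h9 : 0 ≤ ε ^ (-p) + (p - 2) := by
        have : 0 < ε ^ (-p) := by positivity
        linarith
      calc (V x ^ p) ^ (2 - p) * (1 + (p - 2) * V x ^ p)
          ≤ (V x ^ p) ^ (2 - p) * (ε ^ (-p) * V x ^ p + (p - 2) * V x ^ p) := by gcongr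
        _ = (ε ^ (-p) + (p - 2)) * V x ^ (p * (3 - p)) := by rw [← e1]; ring
        _ ≤ (ε ^ (-p) + (p - 2)) * (A ^ (p * (3 - p)) * R ^ (p * (3 - p))) := by gcongr
        _ = _ := by ring

/-- Positivity: the `L¹`-norm of `f t` is at most its integral. -/
theorem IsHeatFlow.nonneg [ProperSpace X] [IsLocallyFiniteMeasure μ]
    (hpq : p.HolderConjugate q) (hp3 : p < 3) (hp2 : p ≠ 2) {V : X → ℝ} {L : ℝ≥0}
    (hV : LipschitzWith L V) {ε : ℝ} (hε : 0 < ε) (hVε : ∀ x, ε ≤ V x)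
    (hρ : 2 < p → Integrable (fun x => V x ^ p * pexp p (-(V x ^ p))) μ)
    {f : ℝ → Lp ℝ 2 μ} (hf : IsHeatFlow q μ f) (hf0 : ∀ᵐ x ∂μ, 0 ≤ f 0 x)
    (h0 : Integrable (f 0) μ) {t : ℝ} (ht : 0 ≤ t) : ∀ᵐ x ∂μ, 0 ≤ f t x := by
  obtain ⟨h1, h2⟩ := hf.integral_abs_le hpq.symm.lt h0 ht
  have h3 := hf.integral_eq hpq hp3 hp2 hV hε hVε hρ h0 ht
  have h4 : ∫ x, |f 0 x| ∂μ = ∫ x, f 0 x ∂μ :=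
    integral_congr_ae (hf0.mono fun x hx => abs_of_nonneg hx)
  have h5 : ∫ x, (|f t x| - f t x) ∂μ = 0 := by
    refine le_antisymm ?_ (integral_nonneg fun x => sub_nonneg.2 (le_abs_self _))
    rw [integral_sub h1.abs h1]; linarith
  have h6 := (integral_eq_zero_iff_of_nonneg (fun x => sub_nonneg.2 (le_abs_self (f t x)))
    (h1.abs.sub h1)).1 h5
  filter_upwards [h6] with x hx
  have : |f t x| - f t x = 0 := hx
  rw [← sub_eq_zero.1 this]; exact abs_nonneg _

end Mass

/-! ### Fisher information -/

section Fisher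

variable {X : Type*} [MetricSpace X] [MeasurableSpace X] [BorelSpace X] {μ : Measure X} {p q : ℝ}

theorem isLocallyAC_integral_entropy {f : ℝ → Lp ℝ 2 μ} (hf : IsHeatFlow q μ f)
    {b w : ℝ} (hb0 : 0 < b) (hb1 : b ≠ 1) (hb2 : b ≠ 2) (hw : 0 < w) :
    IsLocallyAC fun t => ∫ x, entropy b w (f t x) ∂μ := by
  have T : IsTestData q μ b w 1 (fun _ => w) (fun _ => 0) (fun _ => 0) :=
    .of_const_zero hb0 hb1 hb2 hw zero_le_one
  have h := T.isLocallyAC hf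
  simpa only [T.testFunctional_eq (Lp.memLp (f _)), one_mul, zero_mul, integral_zero,
    add_zero] using h

/-- The dissipation of the regularized entropy bounds the regularized Fisher information. -/
theorem IsHeatFlow.ae_lintegral_le_deriv (hq : 1 < q) {f : ℝ → Lp ℝ 2 μ} (hf : IsHeatFlow q μ f)
    {b w : ℝ} (hb0 : 0 < b) (hb1 : b ≠ 1) (hb2 : b ≠ 2) (hw : 0 < w) :
    ∀ᵐ s ∂(volume.restrict (Ioi (0 : ℝ))), AEMeasurable (relaxedSlope q μ (f s)) μ ∧
      (∃ D, HasDerivAt (fun t => ∫ x, entropy b w (f t x) ∂μ) D s ∧ D ≤ 0) ∧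
      ∫⁻ x, relaxedSlope q μ (f s) x ^ q / ENNReal.ofReal ((|f s x| + w) ^ b) ∂μ ≤
        ENNReal.ofReal (-deriv (fun t => ∫ x, entropy b w (f t x) ∂μ) s) := by
  have T : IsTestData q μ b w 1 (fun _ => w) (fun _ => 0) (fun _ => 0) :=
    .of_const_zero hb0 hb1 hb2 hw zero_le_one
  filter_upwards [T.ae_hasDerivAt hq hf] with s hs
  obtain ⟨D, G, hD, hG, hG0, hGs, hint, hle⟩ := hs
  simp only [T.testFunctional_eq (Lp.memLp (f _)), one_mul, zero_mul, integral_zero,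
    add_zero, zero_sub, mul_neg] at hD hint hle
  rw [integral_neg] at hle
  have hint' : Integrable (fun x => G x ^ (q - 1) * (entropyWeight b w (f s x) * G x)) μ := by
    simpa using hint.neg
  have hnn : ∀ᵐ x ∂μ, 0 ≤ G x ^ (q - 1) * (entropyWeight b w (f s x) * G x) := by
    filter_upwards [hG0] with x hx
    exact mul_nonneg (Real.rpow_nonneg hx _) (mul_nonneg (entropyWeight_nonneg hw _) hx)
  refine ⟨hG.1.aemeasurable.ennreal_ofReal.congr hGs.symm,
    ⟨D, hD, hle.trans (neg_nonpos.2 (integral_nonneg_of_ae hnn))⟩, ?_⟩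
  rw [hD.deriv]
  refine le_trans (le_of_eq ?_) (ENNReal.ofReal_le_ofReal (le_neg_of_le_neg hle))
  rw [ofReal_integral_eq_lintegral_ofReal hint' hnn]
  refine lintegral_congr_ae ?_
  filter_upwards [hG0, hGs] with x h0 hx
  have hpos : 0 < |f s x| + w := by positivity
  have e : G x ^ (q - 1) * (entropyWeight b w (f s x) * G x) = G x ^ q / (|f s x| + w) ^ b := by
    rw [entropyWeight, Real.rpow_neg hpos.le]
    rcases h0.eq_or_lt with h | h
    · rw [← h, Real.zero_rpow (by linarith : q ≠ 0)]; simp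
    · rw [mul_left_comm, ← Real.rpow_add_one h.ne', sub_add_cancel, inv_mul_eq_div]
  rw [hx, e, ENNReal.ofReal_div_of_pos (by positivity),
    ENNReal.ofReal_rpow_of_nonneg h0 (by linarith)]

/-- The time integral of the Fisher information is at most the limit of the decrease of the
regularized entropies. Fatou's lemma is applied in time to the derivatives of the entropies, which
are measurable, since the Fisher information need not be measurable in time. -/
theorem IsHeatFlow.lintegral_fisher_le (hpq : p.HolderConjugate q) (hp3 : p < 3) (hp2 : p ≠ 2)
    {f : ℝ → Lp ℝ 2 μ} (hf : IsHeatFlow q μ f) {t A : ℝ} {a : ℕ → ℝ}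
    (ha : ∀ n : ℕ, ∫ x, entropy (p - 1) (1 / ((n : ℝ) + 1)) (f 0 x) ∂μ -
      ∫ x, entropy (p - 1) (1 / ((n : ℝ) + 1)) (f t x) ∂μ ≤ a n)
    (hA : Tendsto a atTop (𝓝 A)) :
    ∫⁻ s in Ioc 0 t, fisher p q μ (f s) ≤ ENNReal.ofReal A := by
  have hp1 := hpq.lt
  have hb0 : 0 < p - 1 := by linarith
  have hb1 : p - 1 ≠ 1 := fun h => hp2 (by linarith)
  have hb2 : p - 1 ≠ 2 := by linarith
  have hw : ∀ n : ℕ, (0 : ℝ) < 1 / ((n : ℝ) + 1) := fun n => Nat.one_div_pos_of_nat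
  set Z : ℕ → ℝ → ℝ := fun n t => ∫ x, entropy (p - 1) (1 / ((n : ℝ) + 1)) (f t x) ∂μ with hZ
  have hae := ae_all_iff.2 fun n => hf.ae_lintegral_le_deriv hpq.symm.lt hb0 hb1 hb2 (hw n)
  have hfish : ∀ᵐ s ∂(volume.restrict (Ioc 0 t)), fisher p q μ (f s) ≤
      liminf (fun n => ENNReal.ofReal (-deriv (Z n) s)) atTop := by
    filter_upwards [ae_restrict_of_ae_restrict_of_subset Ioc_subset_Ioi_self hae] with s hs
    have hm : AEMeasurable (relaxedSlope q μ (f s)) μ := (hs 0).1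
    have hfm := (Lp.memLp (f s)).1.aemeasurable
    set φ : ℕ → X → ℝ≥0∞ := fun n x =>
      relaxedSlope q μ (f s) x ^ q /
        ENNReal.ofReal ((|f s x| + 1 / ((n : ℝ) + 1)) ^ (p - 1)) with hφ
    have hS : NullMeasurableSet {x | 0 < f s x} μ := nullMeasurableSet_lt aemeasurable_const hfm
    calc fisher p q μ (f s) = ∫⁻ x in {x | 0 < f s x}, liminf (fun n => φ n x) atTop ∂μ := by
          rw [fisher]
          refine lintegral_congr_ae ?_
          filter_upwards [ae_restrict_mem₀ hS] with x hx
          have hx' : 0 < f s x := hx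
          refine (Tendsto.liminf_eq ?_).symm
          have h1 : Tendsto (fun n : ℕ => (|f s x| + 1 / ((n : ℝ) + 1)) ^ (p - 1)) atTop
              (𝓝 (f s x ^ (p - 1))) := by
            have h2 := (tendsto_one_div_add_atTop_nhds_zero_nat (𝕜 := ℝ)).const_add |f s x|
            rw [add_zero, abs_of_pos hx'] at h2
            rw [abs_of_pos hx']
            exact h2.rpow_const (Or.inr hb0.le)
          exact ENNReal.Tendsto.const_div (ENNReal.tendsto_ofReal h1)
            (Or.inl ENNReal.ofReal_ne_top)
      _ ≤ liminf (fun n => ∫⁻ x in {x | 0 < f s x}, φ n x ∂μ) atTop :=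
          lintegral_liminf_le' fun n => ((hm.pow_const q).div
            (((hfm.abs.add_const _).pow_const _).ennreal_ofReal)).restrict
      _ ≤ _ := by
          refine liminf_le_liminf (Eventually.of_forall fun n => ?_)
          exact (setLIntegral_le_lintegral _ _).trans (hs n).2.2
  calc ∫⁻ s in Ioc 0 t, fisher p q μ (f s)
      ≤ ∫⁻ s in Ioc 0 t, liminf (fun n => ENNReal.ofReal (-deriv (Z n) s)) atTop :=
        lintegral_mono_ae hfish
    _ ≤ liminf (fun n => ∫⁻ s in Ioc 0 t, ENNReal.ofReal (-deriv (Z n) s)) atTop :=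
        lintegral_liminf_le fun n => (measurable_deriv _).neg.ennreal_ofReal
    _ ≤ liminf (fun n => ENNReal.ofReal (a n)) atTop := by
        refine liminf_le_liminf (Eventually.of_forall fun n => ?_)
        refine ((isLocallyAC_integral_entropy hf hb0 hb1 hb2 (hw n)).lintegral_deriv_le ?_).trans
          (ENNReal.ofReal_le_ofReal (ha n))
        filter_upwards [hae] with s hs using (hs n).2.1
    _ = ENNReal.ofReal A := (ENNReal.tendsto_ofReal hA).liminf_eq

end Fisher

/-! ### Truncated weights -/

section Weight

variable {X : Type*} [MetricSpace X]

/-- A Lipschitz truncation of `V` with bounded support. The slope `k⁻¹` of the cutoff tends to `0`,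
so that the Lipschitz constant of `V` is recovered as `k → ∞`. -/
def trunc (V : X → ℝ) (x₀ : X) (k : ℝ) (x : X) : ℝ := min (V x) (max 0 (k - k⁻¹ * dist x x₀))

variable {V : X → ℝ} {x₀ : X} {k : ℝ}

theorem trunc_le (x : X) : trunc V x₀ k x ≤ V x := min_le_left _ _

theorem trunc_nonneg (hV : ∀ x, 0 ≤ V x) (x : X) : 0 ≤ trunc V x₀ k x :=
  le_min (hV x) (le_max_left _ _)

theorem trunc_le_radius (hk : 0 < k) (x : X) : trunc V x₀ k x ≤ k :=
  (min_le_right _ _).trans (max_le hk.le (by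
    have : 0 ≤ k⁻¹ * dist x x₀ := by positivity
    linarith))

theorem trunc_eq_zero (hV : ∀ x, 0 ≤ V x) (hk : 0 < k) {x : X}
    (hx : x ∉ Metric.closedBall x₀ (k ^ 2)) : trunc V x₀ k x = 0 := by
  rw [Metric.mem_closedBall, not_le] at hx
  have : k ≤ k⁻¹ * dist x x₀ := by
    rw [inv_mul_eq_div, le_div_iff₀ hk, ← sq]; exact hx.le
  rw [trunc, max_eq_left (by linarith), min_eq_right (hV x)]

theorem tendsto_trunc (x : X) :
    Tendsto (fun n : ℕ => trunc V x₀ ((n : ℝ) + 1) x) atTop (𝓝 (V x)) := by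
  refine tendsto_const_nhds.congr' ?_
  filter_upwards [eventually_ge_atTop ⌈V x + dist x x₀⌉₊] with n hn
  have h1 : V x + dist x x₀ ≤ n := Nat.ceil_le.1 hn
  have h2 : ((n : ℝ) + 1)⁻¹ * dist x x₀ ≤ dist x x₀ :=
    mul_le_of_le_one_left dist_nonneg (inv_le_one_of_one_le₀ (by linarith [n.cast_nonneg (α := ℝ)]))
  rw [trunc, min_eq_left (le_max_of_le_right (by linarith))]

theorem lipschitzWith_trunc {L : ℝ≥0} (hV : LipschitzWith L V) (hk : 0 < k) :
    LipschitzWith (max L (k⁻¹).toNNReal) (trunc V x₀ k) := by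
  have h1 : LipschitzWith (k⁻¹).toNNReal fun x : X => k - k⁻¹ * dist x x₀ := by
    refine LipschitzWith.of_dist_le_mul fun x y => ?_
    rw [Real.coe_toNNReal _ (by positivity), Real.dist_eq, sub_sub_sub_cancel_left, ← mul_sub,
      abs_mul, abs_of_pos (by positivity), abs_sub_comm]
    exact mul_le_mul_of_nonneg_left (abs_dist_sub_le x y x₀) (by positivity)
  exact hV.min (h1.const_max 0)

theorem exists_lipschitzWith_rpow {p : ℝ} (hp : 1 ≤ p) {g : X → ℝ} {K : ℝ≥0}
    (hg : LipschitzWith K g) {C : ℝ} (h0 : ∀ x, 0 ≤ g x) (hC : ∀ x, g x ≤ C) :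
    ∃ K' : ℝ≥0, LipschitzWith K' fun x => g x ^ p := by
  have h : LipschitzOnWith (p * C ^ (p - 1)).toNNReal (fun s : ℝ => s ^ p) (Icc 0 C) := by
    refine Convex.lipschitzOnWith_of_nnnorm_hasDerivWithin_le (convex_Icc 0 C)
      (fun s _ => (Real.hasDerivAt_rpow_const (Or.inr hp)).hasDerivWithinAt) fun s hs => ?_
    rw [← NNReal.coe_le_coe, coe_nnnorm, Real.norm_of_nonneg
      (mul_nonneg (by linarith) (Real.rpow_nonneg hs.1 _))]
    refine le_trans ?_ (Real.le_coe_toNNReal _)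
    exact mul_le_mul_of_nonneg_left (Real.rpow_le_rpow hs.1 hs.2 (by linarith)) (by linarith)
  refine ⟨(p * C ^ (p - 1)).toNNReal * K, ?_⟩
  have := h.comp (hg.lipschitzOnWith (s := univ)) fun x _ => ⟨h0 x, hC x⟩
  exact lipschitzOnWith_univ.1 this

end Weight

/-! ### Truncated moments -/

section Moment

variable {X : Type*} [MetricSpace X] [MeasurableSpace X] [BorelSpace X] {μ : Measure X} {p q : ℝ}

section TruncatedWeight

variable {V : X → ℝ} {L : ℝ≥0} {x₀ : X} {k : ℝ}

theorem memLp_trunc_rpow [ProperSpace X] [IsLocallyFiniteMeasure μ] (hV : LipschitzWith L V)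
    (hV0 : ∀ x, 0 ≤ V x) (hk : 0 < k) {a : ℝ} (ha : 0 < a) (r : ℝ≥0∞) :
    MemLp (fun x => trunc V x₀ k x ^ a) r μ := by
  refine memLp_of_abs_le_indicator ((lipschitzWith_trunc hV hk).continuous.measurable.pow_const a)
    (s := Metric.closedBall x₀ (k ^ 2)) (C := k ^ a) Metric.isClosed_closedBall.measurableSet
    (isCompact_closedBall _ _).measure_lt_top.ne (fun x => ?_) r
  by_cases hx : x ∈ Metric.closedBall x₀ (k ^ 2)
  · rw [indicator_of_mem hx, abs_of_nonneg (Real.rpow_nonneg (trunc_nonneg hV0 x) _)]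
    exact Real.rpow_le_rpow (trunc_nonneg hV0 x) (trunc_le_radius hk x) ha.le
  · rw [indicator_of_notMem hx, trunc_eq_zero hV0 hk hx, Real.zero_rpow ha.ne', abs_zero]

theorem lipSlope_trunc_rpow_le {X : Type*} [MetricSpace X] {V : X → ℝ} {x₀ : X}
    (hp : 1 < p) (hV : LipschitzWith L V) (hV0 : ∀ x, 0 ≤ V x) (hk : 0 < k) (x : X) :
    lipSlope (fun y => trunc V x₀ k y ^ p) x ≤
      p * trunc V x₀ k x ^ (p - 1) * (max L (k⁻¹).toNNReal : ℝ≥0) := by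
  have h0 := trunc_nonneg (x₀ := x₀) (k := k) hV0 x
  have h1 : 0 ≤ p * trunc V x₀ k x ^ (p - 1) := by positivity
  refine (lipSlope_comp_le (φ := fun s => s ^ p) (lipschitzWith_trunc hV hk)
    (Real.hasDerivAt_rpow_const (Or.inr hp.le))).trans ?_
  rw [abs_of_nonneg h1]
  exact mul_le_mul_of_nonneg_left (lipSlope_le (lipschitzWith_trunc hV hk) x) h1

theorem isTestData_trunc [ProperSpace X] [IsLocallyFiniteMeasure μ] (hpq : p.HolderConjugate q)
    (hp3 : p < 3) (hp2 : p ≠ 2) (hV : LipschitzWith L V) (hV0 : ∀ x, 0 ≤ V x) (hk : 0 < k)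
    {w β : ℝ} (hw : 0 < w) (hβ : 0 ≤ β) :
    IsTestData q μ (p - 1) w (3 - p) (fun _ => w) (fun x => β * trunc V x₀ k x ^ p)
      (fun x => β * (p * trunc V x₀ k x ^ (p - 1) * (max L (k⁻¹).toNNReal : ℝ≥0))) := by
  have hp1 := hpq.lt
  obtain ⟨K, hK⟩ := exists_lipschitzWith_rpow hp1.le (lipschitzWith_trunc (x₀ := x₀) hV hk)
    (trunc_nonneg hV0) (trunc_le_radius hk)
  refine .of_const (by linarith) (fun h => hp2 (by linarith)) (by linarith) hw (by linarith)
    ⟨_, (lipschitzWith_smul β).comp hK⟩ ((memLp_trunc_rpow hV hV0 hk hpq.pos 2).const_mul β)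
    ((((memLp_trunc_rpow hV hV0 hk (by linarith) _).const_mul p).mul_const _).const_mul β)
    fun x => ?_
  refine (lipSlope_const_mul_le hK β x).trans ?_
  rw [abs_of_nonneg hβ]
  exact mul_le_mul_of_nonneg_left (lipSlope_trunc_rpow_le hp1 hV hV0 hk x) hβ

/-- The factor in the differential inequality for the moment with weight `β V ^ p`, where `l` is a
Lipschitz constant of `V`. -/
def momentRate (p q β l : ℝ) : ℝ := (β * p * l) ^ q * (p * (3 - p)) ^ (1 - q) / q

/-- The differential inequality for the entropy plus a truncated moment. Since
`(p - 1) * (q - 1) = 1` and `(p - 1) * q = p`, Young's inequality reproduces the truncated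
moment itself. -/
theorem ae_hasDerivAt_trunc_le [ProperSpace X] [IsLocallyFiniteMeasure μ]
    (hpq : p.HolderConjugate q)
    (hp3 : p < 3) (hp2 : p ≠ 2) (hV : LipschitzWith L V) (hV0 : ∀ x, 0 ≤ V x) (hk : 0 < k)
    {w β : ℝ} (hw : 0 < w) (hβ : 0 ≤ β) {f : ℝ → Lp ℝ 2 μ} (hf : IsHeatFlow q μ f)
    (hf0 : ∀ s, 0 ≤ s → ∀ᵐ x ∂μ, 0 ≤ f s x) :
    ∀ᵐ s ∂(volume.restrict (Ioi (0 : ℝ))), ∃ D : ℝ,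
      HasDerivAt (fun s => testFunctional μ (p - 1) (3 - p) (fun _ => w)
        (fun x => β * trunc V x₀ k x ^ p) (f s)) D s ∧
      D ≤ momentRate p q β (max L (k⁻¹).toNNReal : ℝ≥0) *
        (∫ x, trunc V x₀ k x ^ p * f s x ∂μ + w * ∫ x, trunc V x₀ k x ^ p ∂μ) := by
  have T := isTestData_trunc (μ := μ) (x₀ := x₀) hpq hp3 hp2 hV hV0 hk hw hβ
  have hp1 := hpq.lt
  have hp0 := hpq.pos
  have hq0 := hpq.symm.pos
  have hpq1 : (p - 1) * (q - 1) = 1 := by have := hpq.mul_eq_add; linarith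
  have hpq2 : (p - 1) * q = p := by have := hpq.mul_eq_add; linarith
  filter_upwards [T.ae_hasDerivAt_le hpq (by linarith) hf, ae_restrict_mem measurableSet_Ioi]
    with s hs hs0
  obtain ⟨D, hD, hle⟩ := hs
  refine ⟨D, hD, ?_⟩
  set l : ℝ := ((max L (k⁻¹).toNNReal : ℝ≥0) : ℝ)
  have hl : 0 ≤ l := NNReal.coe_nonneg _
  have i1 : Integrable (fun x => trunc V x₀ k x ^ p * f s x) μ :=
    (memLp_trunc_rpow hV hV0 hk hp0 2).integrable_mul (Lp.memLp (f s))
  have i2 : Integrable (fun x => w * trunc V x₀ k x ^ p) μ :=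
    (memLp_one_iff_integrable.1 (memLp_trunc_rpow hV hV0 hk hp0 1)).const_mul w
  refine (hle _ ((i1.add i2).const_mul (momentRate p q β l)) ?_).trans (le_of_eq ?_)
  · filter_upwards [hf0 s (mem_Ioi.1 hs0).le] with x hx
    have h0 := trunc_nonneg (x₀ := x₀) (k := k) hV0 x
    rw [hpq1, Real.rpow_one, abs_of_nonneg hx, show β * (p * trunc V x₀ k x ^ (p - 1) * l) =
      β * p * l * trunc V x₀ k x ^ (p - 1) by ring, Real.mul_rpow (by positivity) (by positivity),
      ← Real.rpow_mul h0, hpq2, momentRate, Real.mul_rpow hp0.le (by linarith)]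
    refine le_of_eq ?_
    simp only [Pi.add_apply]
    ring
  · rw [integral_const_mul]
    simp only [Pi.add_apply]
    rw [integral_add i1 i2, integral_const_mul]

theorem tendsto_integral_trunc [ProperSpace X] [IsLocallyFiniteMeasure μ] (hV : LipschitzWith L V)
    (hV0 : ∀ x, 0 ≤ V x) (hp : 0 < p)
    {g : X → ℝ} (hg : MemLp g 2 μ) (hVg : Integrable (fun x => V x ^ p * g x) μ) :
    Tendsto (fun n : ℕ => ∫ x, trunc V x₀ ((n : ℝ) + 1) x ^ p * g x ∂μ) atTop
      (𝓝 (∫ x, V x ^ p * g x ∂μ)) := by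
  refine tendsto_integral_of_dominated_convergence _ (fun n => ?_) hVg.abs
    (fun n => ae_of_all _ fun x => ?_) (ae_of_all _ fun x => ?_)
  · exact (memLp_trunc_rpow hV hV0 (by positivity) hp 2).1.mul hg.1
  · rw [Real.norm_eq_abs, abs_mul, abs_mul]
    refine mul_le_mul_of_nonneg_right ?_ (abs_nonneg _)
    have h0 := trunc_nonneg (x₀ := x₀) (k := (n : ℝ) + 1) hV0 x
    rw [abs_of_nonneg (by positivity), abs_of_nonneg (Real.rpow_nonneg (hV0 x) _)]
    exact Real.rpow_le_rpow h0 (trunc_le x) hp.le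
  · exact ((tendsto_trunc x).rpow_const (Or.inr hp.le)).mul_const _

theorem tendsto_momentRate (hq : 0 < q) (β : ℝ) :
    Tendsto (fun n : ℕ => momentRate p q β (max L (((n : ℝ) + 1)⁻¹).toNNReal : ℝ≥0)) atTop
      (𝓝 (momentRate p q β L)) := by
  have h1 : Tendsto (fun n : ℕ => ((max L (((n : ℝ) + 1)⁻¹).toNNReal : ℝ≥0) : ℝ)) atTop
      (𝓝 (L : ℝ)) := by
    have h2 : Tendsto (fun n : ℕ => ((n : ℝ) + 1)⁻¹) atTop (𝓝 0) := by
      simpa using tendsto_one_div_add_atTop_nhds_zero_nat (𝕜 := ℝ)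
    have h3 := (tendsto_const_nhds (x := L)).max (tendsto_real_toNNReal h2)
    rw [Real.toNNReal_zero, max_eq_left zero_le] at h3
    exact NNReal.tendsto_coe.2 h3
  unfold momentRate
  exact (((h1.const_mul (β * p)).rpow_const (Or.inr hq.le)).mul_const _).div_const _

end TruncatedWeight

section Small

theorem tendsto_entropy_of_lt_one {b : ℝ} (hb1 : b < 1) (r : ℝ) :
    Tendsto (fun n : ℕ => entropy b (1 / ((n : ℝ) + 1)) r) atTop
      (𝓝 (|r| ^ (2 - b) / ((1 - b) * (2 - b)))) := by
  have hw := tendsto_one_div_add_atTop_nhds_zero_nat (𝕜 := ℝ)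
  have h1 : Tendsto (fun n : ℕ => (|r| + 1 / ((n : ℝ) + 1)) ^ (2 - b)) atTop
      (𝓝 (|r| ^ (2 - b))) := by
    have := hw.const_add |r|
    rw [add_zero] at this
    exact this.rpow_const (Or.inr (by linarith))
  have h2 : Tendsto (fun n : ℕ => (1 / ((n : ℝ) + 1)) ^ (2 - b)) atTop (𝓝 0) := by
    have := hw.rpow_const (p := 2 - b) (Or.inr (by linarith))
    rwa [Real.zero_rpow (by linarith)] at this
  have h3 : Tendsto (fun n : ℕ => (1 / ((n : ℝ) + 1)) ^ (1 - b)) atTop (𝓝 0) := by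
    have := hw.rpow_const (p := 1 - b) (Or.inr (by linarith))
    rwa [Real.zero_rpow (by linarith)] at this
  have := ((h1.sub h2).div_const ((1 - b) * (2 - b))).sub ((h3.mul_const |r|).div_const (1 - b))
  simpa [entropy] using this

theorem integrable_rpow_of_lt_two {X : Type*} [MeasurableSpace X] {μ : Measure X} {g : X → ℝ}
    {a : ℝ} (ha1 : 1 ≤ a) (ha2 : a ≤ 2) (hg : Integrable g μ) (hg2 : MemLp g 2 μ) :
    Integrable (fun x => |g x| ^ a) μ := by
  refine (hg.abs.add hg2.integrable_sq).mono'
    (hg.1.aemeasurable.abs.pow_const a).aestronglyMeasurable (ae_of_all _ fun x => ?_)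
  have h0 := abs_nonneg (g x)
  rw [Real.norm_of_nonneg (by positivity), Pi.add_apply, ← sq_abs]
  rcases le_total |g x| 1 with h | h
  · have h1 : |g x| ^ a ≤ |g x| ^ (1 : ℝ) := by
      rcases h0.eq_or_lt with h' | h'
      · rw [← h', Real.zero_rpow (by linarith), Real.zero_rpow one_ne_zero]
      · exact Real.rpow_le_rpow_of_exponent_ge h' h ha1
    rw [Real.rpow_one] at h1
    have := sq_nonneg |g x|
    linarith
  · have h1 := Real.rpow_le_rpow_of_exponent_le h ha2
    rw [Real.rpow_two] at h1
    linarith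

theorem tendsto_integral_entropy_of_lt_one {X : Type*} [MeasurableSpace X] {μ : Measure X}
    {b : ℝ} (hb0 : 0 < b) (hb1 : b < 1) {g : X → ℝ}
    (hg : Integrable g μ) (hg2 : MemLp g 2 μ) :
    Tendsto (fun n : ℕ => ∫ x, entropy b (1 / ((n : ℝ) + 1)) (g x) ∂μ) atTop
      (𝓝 ((∫ x, |g x| ^ (2 - b) ∂μ) / ((1 - b) * (2 - b)))) := by
  rw [← integral_div]
  have hw : ∀ n : ℕ, (0 : ℝ) < 1 / ((n : ℝ) + 1) := fun n => Nat.one_div_pos_of_nat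
  refine tendsto_integral_of_dominated_convergence (fun x => (|g x| + g x ^ 2) / (1 - b))
    (fun n => (integrable_entropy hb0 hb1.ne (by linarith) (hw n) (fun _ => le_rfl)
      measurable_const hg2).1) ((hg.abs.add hg2.integrable_sq).div_const _)
    (fun n => ae_of_all _ fun x => ?_) (ae_of_all _ fun x => tendsto_entropy_of_lt_one hb1 _)
  rw [Real.norm_of_nonneg (entropy_nonneg hb1.ne (by linarith) (hw n) _)]
  exact entropy_le_of_lt_one hb0 hb1 (hw n) _

end Small

end Moment

/-! ### The moment for `p < 2` -/

section MomentSmall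

variable {X : Type*} [MetricSpace X] [MeasurableSpace X] [BorelSpace X] {μ : Measure X} {p q : ℝ}

theorem momentRate_nonneg (hp0 : 0 ≤ p) (hp3 : p ≤ 3) (hq : 0 < q) {β l : ℝ} (hβ : 0 ≤ β)
    (hl : 0 ≤ l) : 0 ≤ momentRate p q β l := by
  have : 0 ≤ 3 - p := by linarith
  rw [momentRate]
  positivity

/-- The weight `p * (3 - p) ^ (1 - p)` turns the rate of the truncated differential inequality
into the rate constant for `p < 2`. -/
theorem momentRate_div_eq (hpq : p.HolderConjugate q) (hp3 : p < 3) {l : ℝ} (hl : 0 ≤ l) :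
    momentRate p q (p * (3 - p) ^ (1 - p)) l / (p * (3 - p) ^ (1 - p)) =
      (p / (3 - p)) ^ q / q * l ^ q := by
  have hp0 := hpq.pos
  have h3 : 0 < 3 - p := by linarith
  have hpq1 : (1 - p) * q = -p := by have := hpq.mul_eq_add; linarith
  have e1 : p ^ (1 - q) = p * (p ^ q)⁻¹ := by
    rw [Real.rpow_sub hp0, Real.rpow_one, div_eq_mul_inv]
  have e2 : (3 - p) ^ (1 - q) = (3 - p) * ((3 - p) ^ q)⁻¹ := by
    rw [Real.rpow_sub h3, Real.rpow_one, div_eq_mul_inv]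
  have e3 : (3 - p) ^ (1 - p) = (3 - p) * ((3 - p) ^ p)⁻¹ := by
    rw [Real.rpow_sub h3, Real.rpow_one, div_eq_mul_inv]
  have e4 : ((3 - p) ^ (1 - p)) ^ q = ((3 - p) ^ p)⁻¹ := by
    rw [← Real.rpow_mul h3.le, hpq1, Real.rpow_neg h3.le]
  have hA : 0 ≤ (3 - p) ^ (1 - p) := by positivity
  rw [momentRate, Real.mul_rpow (by positivity) hl, Real.mul_rpow (by positivity) hp0.le,
    Real.mul_rpow hp0.le hA, e4, Real.mul_rpow hp0.le h3.le, e1, e2, e3,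
    Real.div_rpow hp0.le h3.le]
  have := hpq.symm.pos
  have : 0 < p ^ q := by positivity
  have : 0 < (3 - p) ^ q := by positivity
  have : 0 < (3 - p) ^ p := by positivity
  field_simp

theorem one_le_mul_rpow (hp1 : 1 < p) (hp2 : p < 2) : 1 ≤ p * (3 - p) ^ (1 - p) := by
  have h3 : 0 < 3 - p := by linarith
  have h := rpow_one_add_le_one_add_mul_self (s := 2 - p) (by linarith) (p := p - 1)
    (by linarith) (by linarith)
  rw [show 1 + (2 - p) = 3 - p by ring] at h
  rw [show 1 - p = -(p - 1) by ring, Real.rpow_neg h3.le, ← div_eq_mul_inv,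
    one_le_div (by positivity)]
  nlinarith

theorem IsHeatFlow.lintegral_fisher_le_of_lt_two (hpq : p.HolderConjugate q) (hp2 : p < 2)
    {f : ℝ → Lp ℝ 2 μ} (hf : IsHeatFlow q μ f) (hf0 : ∀ᵐ x ∂μ, 0 ≤ f 0 x)
    (h0 : Integrable (f 0) μ) (t : ℝ) :
    ∫⁻ s in Ioc 0 t, fisher p q μ (f s) ≤
      ENNReal.ofReal (1 / (3 - p) * ((∫ x, f 0 x ^ (3 - p) ∂μ) / (2 - p))) := by
  have hp1 := hpq.lt
  have hw : ∀ n : ℕ, (0 : ℝ) < 1 / ((n : ℝ) + 1) := fun n => Nat.one_div_pos_of_nat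
  have hlim := tendsto_integral_entropy_of_lt_one (b := p - 1) (by linarith) (by linarith) h0
    (Lp.memLp (f 0))
  have hE : ∫ x, |f 0 x| ^ (3 - p) ∂μ = ∫ x, f 0 x ^ (3 - p) ∂μ :=
    integral_congr_ae (hf0.mono fun x hx => by simp only [abs_of_nonneg hx])
  rw [show 2 - (p - 1) = 3 - p by ring, show 1 - (p - 1) = 2 - p by ring, hE] at hlim
  refine (hf.lintegral_fisher_le hpq (by linarith) hp2.ne (fun n => ?_) hlim).trans_eq ?_
  · have : 0 ≤ ∫ x, entropy (p - 1) (1 / ((n : ℝ) + 1)) (f t x) ∂μ := integral_nonneg fun x =>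
      entropy_nonneg (by linarith : p - 1 < 1).ne (by linarith : p - 1 < 2).ne (hw n) _
    linarith
  · congr 1
    have : 2 - p ≠ 0 := by linarith
    have : 3 - p ≠ 0 := by linarith
    field_simp

variable [ProperSpace X] [IsLocallyFiniteMeasure μ] {V : X → ℝ} {L : ℝ≥0} {x₀ : X} {k : ℝ}
  {f : ℝ → Lp ℝ 2 μ}

/-- Grönwall's inequality for the truncated moment. For `p < 2` the entropy is nonnegative, so it
can be added to the moment on the right-hand side and dropped on the left. -/
theorem IsHeatFlow.integral_trunc_le_of_lt_two (hpq : p.HolderConjugate q) (hp2 : p < 2)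
    (hV : LipschitzWith L V) (hV0 : ∀ x, 0 ≤ V x) (hk : 0 < k) (hf : IsHeatFlow q μ f)
    (hf0 : ∀ s, 0 ≤ s → ∀ᵐ x ∂μ, 0 ≤ f s x) (h0 : Integrable (f 0) μ) {β : ℝ} (hβ : 0 < β) {t : ℝ}
    (ht : 0 ≤ t) :
    β * ∫ x, trunc V x₀ k x ^ p * f t x ∂μ ≤
      Real.exp (momentRate p q β (max L (k⁻¹).toNNReal : ℝ≥0) / β * t) *
        ((∫ x, |f 0 x| ^ (3 - p) ∂μ) / (2 - p) + β * ∫ x, trunc V x₀ k x ^ p * f 0 x ∂μ) := by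
  have hp1 := hpq.lt
  have h3 : 0 < 3 - p := by linarith
  set κ := momentRate p q β (max L (k⁻¹).toNNReal : ℝ≥0) with hκ
  have hκ0 : 0 ≤ κ := momentRate_nonneg hpq.pos.le (by linarith) hpq.symm.pos hβ.le
    (NNReal.coe_nonneg _)
  set M : ℝ → ℝ := fun s => ∫ x, trunc V x₀ k x ^ p * f s x ∂μ with hM
  set I : ℝ := ∫ x, trunc V x₀ k x ^ p ∂μ with hI
  have key : ∀ w : ℝ, 0 < w → β * M t ≤ Real.exp (κ / β * t) *
      ((3 - p) * (∫ x, entropy (p - 1) w (f 0 x) ∂μ) + β * M 0 + β * w * I) := by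
    intro w hw
    have T := isTestData_trunc (μ := μ) (x₀ := x₀) hpq (by linarith) hp2.ne hV hV0 hk hw hβ.le
    have e : ∀ s, testFunctional μ (p - 1) (3 - p) (fun _ => w)
        (fun x => β * trunc V x₀ k x ^ p) (f s) =
        (3 - p) * (∫ x, entropy (p - 1) w (f s x) ∂μ) + β * M s := fun s => by
      rw [T.testFunctional_eq (Lp.memLp _)]
      simp only [hM, mul_assoc, integral_const_mul]
    have hnn : ∀ s, 0 ≤ (3 - p) * ∫ x, entropy (p - 1) w (f s x) ∂μ := fun s =>
      mul_nonneg h3.le (integral_nonneg fun x =>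
        entropy_nonneg (by linarith : p - 1 < 1).ne (by linarith : p - 1 < 2).ne hw _)
    have hI0 : 0 ≤ β * w * I := mul_nonneg (by positivity) (integral_nonneg fun x =>
      Real.rpow_nonneg (trunc_nonneg hV0 x) _)
    have hg := (T.isLocallyAC hf).add_le_exp_mul (κ := κ / β) (d := β * w * I) ht (by
      filter_upwards [ae_hasDerivAt_trunc_le (x₀ := x₀) hpq (by linarith) hp2.ne hV hV0 hk hw
        hβ.le hf hf0] with s hs _
      obtain ⟨D, hD, hle⟩ := hs
      refine ⟨D, hD, hle.trans ?_⟩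
      rw [e]
      calc κ * (M s + w * I) = κ / β * (β * M s + β * w * I) := by field_simp
        _ ≤ _ := mul_le_mul_of_nonneg_left (by linarith [hnn s]) (by positivity))
    rw [e, e] at hg
    linarith [hnn t]
  have hw : ∀ n : ℕ, (0 : ℝ) < 1 / ((n : ℝ) + 1) := fun n => Nat.one_div_pos_of_nat
  have hlim := tendsto_integral_entropy_of_lt_one (b := p - 1) (by linarith) (by linarith) h0
    (Lp.memLp (f 0))
  have hlim2 := ((((hlim.const_mul (3 - p)).add_const (β * M 0)).add
    (((tendsto_one_div_add_atTop_nhds_zero_nat (𝕜 := ℝ)).const_mul β).mul_const I))).const_mul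
      (Real.exp (κ / β * t))
  refine (ge_of_tendsto' hlim2 fun n => key _ (hw n)).trans (le_of_eq ?_)
  rw [show 2 - (p - 1) = 3 - p by ring, show 1 - (p - 1) = 2 - p by ring]
  have : 2 - p ≠ 0 := by linarith
  field_simp
  ring

/-- Propagation of the moment for `p < 2`. -/
theorem IsHeatFlow.integral_rpow_mul_le_of_lt_two (hpq : p.HolderConjugate q) (hp2 : p < 2)
    (hV : LipschitzWith L V) (hV0 : ∀ x, 0 ≤ V x) (hf : IsHeatFlow q μ f)
    (hf0 : ∀ s, 0 ≤ s → ∀ᵐ x ∂μ, 0 ≤ f s x) (h0 : Integrable (f 0) μ)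
    (hVf : Integrable (fun x => V x ^ p * f 0 x) μ) (x₀ : X) {t : ℝ} (ht : 0 ≤ t) :
    Integrable (fun x => V x ^ p * f t x) μ ∧
      ∫ x, V x ^ p * f t x ∂μ ≤ Real.exp ((p / (3 - p)) ^ q / q * (L : ℝ) ^ q * t) *
        ((∫ x, f 0 x ^ (3 - p) ∂μ) / (2 - p) + p * ∫ x, V x ^ p * f 0 x ∂μ) := by
  have hp1 := hpq.lt
  set β := p * (3 - p) ^ (1 - p) with hβ
  have hβ1 : 1 ≤ β := one_le_mul_rpow hp1 hp2
  have hβ0 : 0 < β := by linarith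
  have hk : ∀ n : ℕ, (0 : ℝ) < (n : ℝ) + 1 := fun n => by positivity
  have hE : ∫ x, |f 0 x| ^ (3 - p) ∂μ = ∫ x, f 0 x ^ (3 - p) ∂μ :=
    integral_congr_ae ((hf0 0 le_rfl).mono fun x hx => by simp only [abs_of_nonneg hx])
  have h := integrable_of_tendsto_of_integral_le (μ := μ)
    (F := fun (n : ℕ) x => trunc V x₀ ((n : ℝ) + 1) x ^ p * f t x)
    (f := fun x => V x ^ p * f t x)
    (fun n => (memLp_trunc_rpow hV hV0 (hk n) hpq.pos 2).integrable_mul (Lp.memLp (f t)))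
    (fun n => (hf0 t ht).mono fun x hx =>
      mul_nonneg (Real.rpow_nonneg (trunc_nonneg hV0 x) _) hx)
    (fun n => by
      have h1 := hf.integral_trunc_le_of_lt_two (x₀ := x₀) hpq hp2 hV hV0 (hk n) hf0 h0 hβ0 ht
      rw [← le_inv_mul_iff₀ hβ0] at h1
      exact h1)
    (((((((tendsto_momentRate (L := L) hpq.symm.pos β).div_const β).mul_const t).rexp).mul
      (((tendsto_integral_trunc (x₀ := x₀) hV hV0 hpq.pos (Lp.memLp (f 0)) hVf).const_mul
        β).const_add ((∫ x, |f 0 x| ^ (3 - p) ∂μ) / (2 - p))))).const_mul β⁻¹)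
    ((hV.continuous.measurable.pow_const p).aestronglyMeasurable.mul (Lp.memLp (f t)).1)
    (ae_of_all _ fun x => ((tendsto_trunc x).rpow_const (Or.inr hpq.pos.le)).mul_const _)
  refine ⟨h.1, h.2.trans ?_⟩
  rw [hβ, momentRate_div_eq hpq (by linarith) (NNReal.coe_nonneg L), ← hβ, hE, mul_left_comm]
  refine mul_le_mul_of_nonneg_left ?_ (Real.exp_pos _).le
  have hE0 : 0 ≤ (∫ x, f 0 x ^ (3 - p) ∂μ) / (2 - p) :=
    div_nonneg (integral_nonneg_of_ae ((hf0 0 le_rfl).mono fun x hx => Real.rpow_nonneg hx _))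
      (by linarith)
  have hM0 : 0 ≤ ∫ x, V x ^ p * f 0 x ∂μ :=
    integral_nonneg_of_ae ((hf0 0 le_rfl).mono fun x hx =>
      mul_nonneg (Real.rpow_nonneg (hV0 x) _) hx)
  rw [mul_add, inv_mul_cancel_left₀ hβ0.ne']
  have h4 : β⁻¹ * ((∫ x, f 0 x ^ (3 - p) ∂μ) / (2 - p)) ≤ (∫ x, f 0 x ^ (3 - p) ∂μ) / (2 - p) :=
    mul_le_of_le_one_left hE0 (inv_le_one_of_one_le₀ hβ1)
  have h5 : ∫ x, V x ^ p * f 0 x ∂μ ≤ p * ∫ x, V x ^ p * f 0 x ∂μ :=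
    le_mul_of_one_le_left hM0 hp1.le
  linarith

end MomentSmall

/-! ### Finiteness of the moment for `p > 2` -/

section PExp

variable {p q : ℝ}

theorem pexp_neg_anti (hp : 2 < p) {s r : ℝ} (hs : 0 ≤ s) (hsr : s ≤ r) :
    pexp p (-r) ≤ pexp p (-s) := by
  refine Real.rpow_le_rpow_of_nonpos (by nlinarith) (by nlinarith) ?_
  exact div_nonpos_of_nonneg_of_nonpos zero_le_one (by linarith)

theorem pexp_neg_le_one (hp : 2 < p) {s : ℝ} (hs : 0 ≤ s) : pexp p (-s) ≤ 1 := by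
  have := pexp_neg_anti hp le_rfl hs
  simpa [pexp] using this

theorem hasDerivAt_pexp_neg_rpow (hp : 2 < p) {s : ℝ} (hs : 0 ≤ s) :
    HasDerivAt (fun s => pexp p (-(s ^ p)))
      (-(p * s ^ (p - 1) * pexp p (-(s ^ p)) ^ (p - 1))) s := by
  have h0 : 0 < 1 + (2 - p) * -(s ^ p) := by
    have : 0 ≤ s ^ p := by positivity
    nlinarith
  have h1 : HasDerivAt (fun s : ℝ => 1 + (2 - p) * -(s ^ p)) ((2 - p) * -(p * s ^ (p - 1))) s :=
    (((Real.hasDerivAt_rpow_const (Or.inr (by linarith))).neg).const_mul _).const_add _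
  have h2 := h1.rpow_const (p := 1 / (2 - p)) (Or.inl h0.ne')
  refine h2.congr_deriv ?_
  have h3 : 2 - p ≠ 0 := by linarith
  rw [pexp, ← Real.rpow_mul h0.le, show 1 / (2 - p) * (p - 1) = 1 / (2 - p) - 1 by
    field_simp; ring]
  field_simp

/-- Young's inequality for `r ^ (3 - p)`, that is, the tangent of this concave power at
`pexp p (-s)`. -/
theorem rpow_le_of_pexp (hp2 : 2 < p) (hp3 : p < 3) {s r : ℝ} (hs : 0 ≤ s) (hr : 0 ≤ r) :
    r ^ (3 - p) ≤ (p - 2) * (pexp p (-s) * (1 + (p - 2) * s)) +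
      (3 - p) * ((1 + (p - 2) * s) * r) := by
  have hρ := pexp_neg_pos hp2 hs
  have e := pexp_neg_rpow hp2 hs
  set ρ := pexp p (-s)
  have h := Real.geom_mean_le_arith_mean2_weighted (w₁ := p - 2) (w₂ := 3 - p) (p₁ := ρ) (p₂ := r)
    (by linarith) (by linarith) hρ.le hr (by ring)
  have h1 := mul_le_mul_of_nonneg_left h (by positivity : 0 ≤ ρ ^ (2 - p))
  have e1 : ρ ^ (2 - p) * ρ ^ (p - 2) = 1 := by
    rw [← Real.rpow_add hρ]; simp
  rw [← mul_assoc, e1, one_mul, e] at h1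
  linarith

end PExp

section MomentLarge

variable {X : Type*} [MetricSpace X] {p q : ℝ} {V : X → ℝ} {L : ℝ≥0} {k : ℝ}

theorem lipSlope_min_le (hV : LipschitzWith L V) (k : ℝ) (x : X) :
    lipSlope (fun y => min (V y) k) x ≤ {x | V x ≤ k}.indicator (fun _ => (L : ℝ)) x := by
  by_cases hx : V x ≤ k
  · rw [indicator_of_mem (show x ∈ {x | V x ≤ k} from hx)]
    exact lipSlope_le (hV.min_const k) x
  · rw [indicator_of_notMem (show x ∉ {x | V x ≤ k} from hx)]
    rw [not_le] at hx
    refine (lipSlope_eq_zero_of_eventually_const ?_).le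
    filter_upwards [hV.continuous.continuousAt.eventually (lt_mem_nhds hx)] with y hy
    rw [min_eq_right hy.le, min_eq_right hx.le]

theorem exists_lipschitzWith_pexp (hp : 2 < p) (hV : LipschitzWith L V) (hV0 : ∀ x, 0 ≤ V x)
    (hk : 0 ≤ k) : ∃ K : ℝ≥0, LipschitzWith K fun x => pexp p (-(min (V x) k ^ p)) := by
  have h : LipschitzOnWith (p * k ^ (p - 1)).toNNReal (fun s : ℝ => pexp p (-(s ^ p)))
      (Icc 0 k) := by
    refine Convex.lipschitzOnWith_of_nnnorm_hasDerivWithin_le (convex_Icc 0 k)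
      (fun s hs => (hasDerivAt_pexp_neg_rpow hp hs.1).hasDerivWithinAt) fun s hs => ?_
    have hs0 := hs.1
    have hsp : 0 ≤ s ^ p := by positivity
    have h1 := pexp_neg_pos hp hsp
    rw [← NNReal.coe_le_coe, coe_nnnorm, norm_neg, Real.norm_of_nonneg (by positivity)]
    refine le_trans ?_ (Real.le_coe_toNNReal _)
    have h2 : pexp p (-(s ^ p)) ^ (p - 1) ≤ 1 :=
      Real.rpow_le_one h1.le (pexp_neg_le_one hp hsp) (by linarith)
    calc _ ≤ p * s ^ (p - 1) * 1 := by gcongr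
      _ ≤ _ := by
        rw [mul_one]
        exact mul_le_mul_of_nonneg_left (Real.rpow_le_rpow hs.1 hs.2 (by linarith)) (by linarith)
  have := h.comp ((hV.min_const k).lipschitzOnWith (s := univ)) fun x _ =>
    ⟨le_min (hV0 x) hk, min_le_right _ _⟩
  exact ⟨_, lipschitzOnWith_univ.1 this⟩

variable [MeasurableSpace X] [BorelSpace X] {μ : Measure X}

theorem measure_le_ne_top {X : Type*} [MeasurableSpace X] {μ : Measure X} {V : X → ℝ} (hp : 2 < p)
    (hV0 : ∀ x, 0 ≤ V x) (hk : 0 ≤ k)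
    (hρ : Integrable (fun x => pexp p (-(V x ^ p))) μ) : μ {x | V x ≤ k} ≠ ∞ := by
  have hkp : 0 ≤ k ^ p := by positivity
  refine ne_top_of_le_ne_top (hρ.measure_ge_lt_top (pexp_neg_pos hp hkp)).ne
    (measure_mono fun x hx => ?_)
  exact pexp_neg_anti hp (Real.rpow_nonneg (hV0 x) _)
    (Real.rpow_le_rpow (hV0 x) hx (by linarith))

/-- The density `pexp p (-V ^ p)` with `V` cut off at height `k` is an admissible shift. The powers
of the density in the bound for its slope cancel, which is the reason for using `pexp p`. -/
theorem isTestData_pexp (hp : 2 < p) (hp3 : p < 3)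
    (hV : LipschitzWith L V) (hV0 : ∀ x, 0 ≤ V x) (hk : 0 < k)
    (hρ : Integrable (fun x => pexp p (-(V x ^ p))) μ) :
    IsTestData q μ (p - 1) (pexp p (-(k ^ p))) 1 (fun x => pexp p (-(min (V x) k ^ p)))
      (fun _ => 0) ({x | V x ≤ k}.indicator fun x => p * L * V x ^ (p - 1)) where
  b_pos := by linarith
  b_ne_one := by linarith
  b_ne_two := by linarith
  w₀_pos := pexp_neg_pos hp (by positivity)
  c_nonneg := zero_le_one
  lipschitz_w := exists_lipschitzWith_pexp hp hV hV0 hk.le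
  le_w := fun x => pexp_neg_anti hp (Real.rpow_nonneg (le_min (hV0 x) hk.le) _)
    (Real.rpow_le_rpow (le_min (hV0 x) hk.le) (min_le_right _ _) (by linarith))
  lipschitz_u := ⟨0, LipschitzWith.const 0⟩
  memLp_u := MemLp.zero (ε := ℝ)
  memLp_B := by
    have hm : MeasurableSet {x | V x ≤ k} := measurableSet_le hV.continuous.measurable
      measurable_const
    refine memLp_of_abs_le_indicator ((((hV.continuous.measurable.pow_const _).const_mul
      _)).indicator hm) hm (measure_le_ne_top hp hV0 hk.le hρ) (C := p * L * k ^ (p - 1))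
      (fun x => ?_) _
    by_cases hx : x ∈ {x | V x ≤ k}
    · have := hV0 x
      have : 0 ≤ p := by linarith
      rw [indicator_of_mem hx, indicator_of_mem hx, abs_of_nonneg (by positivity)]
      exact mul_le_mul_of_nonneg_left (Real.rpow_le_rpow (hV0 x) hx (by linarith)) (by positivity)
    · rw [indicator_of_notMem hx, indicator_of_notMem hx, abs_zero]
  le_B := fun x => by
    have hm0 : 0 ≤ min (V x) k := le_min (hV0 x) hk.le
    have hmp : 0 ≤ min (V x) k ^ p := by positivity
    have hw := pexp_neg_pos hp hmp
    have h1 := lipSlope_comp_le (hV.min_const k) (x := x) (hasDerivAt_pexp_neg_rpow hp hm0)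
    rw [abs_neg, abs_of_nonneg (by positivity)] at h1
    rw [lipSlope_const, add_zero, one_mul]
    set w := pexp p (-(min (V x) k ^ p))
    have e : w ^ (-(p - 1)) * w ^ (p - 1) = 1 := by rw [← Real.rpow_add hw]; simp
    calc w ^ (-(p - 1)) * lipSlope (fun x => pexp p (-(min (V x) k ^ p))) x
        ≤ w ^ (-(p - 1)) * (p * min (V x) k ^ (p - 1) * w ^ (p - 1) *
          lipSlope (fun y => min (V y) k) x) := by gcongr
      _ = p * min (V x) k ^ (p - 1) * lipSlope (fun y => min (V y) k) x := by
          linear_combination (p * min (V x) k ^ (p - 1) * lipSlope (fun y => min (V y) k) x) * e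
      _ ≤ p * min (V x) k ^ (p - 1) * {x | V x ≤ k}.indicator (fun _ => (L : ℝ)) x := by
          gcongr
          exact lipSlope_min_le hV k x
      _ = _ := by
          by_cases hx : x ∈ {x | V x ≤ k}
          · have hx' : V x ≤ k := hx
            rw [indicator_of_mem hx, indicator_of_mem hx, min_eq_left hx']
            ring
          · rw [indicator_of_notMem hx, indicator_of_notMem hx, mul_zero]

/-- Coercivity of the entropy relative to the shift `w`: the tangent at `r = w`. -/
theorem mul_sub_le_entropy (hp : 2 < p) (hp3 : p < 3) {w : ℝ} (hw : 0 < w) (r : ℝ) :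
    (1 - 2 ^ (2 - p)) / (p - 2) * w ^ (2 - p) * (r - w) ≤ entropy (p - 1) w r := by
  have h := entropy_tangent_le (b := p - 1) (by linarith) (by linarith) hw w r
  have h0 := entropy_nonneg (b := p - 1) (by linarith) (by linarith) hw w
  have e : entropyDeriv (p - 1) w w = (1 - 2 ^ (2 - p)) / (p - 2) * w ^ (2 - p) := by
    rw [entropyDeriv, Real.sign_of_pos hw, abs_of_pos hw, ← two_mul,
      Real.mul_rpow zero_le_two hw.le, show 1 - (p - 1) = 2 - p by ring]
    have : p - 2 ≠ 0 := by linarith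
    have : 2 - p ≠ 0 := by linarith
    field_simp
    ring
  rw [e] at h
  linarith

theorem entropy_le_of_one_lt {b w : ℝ} (hb1 : 1 < b) (hb2 : b < 2) (hw : 0 < w) (r : ℝ) :
    entropy b w r ≤ w ^ (1 - b) * |r| / (b - 1) := by
  have h1 : w ^ (2 - b) ≤ (|r| + w) ^ (2 - b) :=
    Real.rpow_le_rpow hw.le (by linarith [abs_nonneg r]) (by linarith)
  have h2 : ((|r| + w) ^ (2 - b) - w ^ (2 - b)) / ((1 - b) * (2 - b)) ≤ 0 :=
    div_nonpos_of_nonneg_of_nonpos (by linarith) (by nlinarith)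
  have e : w ^ (1 - b) * |r| / (b - 1) = -(w ^ (1 - b) * |r| / (1 - b)) := by
    rw [← div_neg, neg_sub]
  rw [entropy, e]
  linarith

/-- Finiteness of the moment for `p > 2`: the entropy relative to the finite measure with density
`pexp p (-V ^ p)` controls the moment. -/
theorem IsHeatFlow.exists_integral_rpow_mul_le (hpq : p.HolderConjugate q) (hp : 2 < p)
    (hp3 : p < 3) (hV : LipschitzWith L V) (hV0 : ∀ x, 0 ≤ V x)
    (hρ : Integrable (fun x => pexp p (-(V x ^ p))) μ)
    (hVρ : Integrable (fun x => V x ^ p * pexp p (-(V x ^ p))) μ) {f : ℝ → Lp ℝ 2 μ}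
    (hf : IsHeatFlow q μ f) (hf0 : ∀ s, 0 ≤ s → ∀ᵐ x ∂μ, 0 ≤ f s x)
    (hi : ∀ s, 0 ≤ s → Integrable (f s) μ) (hVf : Integrable (fun x => V x ^ p * f 0 x) μ) :
    ∃ A κ : ℝ, 0 ≤ κ ∧ ∀ t, 0 ≤ t → Integrable (fun x => V x ^ p * f t x) μ ∧
      ∫ x, V x ^ p * f t x ∂μ ≤ Real.exp (κ * t) * A := by
  have hp0 := hpq.pos
  have hq0 := hpq.symm.pos
  have hpq1 : (p - 1) * (q - 1) = 1 := by have := hpq.mul_eq_add; linarith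
  have hpq2 : (p - 1) * q = p := by have := hpq.mul_eq_add; linarith
  have hVm : Measurable V := hV.continuous.measurable
  have hVp : ∀ x, 0 ≤ V x ^ p := fun x => Real.rpow_nonneg (hV0 x) _
  set ρ : X → ℝ := fun x => pexp p (-(V x ^ p)) with hρdef
  have hρ0 : ∀ x, 0 < ρ x := fun x => pexp_neg_pos hp (hVp x)
  set h : ℝ := (1 - 2 ^ (2 - p)) / (p - 2) with hh
  have hh0 : 0 < h := by
    refine div_pos ?_ (by linarith)
    have := Real.rpow_lt_one_of_one_lt_of_neg (x := 2) (z := 2 - p) (by norm_num) (by linarith)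
    linarith
  set C : ℝ := 1 / q * p ^ (1 - q) * (p * L) ^ q with hC
  have hC0 : 0 ≤ C := by positivity
  set J : ℝ := ∫ x, V x ^ p * ρ x ∂μ with hJ
  set J' : ℝ := ∫ x, (1 + (p - 2) * V x ^ p) * ρ x ∂μ with hJ'
  have iJ' : Integrable (fun x => (1 + (p - 2) * V x ^ p) * ρ x) μ := by
    refine (hρ.add (hVρ.const_mul (p - 2))).congr (ae_of_all _ fun x => ?_)
    simp only [Pi.add_apply]; ring
  have iE : Integrable (fun x => (1 + (p - 2) * V x ^ p) * f 0 x) μ := by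
    refine ((hi 0 le_rfl).add (hVf.const_mul (p - 2))).congr (ae_of_all _ fun x => ?_)
    simp only [Pi.add_apply]; ring
  set E : ℝ := (∫ x, (1 + (p - 2) * V x ^ p) * f 0 x ∂μ) / (p - 2) with hE
  set κ : ℝ := C / (h * (p - 2)) with hκ
  have hhp : 0 < h * (p - 2) := mul_pos hh0 (by linarith)
  have hκ0 : 0 ≤ κ := by positivity
  set d : ℝ := h * J' + J * (h * (p - 2)) with hd
  have hJ0 : 0 ≤ J := integral_nonneg fun x => mul_nonneg (hVp x) (hρ0 x).le
  have key : ∀ k : ℝ, 0 < k → ∀ t, 0 ≤ t → Integrable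
      ({x | V x ≤ k}.indicator fun x => V x ^ p * f t x) μ ∧
      ∫ x, {x | V x ≤ k}.indicator (fun x => V x ^ p * f t x) x ∂μ ≤
        Real.exp (κ * t) * ((E + d) / (h * (p - 2))) := by
    intro k hk
    set S : Set X := {x | V x ≤ k} with hS
    have hSm : MeasurableSet S := measurableSet_le hVm measurable_const
    set w : X → ℝ := fun x => pexp p (-(min (V x) k ^ p)) with hw
    have hwS : ∀ x ∈ S, w x = ρ x := fun x hx => by
      have hx' : V x ≤ k := hx
      simp only [hw, hρdef, min_eq_left hx']
    have T := isTestData_pexp (μ := μ) (q := q) hp hp3 hV hV0 hk hρ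
    have im : ∀ s, 0 ≤ s → Integrable (S.indicator fun x => V x ^ p * f s x) μ := by
      intro s hs
      refine ((hi s hs).const_mul (k ^ p)).mono (((hVm.pow_const p).aestronglyMeasurable.mul
        (hi s hs).1).indicator hSm) (ae_of_all _ fun x => ?_)
      by_cases hx : x ∈ S
      · rw [indicator_of_mem hx, norm_mul, norm_mul, Real.norm_of_nonneg (hVp x),
          Real.norm_of_nonneg (by positivity : 0 ≤ k ^ p)]
        exact mul_le_mul_of_nonneg_right (Real.rpow_le_rpow (hV0 x) hx hp0.le) (norm_nonneg _)
      · rw [indicator_of_notMem hx, norm_zero]; exact norm_nonneg _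
    set m : ℝ → ℝ := fun s => ∫ x, S.indicator (fun x => V x ^ p * f s x) x ∂μ with hm
    set Z : ℝ → ℝ := fun s => testFunctional μ (p - 1) 1 w (fun _ => 0) (f s) with hZ
    have eZ : ∀ s, Z s = ∫ x, entropy (p - 1) (w x) (f s x) ∂μ := fun s => by
      simp only [hZ, T.testFunctional_eq (Lp.memLp _), one_mul, zero_mul, integral_zero, add_zero,
        hw]
    have ien : ∀ s, Integrable (fun x => entropy (p - 1) (w x) (f s x)) μ := fun s =>
      integrable_entropy T.b_pos T.b_ne_one T.b_ne_two T.w₀_pos T.le_w T.measurable_w (Lp.memLp _)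
    -- the entropy controls the moment on `S`, since `w ^ (2 - p) = 1 + (p - 2) * V ^ p` there
    have hcoer : ∀ s, 0 ≤ s → h * (p - 2) * m s - h * J' ≤ Z s := by
      intro s hs
      rw [eZ, hm, hJ', ← integral_const_mul, ← integral_const_mul,
        ← integral_sub ((im s hs).const_mul _) (iJ'.const_mul h)]
      refine integral_mono_ae (((im s hs).const_mul _).sub (iJ'.const_mul h)) (ien s) ?_
      filter_upwards [hf0 s hs] with x hx
      have h1 : 0 ≤ h * ((1 + (p - 2) * V x ^ p) * ρ x) := by
        have := hVp x
        have := hρ0 x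
        have : 0 < p - 2 := by linarith
        positivity
      by_cases hxS : x ∈ S
      · rw [indicator_of_mem hxS]
        have h2 := mul_sub_le_entropy hp hp3 (T.w_pos x) (f s x)
        change _ ≤ entropy (p - 1) (w x) (f s x) at h2
        change h * w x ^ (2 - p) * (f s x - w x) ≤ _ at h2
        rw [hwS x hxS] at h2 ⊢
        rw [show ρ x ^ (2 - p) = 1 + (p - 2) * V x ^ p from pexp_neg_rpow hp (hVp x)] at h2
        refine le_trans ?_ h2
        have := mul_nonneg hh0.le hx
        linarith
      · rw [indicator_of_notMem hxS]
        have := entropy_nonneg T.b_ne_one T.b_ne_two (T.w_pos x) (f s x)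
        change 0 ≤ entropy (p - 1) (w x) (f s x) at this
        linarith
    have hZ0 : Z 0 ≤ E := by
      rw [eZ, hE, ← integral_div]
      refine integral_mono_ae (ien 0) (iE.div_const _) ?_
      filter_upwards [hf0 0 le_rfl] with x hx
      refine (entropy_le_of_one_lt (by linarith) (by linarith) (T.w_pos x) _).trans ?_
      rw [show 1 - (p - 1) = 2 - p by ring, show p - 1 - 1 = p - 2 by ring, abs_of_nonneg hx,
        pexp_neg_rpow hp (Real.rpow_nonneg (le_min (hV0 x) hk.le) _)]
      refine div_le_div_of_nonneg_right (mul_le_mul_of_nonneg_right ?_ hx) (by linarith)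
      have := Real.rpow_le_rpow (le_min (hV0 x) hk.le) (min_le_left (V x) k) hp0.le
      have := mul_le_mul_of_nonneg_left this (by linarith : 0 ≤ p - 2)
      linarith
    have hg : ∀ t, 0 ≤ t → Z t + d ≤ Real.exp (κ * t) * (Z 0 + d) := fun t ht =>
      (T.isLocallyAC hf).add_le_exp_mul ht (by
        filter_upwards [T.ae_hasDerivAt_le hpq one_pos hf, ae_restrict_mem measurableSet_Ioi]
          with s hs hs0 _
        obtain ⟨D, hD, hle⟩ := hs
        have hs0' := (mem_Ioi.1 hs0).le
        have iy : Integrable (fun x => C * (S.indicator (fun x => V x ^ p * f s x) x +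
            V x ^ p * ρ x)) μ := ((im s hs0').add hVρ).const_mul C
        refine ⟨D, hD, (hle _ iy ?_).trans ?_⟩
        · filter_upwards [hf0 s hs0'] with x hx
          have hVx := hV0 x
          have h2 : 0 ≤ V x ^ p * ρ x := mul_nonneg (hVp x) (hρ0 x).le
          by_cases hxS : x ∈ S
          · have hxS' : V x ≤ k := hxS
            rw [indicator_of_mem hxS, indicator_of_mem hxS, hpq1, Real.rpow_one, Real.one_rpow,
              abs_of_nonneg hx, min_eq_left hxS', Real.mul_rpow (by positivity) (by positivity),
              ← Real.rpow_mul hVx, hpq2]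
            refine le_of_eq ?_
            simp only [hC, hρdef]
            ring
          · rw [indicator_of_notMem hxS, indicator_of_notMem hxS, Real.zero_rpow hq0.ne', zero_mul,
              mul_zero, zero_add]
            positivity
        · rw [integral_const_mul, integral_add (im s hs0') hVρ]
          have h3 := hcoer s hs0'
          calc C * (m s + J) = κ * (h * (p - 2) * m s + J * (h * (p - 2))) := by
                rw [hκ]
                have : p - 2 ≠ 0 := by linarith
                field_simp
            _ ≤ κ * (Z s + d) := mul_le_mul_of_nonneg_left (by rw [hd]; linarith) hκ0)
    intro t ht
    refine ⟨im t ht, ?_⟩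
    have h4 := hcoer t ht
    have h5 := hg t ht
    have h6 : Real.exp (κ * t) * (Z 0 + d) ≤ Real.exp (κ * t) * (E + d) :=
      mul_le_mul_of_nonneg_left (by linarith) (Real.exp_pos _).le
    change m t ≤ _
    rw [← mul_div_assoc, le_div_iff₀ hhp]
    have h7 : 0 ≤ J * (h * (p - 2)) := by positivity
    rw [hd] at h5 h6 ⊢
    linarith
  refine ⟨(E + d) / (h * (p - 2)), κ, hκ0, fun t ht => ?_⟩
  have hk : ∀ n : ℕ, (0 : ℝ) < (n : ℝ) + 1 := fun n => by positivity
  refine integrable_of_tendsto_of_integral_le (fun n : ℕ => (key _ (hk n) t ht).1) (fun n => ?_)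
    (fun n => (key _ (hk n) t ht).2) tendsto_const_nhds
    ((hVm.pow_const p).aestronglyMeasurable.mul (Lp.memLp (f t)).1) (ae_of_all _ fun x => ?_)
  · filter_upwards [hf0 t ht] with x hx
    by_cases hxS : x ∈ {x | V x ≤ (n : ℝ) + 1}
    · rw [indicator_of_mem hxS]; exact mul_nonneg (hVp x) hx
    · rw [indicator_of_notMem hxS]
  · refine tendsto_const_nhds.congr' ?_
    filter_upwards [eventually_ge_atTop ⌈V x⌉₊] with n hn
    have h1 : V x ≤ n := Nat.ceil_le.1 hn
    rw [indicator_of_mem (show x ∈ {x | V x ≤ (n : ℝ) + 1} from by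
      change V x ≤ (n : ℝ) + 1
      linarith)]

end MomentLarge

/-! ### The limit of the entropies for `p > 2` -/

section EntropyLimit

variable {X : Type*} [MeasurableSpace X] {μ : Measure X} {p : ℝ}

theorem add_rpow_sub_rpow_mem {a w r : ℝ} (ha : 0 ≤ a) (ha1 : a ≤ 1) (hw : 0 ≤ w) (hr : 0 ≤ r) :
    (r + w) ^ a - w ^ a ∈ Icc 0 (r ^ a) :=
  ⟨sub_nonneg.2 (Real.rpow_le_rpow hw (by linarith) ha), by
    have := Real.rpow_add_le_add_rpow hr hw ha ha1
    linarith⟩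

theorem integrable_add_rpow_sub {a w : ℝ} (ha : 0 ≤ a) (ha1 : a ≤ 1) (hw : 0 ≤ w) {g : X → ℝ}
    (hgm : AEMeasurable g μ) (hg : Integrable (fun x => |g x| ^ a) μ) :
    Integrable (fun x => (|g x| + w) ^ a - w ^ a) μ := by
  refine hg.mono' (((hgm.abs.add_const w).pow_const a).sub_const _).aestronglyMeasurable
    (ae_of_all _ fun x => ?_)
  have h := add_rpow_sub_rpow_mem ha ha1 hw (abs_nonneg (g x))
  rw [Real.norm_of_nonneg h.1]
  exact h.2

theorem tendsto_integral_add_rpow_sub {a : ℝ} (ha : 0 < a) (ha1 : a ≤ 1) {g : X → ℝ}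
    (hgm : AEMeasurable g μ) (hg : Integrable (fun x => |g x| ^ a) μ) :
    Tendsto (fun n : ℕ => ∫ x, ((|g x| + 1 / ((n : ℝ) + 1)) ^ a - (1 / ((n : ℝ) + 1)) ^ a) ∂μ)
      atTop (𝓝 (∫ x, |g x| ^ a ∂μ)) := by
  have hw : ∀ n : ℕ, (0 : ℝ) ≤ 1 / ((n : ℝ) + 1) := fun n => Nat.one_div_pos_of_nat.le
  refine tendsto_integral_of_dominated_convergence _
    (fun n => (integrable_add_rpow_sub ha.le ha1 (hw n) hgm hg).1) hg
    (fun n => ae_of_all _ fun x => ?_) (ae_of_all _ fun x => ?_)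
  · have h := add_rpow_sub_rpow_mem ha.le ha1 (hw n) (abs_nonneg (g x))
    rw [Real.norm_of_nonneg h.1]
    exact h.2
  · have h0 := tendsto_one_div_add_atTop_nhds_zero_nat (𝕜 := ℝ)
    have h1 := (h0.const_add |g x|).rpow_const (p := a) (Or.inr ha.le)
    have h2 := h1.sub (h0.rpow_const (p := a) (Or.inr ha.le))
    rwa [add_zero, Real.zero_rpow ha.ne', sub_zero] at h2

/-- For `p > 2` the entropy splits into a linear term, which diverges as `w → 0`, and a negative
multiple of a regularization of `∫ g ^ (3 - p)`. -/
theorem integral_entropy_eq (hp : 2 < p) (hp3 : p < 3) {w : ℝ} (hw : 0 < w) {g : X → ℝ}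
    (hg0 : ∀ᵐ x ∂μ, 0 ≤ g x) (hg : Integrable g μ) (hgE : Integrable (fun x => |g x| ^ (3 - p)) μ) :
    (3 - p) * ∫ x, entropy (p - 1) w (g x) ∂μ =
      (3 - p) * w ^ (2 - p) / (p - 2) * ∫ x, g x ∂μ -
        (∫ x, ((|g x| + w) ^ (3 - p) - w ^ (3 - p)) ∂μ) / (p - 2) := by
  have i1 := integrable_add_rpow_sub (by linarith) (by linarith) hw.le hg.1.aemeasurable hgE
  rw [← integral_const_mul, ← integral_const_mul, ← integral_div,
    ← integral_sub (hg.const_mul _) (i1.div_const _)]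
  refine integral_congr_ae (hg0.mono fun x hx => ?_)
  have h1 : 2 - p ≠ 0 := by linarith
  have h2 : p - 2 ≠ 0 := by linarith
  have h3 : 3 - p ≠ 0 := by linarith
  simp only [entropy, abs_of_nonneg hx]
  rw [show 2 - (p - 1) = 3 - p by ring, show 1 - (p - 1) = 2 - p by ring]
  rw [show 2 - p = -(p - 2) by ring] at h1 ⊢
  field_simp
  ring

end EntropyLimit

section MomentLarge

variable {X : Type*} [MetricSpace X] [MeasurableSpace X] [BorelSpace X] {μ : Measure X} {p q : ℝ}
  {V : X → ℝ} {L : ℝ≥0} {f : ℝ → Lp ℝ 2 μ}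

/-- The decrease of the regularized entropies converges to the growth of `∫ f ^ (3 - p)`, because
their terms linear in `f` cancel by mass preservation. -/
theorem IsHeatFlow.lintegral_fisher_le_of_two_lt (hpq : p.HolderConjugate q) (hp : 2 < p)
    (hp3 : p < 3) (hf : IsHeatFlow q μ f) (hf0 : ∀ s, 0 ≤ s → ∀ᵐ x ∂μ, 0 ≤ f s x)
    (hi : ∀ s, 0 ≤ s → Integrable (f s) μ) (hm : ∀ s, 0 ≤ s → ∫ x, f s x ∂μ = ∫ x, f 0 x ∂μ)
    (hE : ∀ s, 0 ≤ s → Integrable (fun x => |f s x| ^ (3 - p)) μ) {t : ℝ} (ht : 0 ≤ t) :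
    ∫⁻ s in Ioc 0 t, fisher p q μ (f s) ≤ ENNReal.ofReal (1 / (3 - p) *
      ((∫ x, |f t x| ^ (3 - p) ∂μ - ∫ x, |f 0 x| ^ (3 - p) ∂μ) / (p - 2))) := by
  have hw : ∀ n : ℕ, (0 : ℝ) < 1 / ((n : ℝ) + 1) := fun n => Nat.one_div_pos_of_nat
  have h3 : 0 < 3 - p := by linarith
  have hlim := fun s (hs : 0 ≤ s) => tendsto_integral_add_rpow_sub (a := 3 - p) (by linarith)
    (by linarith) (hi s hs).1.aemeasurable (hE s hs)
  refine hf.lintegral_fisher_le hpq hp3 hp.ne' (fun n => ?_)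
    ((((hlim t ht).sub (hlim 0 le_rfl)).div_const (p - 2)).const_mul (1 / (3 - p)))
  have h0 := integral_entropy_eq hp hp3 (hw n) (hf0 0 le_rfl) (hi 0 le_rfl) (hE 0 le_rfl)
  have h1 := integral_entropy_eq hp hp3 (hw n) (hf0 t ht) (hi t ht) (hE t ht)
  rw [hm t ht] at h1
  rw [one_div_mul_eq_div, le_div_iff₀ h3, mul_comm, mul_sub, h0, h1, sub_div]
  linarith

/-- The time is replaced by `max s 0`, as nothing is known about the flow at negative times. -/
theorem measurable_integral_mul {X : Type*} [MetricSpace X] [MeasurableSpace X] {μ : Measure X}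
    {g : X → ℝ} {f : ℝ → Lp ℝ 2 μ} (hg : MemLp g 2 μ) (hf : IsHeatFlow q μ f) :
    Measurable fun s => ∫ x, g x * f (max s 0) x ∂μ := by
  have e : ∀ h : Lp ℝ 2 μ, ∫ x, g x * h x ∂μ = inner ℝ (hg.toLp g) h := fun h => by
    rw [L2.inner_def]
    refine integral_congr_ae ?_
    filter_upwards [hg.coeFn_toLp] with x hx
    rw [hx]
    simp [mul_comm]
  simp only [e]
  exact (continuous_const.inner (hf.continuousOn.comp_continuous (by fun_prop)
    fun s => mem_Ici.2 (le_max_right _ _))).measurable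

variable [ProperSpace X] [IsLocallyFiniteMeasure μ]

theorem measurable_moment (hV : LipschitzWith L V) (hV0 : ∀ x, 0 ≤ V x) (hp : 0 < p) (x₀ : X)
    (hf : IsHeatFlow q μ f) (hVf : ∀ s, 0 ≤ s → Integrable (fun x => V x ^ p * f s x) μ) :
    Measurable fun s => ∫ x, V x ^ p * f (max s 0) x ∂μ :=
  measurable_of_tendsto_metrizable
    (fun n : ℕ => measurable_integral_mul (memLp_trunc_rpow (x₀ := x₀) (k := (n : ℝ) + 1) hV hV0
      (by positivity) hp 2) hf)
    (tendsto_pi_nhds.2 fun _ => tendsto_integral_trunc hV hV0 hp (Lp.memLp _)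
      (hVf _ (le_max_right _ _)))

/-- The integrated evolution inequality for `p V ^ p f - f ^ (3 - p) / (p - 2)`. -/
theorem IsHeatFlow.moment_sub_le (hpq : p.HolderConjugate q) (hp : 2 < p)
    (hp3 : p < 3) (hV : LipschitzWith L V) (hV0 : ∀ x, 0 ≤ V x) (x₀ : X) (hf : IsHeatFlow q μ f)
    (hf0 : ∀ s, 0 ≤ s → ∀ᵐ x ∂μ, 0 ≤ f s x)
    (hi : ∀ s, 0 ≤ s → Integrable (f s) μ) (hm : ∀ s, 0 ≤ s → ∫ x, f s x ∂μ = ∫ x, f 0 x ∂μ)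
    (hE : ∀ s, 0 ≤ s → Integrable (fun x => |f s x| ^ (3 - p)) μ)
    (hVf : ∀ s, 0 ≤ s → Integrable (fun x => V x ^ p * f s x) μ) {t : ℝ} (ht : 0 ≤ t)
    (hy : IntervalIntegrable (fun s => ∫ x, V x ^ p * f (max s 0) x ∂μ) volume 0 t) :
    p * (∫ x, V x ^ p * f t x ∂μ) - (∫ x, |f t x| ^ (3 - p) ∂μ) / (p - 2) ≤
      p * (∫ x, V x ^ p * f 0 x ∂μ) - (∫ x, |f 0 x| ^ (3 - p) ∂μ) / (p - 2) +
        momentRate p q p L * ∫ s in (0 : ℝ)..t, ∫ x, V x ^ p * f (max s 0) x ∂μ := by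
  have hp0 := hpq.pos
  set y : ℝ → ℝ := fun s => ∫ x, V x ^ p * f (max s 0) x ∂μ with hydef
  have hw : ∀ n : ℕ, (0 : ℝ) < 1 / ((n : ℝ) + 1) := fun n => Nat.one_div_pos_of_nat
  have hlim := fun s (hs : 0 ≤ s) => tendsto_integral_add_rpow_sub (a := 3 - p) (by linarith)
    (by linarith) (hi s hs).1.aemeasurable (hE s hs)
  have key : ∀ k : ℝ, 0 < k →
      p * (∫ x, trunc V x₀ k x ^ p * f t x ∂μ) - (∫ x, |f t x| ^ (3 - p) ∂μ) / (p - 2) ≤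
      p * (∫ x, trunc V x₀ k x ^ p * f 0 x ∂μ) - (∫ x, |f 0 x| ^ (3 - p) ∂μ) / (p - 2) +
        momentRate p q p (max L (k⁻¹).toNNReal : ℝ≥0) * ∫ s in (0 : ℝ)..t, y s := by
    intro k hk
    set K : ℝ := momentRate p q p (max L (k⁻¹).toNNReal : ℝ≥0) with hK
    have hK0 : 0 ≤ K := momentRate_nonneg hp0.le hp3.le hpq.symm.pos hp0.le (NNReal.coe_nonneg _)
    set M : ℝ → ℝ := fun s => ∫ x, trunc V x₀ k x ^ p * f s x ∂μ with hM
    set I : ℝ := ∫ x, trunc V x₀ k x ^ p ∂μ with hI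
    -- first `w → 0` with `k` fixed, then `k → ∞`
    have step : ∀ w : ℝ, 0 < w →
        p * M t - (∫ x, ((|f t x| + w) ^ (3 - p) - w ^ (3 - p)) ∂μ) / (p - 2) ≤
        p * M 0 - (∫ x, ((|f 0 x| + w) ^ (3 - p) - w ^ (3 - p)) ∂μ) / (p - 2) +
          (K * (∫ s in (0 : ℝ)..t, y s) + w * (t * K * I)) := by
      intro w hw
      have T := isTestData_trunc (μ := μ) (x₀ := x₀) hpq hp3 hp.ne' hV hV0 hk hw hp0.le
      have e : ∀ s, testFunctional μ (p - 1) (3 - p) (fun _ => w)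
          (fun x => p * trunc V x₀ k x ^ p) (f s) =
          (3 - p) * (∫ x, entropy (p - 1) w (f s x) ∂μ) + p * M s := fun s => by
        rw [T.testFunctional_eq (Lp.memLp _)]
        simp only [hM, mul_assoc, integral_const_mul]
      have hr : IntervalIntegrable (fun s => K * (y s + w * I)) volume 0 t :=
        (hy.add intervalIntegrable_const).const_mul K
      have h := (T.isLocallyAC hf).sub_le_integral ht hr (by
        filter_upwards [ae_hasDerivAt_trunc_le (x₀ := x₀) hpq hp3 hp.ne' hV hV0 hk hw
          hp0.le hf hf0, ae_restrict_mem measurableSet_Ioi] with s hs hs0 _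
        obtain ⟨D, hD, hle⟩ := hs
        have hs0' := (mem_Ioi.1 hs0).le
        refine ⟨D, hD, hle.trans (mul_le_mul_of_nonneg_left (add_le_add_left ?_ _) hK0)⟩
        simp only [hydef, max_eq_left hs0']
        refine integral_mono_ae ((memLp_trunc_rpow hV hV0 hk hp0 2).integrable_mul (Lp.memLp (f s)))
          (hVf s hs0') ?_
        filter_upwards [hf0 s hs0'] with x hx
        exact mul_le_mul_of_nonneg_right
          (Real.rpow_le_rpow (trunc_nonneg hV0 x) (trunc_le x) hp0.le) hx)
      rw [intervalIntegral.integral_const_mul, intervalIntegral.integral_add hy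
        intervalIntegrable_const, intervalIntegral.integral_const, e, e,
        integral_entropy_eq hp hp3 hw (hf0 0 le_rfl) (hi 0 le_rfl) (hE 0 le_rfl),
        integral_entropy_eq hp hp3 hw (hf0 t ht) (hi t ht) (hE t ht), hm t ht, sub_zero,
        smul_eq_mul] at h
      linarith
    have l1 := ((hlim t ht).div_const (p - 2)).const_sub (p * M t)
    have l2 := (((hlim 0 le_rfl).div_const (p - 2)).const_sub (p * M 0)).add
      (((tendsto_one_div_add_atTop_nhds_zero_nat (𝕜 := ℝ)).mul_const (t * K * I)).const_add
        (K * (∫ s in (0 : ℝ)..t, y s)))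
    rw [zero_mul, add_zero] at l2
    exact le_of_tendsto_of_tendsto' l1 l2 fun n => step _ (hw n)
  have l := fun s (hs : 0 ≤ s) => ((tendsto_integral_trunc (x₀ := x₀) hV hV0 hp0 (Lp.memLp (f s))
    (hVf s hs)).const_mul p).sub_const ((∫ x, |f s x| ^ (3 - p) ∂μ) / (p - 2))
  exact le_of_tendsto_of_tendsto' (l t ht) ((l 0 le_rfl).add ((tendsto_momentRate (L := L)
    hpq.symm.pos p).mul_const (∫ s in (0 : ℝ)..t, y s))) fun n => key _ (by positivity)

end MomentLarge

/-! ### The moment for `p > 2` -/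

section MomentLarge

variable {X : Type*} [MetricSpace X] [MeasurableSpace X] [BorelSpace X] {μ : Measure X} {p q : ℝ}
  {V : X → ℝ} {L : ℝ≥0} {f : ℝ → Lp ℝ 2 μ}

/-- The moment controls `∫ g ^ (3 - p)`, by integrating `rpow_le_of_pexp`. -/
theorem integral_rpow_le_of_two_lt {X : Type*} [MeasurableSpace X] {μ : Measure X} {V g : X → ℝ}
    (hp : 2 < p) (hp3 : p < 3) (hV0 : ∀ x, 0 ≤ V x)
    (hρ : Integrable (fun x => pexp p (-(V x ^ p))) μ)
    (hVρ : Integrable (fun x => V x ^ p * pexp p (-(V x ^ p))) μ)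
    (hg0 : ∀ᵐ x ∂μ, 0 ≤ g x) (hg : Integrable g μ) (hVg : Integrable (fun x => V x ^ p * g x) μ) :
    Integrable (fun x => |g x| ^ (3 - p)) μ ∧
      (∫ x, |g x| ^ (3 - p) ∂μ) / (p - 2) ≤ ∫ x, pexp p (-(V x ^ p)) ∂μ +
        (p - 2) * (∫ x, V x ^ p * pexp p (-(V x ^ p)) ∂μ) +
        ((∫ x, g x ∂μ) / (p - 2) - ∫ x, g x ∂μ + (3 - p) * ∫ x, V x ^ p * g x ∂μ) := by
  have hp' : 0 < p - 2 := by linarith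
  have hle : ∀ᵐ x ∂μ, |g x| ^ (3 - p) ≤ (p - 2) * (pexp p (-(V x ^ p)) +
      (p - 2) * (V x ^ p * pexp p (-(V x ^ p)))) + (3 - p) * (g x + (p - 2) * (V x ^ p * g x)) := by
    filter_upwards [hg0] with x hx
    rw [abs_of_nonneg hx]
    refine (rpow_le_of_pexp hp hp3 (Real.rpow_nonneg (hV0 x) p) hx).trans (le_of_eq ?_)
    ring
  have i1 : Integrable (fun x => pexp p (-(V x ^ p)) +
      (p - 2) * (V x ^ p * pexp p (-(V x ^ p)))) μ := hρ.add (hVρ.const_mul _)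
  have i2 : Integrable (fun x => g x + (p - 2) * (V x ^ p * g x)) μ := hg.add (hVg.const_mul _)
  have i3 := (i1.const_mul (p - 2)).add (i2.const_mul (3 - p))
  have i4 : Integrable (fun x => |g x| ^ (3 - p)) μ := by
    refine i3.mono' (hg.1.aemeasurable.abs.pow_const _).aestronglyMeasurable ?_
    filter_upwards [hle] with x hx
    rw [Real.norm_of_nonneg (Real.rpow_nonneg (abs_nonneg _) _)]
    exact hx
  refine ⟨i4, ?_⟩
  have h := integral_mono_ae i4 i3 hle
  simp only [Pi.add_apply] at h
  rw [integral_add (i1.const_mul _) (i2.const_mul _), integral_const_mul, integral_const_mul,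
    integral_add hρ (hVρ.const_mul _), integral_add hg (hVg.const_mul _), integral_const_mul,
    integral_const_mul] at h
  rw [div_le_iff₀ hp']
  refine h.trans (le_of_eq ?_)
  field_simp
  ring

theorem momentRate_div_eq_of_two_lt (hpq : p.HolderConjugate q) (hp3 : p < 3) {l : ℝ}
    (hl : 0 ≤ l) : momentRate p q p l / (2 * p - 3) =
      p ^ (q + 1) / (q * (3 - p) ^ (q - 1) * (2 * p - 3)) * l ^ q := by
  have hp0 := hpq.pos
  have hq0 := hpq.symm.pos
  have h3 : 0 < 3 - p := by linarith
  have e1 : p ^ (1 - q) = p * (p ^ q)⁻¹ := by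
    rw [Real.rpow_sub hp0, Real.rpow_one, div_eq_mul_inv]
  have e2 : (3 - p) ^ (1 - q) = ((3 - p) ^ (q - 1))⁻¹ := by
    rw [← neg_sub q 1, Real.rpow_neg h3.le]
  rw [momentRate, Real.mul_rpow (by positivity) hl, Real.mul_rpow hp0.le hp0.le,
    Real.mul_rpow hp0.le h3.le, e1, e2, Real.rpow_add_one hp0.ne']
  have : 0 < p ^ q := by positivity
  have : 0 < (3 - p) ^ (q - 1) := by positivity
  field_simp

variable [ProperSpace X] [IsLocallyFiniteMeasure μ]

/-- Moment and entropy bounds for `p > 2`. The left-hand side of `hS` is the initial value of the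
functional of `IsHeatFlow.moment_sub_le` plus the constants of `integral_rpow_le_of_two_lt`. -/
theorem IsHeatFlow.moment_le_of_two_lt (hpq : p.HolderConjugate q) (hp : 2 < p)
    (hp3 : p < 3) (hV : LipschitzWith L V) (hV0 : ∀ x, 0 ≤ V x)
    (hρ : Integrable (fun x => pexp p (-(V x ^ p))) μ)
    (hVρ : Integrable (fun x => V x ^ p * pexp p (-(V x ^ p))) μ)
    (x₀ : X) (hf : IsHeatFlow q μ f)
    (hf0 : ∀ s, 0 ≤ s → ∀ᵐ x ∂μ, 0 ≤ f s x)
    (hi : ∀ s, 0 ≤ s → Integrable (f s) μ) (hm : ∀ s, 0 ≤ s → ∫ x, f s x ∂μ = ∫ x, f 0 x ∂μ)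
    (hVf : Integrable (fun x => V x ^ p * f 0 x) μ) {S : ℝ}
    (hS : p * (∫ x, V x ^ p * f 0 x ∂μ) - (∫ x, |f 0 x| ^ (3 - p) ∂μ) / (p - 2) +
      (∫ x, pexp p (-(V x ^ p)) ∂μ + (p - 2) * (∫ x, V x ^ p * pexp p (-(V x ^ p)) ∂μ) +
        ((∫ x, f 0 x ∂μ) / (p - 2) - ∫ x, f 0 x ∂μ)) ≤ S) {t : ℝ} (ht : 0 ≤ t) :
    0 ≤ S ∧ Integrable (fun x => V x ^ p * f t x) μ ∧
      ∫ x, V x ^ p * f t x ∂μ ≤ Real.exp (momentRate p q p L / (2 * p - 3) * t) * S ∧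
      ∫⁻ s in Ioc 0 t, fisher p q μ (f s) ≤
        ENNReal.ofReal (1 / (3 - p) * (S + (3 - p) * ∫ x, V x ^ p * f t x ∂μ)) := by
  have hp0 := hpq.pos
  have h2p : 1 < 2 * p - 3 := by linarith
  obtain ⟨A, κ, hκ, hA⟩ := hf.exists_integral_rpow_mul_le hpq hp hp3 hV hV0 hρ hVρ hf0 hi hVf
  have hVf' := fun s hs => (hA s hs).1
  have hEs := fun s (hs : 0 ≤ s) =>
    integral_rpow_le_of_two_lt hp hp3 hV0 hρ hVρ (hf0 s hs) (hi s hs) (hVf' s hs)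
  have hE := fun s hs => (hEs s hs).1
  have hM0 : ∀ s, 0 ≤ s → 0 ≤ ∫ x, V x ^ p * f s x ∂μ := fun s hs =>
    integral_nonneg_of_ae ((hf0 s hs).mono fun x hx => mul_nonneg (Real.rpow_nonneg (hV0 x) _) hx)
  set y : ℝ → ℝ := fun s => ∫ x, V x ^ p * f (max s 0) x ∂μ with hydef
  have hys : ∀ s, 0 ≤ s → y s = ∫ x, V x ^ p * f s x ∂μ := fun s hs => by
    simp only [hydef, max_eq_left hs]
  have hym : Measurable y := measurable_moment hV hV0 hp0 x₀ hf hVf'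
  have hyb : ∀ s ∈ Icc 0 t, |y s| ≤ Real.exp (κ * t) * A := fun s hs => by
    rw [hys s hs.1, abs_of_nonneg (hM0 s hs.1)]
    refine (hA s hs.1).2.trans ?_
    have hA0 : 0 ≤ A := by
      have := (hM0 0 le_rfl).trans (hA 0 le_rfl).2
      simpa using this
    exact mul_le_mul_of_nonneg_right (Real.exp_le_exp.2 (mul_le_mul_of_nonneg_left hs.2 hκ)) hA0
  have hyi : ∀ s ∈ Icc 0 t, IntervalIntegrable y volume 0 s := fun s hs => by
    rw [intervalIntegrable_iff_integrableOn_Ioc_of_le hs.1]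
    refine Measure.integrableOn_of_bounded (M := Real.exp (κ * t) * A) (by simp)
      hym.aestronglyMeasurable ?_
    rw [ae_restrict_iff' measurableSet_Ioc]
    exact ae_of_all _ fun r hr => hyb r ⟨hr.1.le, hr.2.trans hs.2⟩
  set K : ℝ := momentRate p q p L with hK
  have hK0 : 0 ≤ K := momentRate_nonneg hp0.le hp3.le hpq.symm.pos hp0.le (NNReal.coe_nonneg _)
  -- Young's inequality turns the evolution inequality into an integral inequality for the moment
  have hint : ∀ s ∈ Icc 0 t, (2 * p - 3) * y s ≤
      S + K / (2 * p - 3) * ∫ r in (0 : ℝ)..s, (2 * p - 3) * y r := by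
    intro s hs
    have h1 := hf.moment_sub_le hpq hp hp3 hV hV0 x₀ hf0 hi hm hE hVf' hs.1 (hyi s hs)
    have h2 := (hEs s hs.1).2
    rw [hm s hs.1] at h2
    rw [intervalIntegral.integral_const_mul, ← mul_assoc, div_mul_cancel₀ _ (by linarith),
      hys s hs.1]
    change _ ≤ _ + K * ∫ r in (0 : ℝ)..s, y r at h1
    linarith
  have hg := le_exp_mul_of_le_integral (y := fun s => (2 * p - 3) * y s)
    (C := (2 * p - 3) * (Real.exp (κ * t) * A)) (T := t)
    (div_nonneg hK0 (by linarith)) (hym.const_mul _) (fun s hs => by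
      rw [abs_mul, abs_of_pos (by linarith : 0 < 2 * p - 3)]
      exact mul_le_mul_of_nonneg_left (hyb s hs) (by linarith)) hint ⟨ht, le_rfl⟩
  have hMle : ∫ x, V x ^ p * f t x ∂μ ≤ (2 * p - 3) * y t := by
    rw [hys t ht]
    exact le_mul_of_one_le_left (hM0 t ht) h2p.le
  have hS0 : 0 ≤ S := by
    have h1 := hint 0 ⟨le_rfl, ht⟩
    rw [intervalIntegral.integral_same, mul_zero, add_zero, hys 0 le_rfl] at h1
    exact (mul_nonneg (by linarith) (hM0 0 le_rfl)).trans h1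
  refine ⟨hS0, hVf' t ht, hMle.trans hg, ?_⟩
  refine (hf.lintegral_fisher_le_of_two_lt hpq hp hp3 hf0 hi hm hE ht).trans
    (ENNReal.ofReal_le_ofReal (mul_le_mul_of_nonneg_left ?_
      (div_nonneg zero_le_one (by linarith))))
  have h2 := (hEs t ht).2
  rw [hm t ht] at h2
  have h3 := mul_nonneg hp0.le (hM0 0 le_rfl)
  rw [sub_div]
  linarith

end MomentLarge

section Bound

variable {X : Type*} [MeasurableSpace X] {μ : Measure X} {p q : ℝ} {V : X → ℝ}

theorem momentBound_eq {g : X → ℝ} (hg : Integrable g μ)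
    (hgE : Integrable (fun x => g x ^ (3 - p)) μ)
    (hVg : Integrable (fun x => V x ^ p * g x) μ) (L z t : ℝ) :
    momentBound p q μ V L z g t = Real.exp (rateConst p q * L ^ q * t) * (momentI p μ V +
      (1 / (2 - p) * (∫ x, g x ^ (3 - p) ∂μ - ∫ x, g x ∂μ) + (p * ∫ x, V x ^ p * g x ∂μ +
        z⁻¹ * max (1 / (2 - p)) 1 * ∫ x, g x ∂μ))) := by
  have i1 : Integrable (fun x => 1 / (2 - p) * (g x ^ (3 - p) - g x)) μ :=
    (hgE.sub hg).const_mul _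
  have i2 : Integrable (fun x => p * (V x ^ p * g x)) μ := hVg.const_mul _
  have i3 : Integrable (fun x => z⁻¹ * max (1 / (2 - p)) 1 * g x) μ := hg.const_mul _
  have e : ∀ x, 1 / (2 - p) * (g x ^ (3 - p) - g x) +
      (p * V x ^ p + z⁻¹ * max (1 / (2 - p)) 1) * g x = 1 / (2 - p) * (g x ^ (3 - p) - g x) +
        (p * (V x ^ p * g x) + z⁻¹ * max (1 / (2 - p)) 1 * g x) := fun x => by ring
  have i23 : Integrable (fun x => p * (V x ^ p * g x) + z⁻¹ * max (1 / (2 - p)) 1 * g x) μ :=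
    i2.add i3
  rw [momentBound]
  simp only [e]
  rw [integral_add i1 i23, integral_add i2 i3, integral_const_mul, integral_const_mul,
    integral_const_mul, integral_sub hgE hg]

end Bound

end QHeat

end

theorem mainTheorem2 {X : Type*} [MetricSpace X] [ProperSpace X] [MeasurableSpace X]
    [BorelSpace X] (μ : Measure X) [IsLocallyFiniteMeasure μ] [SigmaFinite μ]
    (p q : ℝ) (hpq : p.HolderConjugate q) (hp3 : p < 3) (hp2 : p ≠ 2)
    (V : X → ℝ) (hVlip : ∃ L : ℝ≥0, LipschitzWith L V)
    (hVpos : ∃ ε : ℝ, 0 < ε ∧ ∀ x, ε ≤ V x)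
    (hVlarge : 2 < p →
      (Integrable (fun x => QHeat.pexp p (-(V x ^ p))) μ ∧
        ∫ x, QHeat.pexp p (-(V x ^ p)) ∂μ ≤ 1) ∧
      Integrable (fun x => V x ^ p * QHeat.pexp p (-(V x ^ p))) μ)
    (hVsmall : p < 2 →
      ∃ Φ : ℝ → ℝ≥0∞, Monotone Φ ∧ ∫⁻ x, Φ (-(V x ^ p)) ∂μ ≤ 1) :
    -- mass preservation
    (∀ f : ℝ → Lp ℝ 2 μ, QHeat.IsHeatFlow q μ f → Integrable (f 0) μ →
      ∀ t : ℝ, 0 ≤ t → Integrable (f t) μ ∧ ∫ x, f t x ∂μ = ∫ x, f 0 x ∂μ) ∧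
    -- moment and entropy bounds
    (∀ f : ℝ → Lp ℝ 2 μ, QHeat.IsHeatFlow q μ f →
      (∀ᵐ x ∂μ, 0 ≤ f 0 x) → Integrable (f 0) μ →
      Integrable (fun x => V x ^ p * f 0 x) μ →
      Integrable (fun x => f 0 x ^ (3 - p)) μ ∧
      ∀ L : ℝ≥0, LipschitzWith L V →
      ∀ z : ℝ, 0 < z →
      (p < 2 → z ≤ 1) →
      (2 < p → z * ∫ x, QHeat.pexp p (-(V x ^ p)) ∂μ ≤ ∫ x, f 0 x ∂μ) →
      ∀ t : ℝ, 0 ≤ t →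
        Integrable (fun x => V x ^ p * f t x) μ ∧
        ∫ x, V x ^ p * f t x ∂μ ≤ QHeat.momentBound p q μ V L z (f 0) t ∧
        ∫⁻ s in Ioc 0 t, QHeat.fisher p q μ (f s) ≤
          ENNReal.ofReal (4 / (3 - p) * QHeat.momentBound p q μ V L z (f 0) t)) := by
  obtain ⟨L₀, hL₀⟩ := hVlip
  obtain ⟨ε, hε, hVε⟩ := hVpos
  have hp1 := hpq.lt
  have hV0 : ∀ x, 0 ≤ V x := fun x => hε.le.trans (hVε x)
  have hρ : 2 < p → Integrable (fun x => V x ^ p * QHeat.pexp p (-(V x ^ p))) μ := fun h =>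
    (hVlarge h).2
  refine ⟨fun f hf h0 t ht => ⟨(hf.integral_abs_le hpq.symm.lt h0 ht).1,
    hf.integral_eq hpq hp3 hp2 hL₀ hε hVε hρ h0 ht⟩, fun f hf hf0 h0 hVf => ?_⟩
  have hi := fun s (hs : 0 ≤ s) => (hf.integral_abs_le hpq.symm.lt h0 hs).1
  have hm := fun s (hs : 0 ≤ s) => hf.integral_eq hpq hp3 hp2 hL₀ hε hVε hρ h0 hs
  have hfs := fun s (hs : 0 ≤ s) => hf.nonneg hpq hp3 hp2 hL₀ hε hVε hρ hf0 h0 hs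
  have habs : (fun x => |f 0 x| ^ (3 - p)) =ᵐ[μ] fun x => f 0 x ^ (3 - p) :=
    hf0.mono fun x hx => by simp only [abs_of_nonneg hx]
  have hE : Integrable (fun x => f 0 x ^ (3 - p)) μ := by
    refine Integrable.congr ?_ habs
    rcases lt_or_gt_of_ne hp2 with hp | hp
    · exact QHeat.integrable_rpow_of_lt_two (by linarith) (by linarith) h0 (Lp.memLp (f 0))
    · exact (QHeat.integral_rpow_le_of_two_lt hp hp3 hV0 (hVlarge hp).1.1 (hVlarge hp).2 hf0 h0
        hVf).1
  refine ⟨hE, fun L hL z hz hz1 hz2 t ht => ?_⟩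
  rw [QHeat.momentBound_eq h0 hE hVf]
  set m := ∫ x, f 0 x ∂μ with hmdef
  set M₀ := ∫ x, V x ^ p * f 0 x ∂μ with hM₀def
  set E := ∫ x, f 0 x ^ (3 - p) ∂μ with hEdef
  have hm0 : 0 ≤ m := integral_nonneg_of_ae hf0
  have hM₀ : 0 ≤ M₀ := integral_nonneg_of_ae (hf0.mono fun x hx =>
    mul_nonneg (Real.rpow_nonneg (hV0 x) _) hx)
  have hE0 : 0 ≤ E := integral_nonneg_of_ae (hf0.mono fun x hx => Real.rpow_nonneg hx _)
  have h3 : 0 < 3 - p := by linarith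
  have hq0 := hpq.symm.pos
  -- the truncations of `V` need a centre `x₀`
  rcases isEmpty_or_nonempty X with hX | ⟨⟨x₀⟩⟩
  · have hμ : μ = 0 := Measure.eq_zero_of_isEmpty μ
    refine ⟨hi t ht |>.congr (ae_of_all _ fun x => isEmptyElim x), ?_, ?_⟩
    · have hI : QHeat.momentI p μ V = 0 := by simp [QHeat.momentI, integral_of_isEmpty]
      simp only [hI, hmdef, hM₀def, hEdef, integral_of_isEmpty, mul_zero, add_zero, sub_zero,
        le_refl]
    · simp [QHeat.fisher, lintegral_of_isEmpty]
  rcases lt_or_gt_of_ne hp2 with hp | hp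
  · have hp' : 0 < 2 - p := by linarith
    have h1 := hf.integral_rpow_mul_le_of_lt_two hpq hp hL hV0 hfs h0 hVf x₀ ht
    have h2 := hf.lintegral_fisher_le_of_lt_two hpq hp hf0 h0 t
    rw [QHeat.momentI, if_pos hp, QHeat.rateConst, if_pos hp, zero_add]
    -- the bound `z ≤ 1` makes the last term of `S_t` compensate `-∫ f₀ / (2 - p)`
    have hz' : m / (2 - p) ≤ z⁻¹ * max (1 / (2 - p)) 1 * m := by
      have h4 : 1 ≤ z⁻¹ := (one_le_inv₀ hz).2 (hz1 hp)
      have h5 : 1 / (2 - p) ≤ z⁻¹ * max (1 / (2 - p)) 1 :=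
        (le_max_left _ _).trans (le_mul_of_one_le_left (by positivity) h4)
      have := mul_le_mul_of_nonneg_right h5 hm0
      rwa [one_div_mul_eq_div] at this
    have hS : E / (2 - p) + p * M₀ ≤ 1 / (2 - p) * (E - m) +
        (p * M₀ + z⁻¹ * max (1 / (2 - p)) 1 * m) := by
      rw [one_div_mul_eq_div, sub_div]; linarith
    have hEp : 0 ≤ E / (2 - p) := by positivity
    have hpM : 0 ≤ p * M₀ := mul_nonneg hpq.pos.le hM₀
    refine ⟨h1.1, h1.2.trans (mul_le_mul_of_nonneg_left hS (Real.exp_pos _).le),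
      h2.trans (ENNReal.ofReal_le_ofReal ?_)⟩
    have hexp : 1 ≤ Real.exp ((p / (3 - p)) ^ q / q * (L : ℝ) ^ q * t) := by
      have : 0 ≤ p / (3 - p) := div_nonneg hpq.pos.le h3.le
      exact Real.one_le_exp (by positivity)
    have h6 := le_mul_of_one_le_left (by linarith : 0 ≤ 1 / (2 - p) * (E - m) +
        (p * M₀ + z⁻¹ * max (1 / (2 - p)) 1 * m)) hexp
    exact mul_le_mul (div_le_div_of_nonneg_right (by norm_num) h3.le) (by linarith) hEp
      (by positivity)
  · have hp' : 0 < p - 2 := by linarith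
    obtain ⟨⟨hρ1, -⟩, hVρ⟩ := hVlarge hp
    set J := ∫ x, V x ^ p * QHeat.pexp p (-(V x ^ p)) ∂μ with hJ
    have hJ0 : 0 ≤ J := integral_nonneg fun x => mul_nonneg (Real.rpow_nonneg (hV0 x) _)
      (QHeat.pexp_neg_pos hp (Real.rpow_nonneg (hV0 x) _)).le
    have hl : max (1 / (2 - p)) 1 = 1 := max_eq_right
      ((div_nonpos_of_nonneg_of_nonpos zero_le_one (by linarith)).trans zero_le_one)
    rw [QHeat.momentI, if_neg hp.not_gt, hl, mul_one]
    have e1 : 1 / (2 - p) * (E - m) = m / (p - 2) - E / (p - 2) := by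
      rw [show 2 - p = -(p - 2) by ring]
      field_simp
      ring
    rw [e1]
    set S := (p - 2) / (3 - p) * J + (m / (p - 2) - E / (p - 2) + (p * M₀ + z⁻¹ * m)) with hS
    -- the condition on `z` lets the last term of `S_t` bound the mass of `pexp p (-V ^ p)`
    have hzm : ∫ x, QHeat.pexp p (-(V x ^ p)) ∂μ ≤ z⁻¹ * m := by
      rw [le_inv_mul_iff₀ hz]; exact hz2 hp
    have hJle : (p - 2) * J ≤ (p - 2) / (3 - p) * J :=
      mul_le_mul_of_nonneg_right (le_div_self hp'.le h3 (by linarith)) hJ0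
    obtain ⟨hS0, k1, k2, k3⟩ := hf.moment_le_of_two_lt (S := S) hpq hp hp3 hL hV0 hρ1 hVρ x₀ hfs hi
      hm hVf (by
        rw [integral_congr_ae habs]
        linarith) ht
    have hrate : QHeat.momentRate p q p L / (2 * p - 3) ≤ QHeat.rateConst p q * (L : ℝ) ^ q := by
      rw [QHeat.momentRate_div_eq_of_two_lt hpq hp3 (NNReal.coe_nonneg L), QHeat.rateConst,
        if_neg hp.not_gt]
      exact mul_le_mul_of_nonneg_right (le_max_right _ _) (by positivity)
    have hrate0 : 0 ≤ QHeat.momentRate p q p L / (2 * p - 3) :=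
      div_nonneg (QHeat.momentRate_nonneg hpq.pos.le hp3.le hq0 hpq.pos.le (NNReal.coe_nonneg L))
        (by linarith)
    have hbound : ∫ x, V x ^ p * f t x ∂μ ≤ Real.exp (QHeat.rateConst p q * (L : ℝ) ^ q * t) * S :=
      k2.trans (mul_le_mul_of_nonneg_right (Real.exp_le_exp.2
        (mul_le_mul_of_nonneg_right hrate ht)) hS0)
    refine ⟨k1, hbound, k3.trans (ENNReal.ofReal_le_ofReal ?_)⟩
    have hSt : S ≤ Real.exp (QHeat.rateConst p q * (L : ℝ) ^ q * t) * S :=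
      le_mul_of_one_le_left hS0 (Real.one_le_exp (mul_nonneg (hrate0.trans hrate) ht))
    set St := Real.exp (QHeat.rateConst p q * (L : ℝ) ^ q * t) * S
    have hSt0 : 0 ≤ St := hS0.trans hSt
    have h7 : (3 - p) * ∫ x, V x ^ p * f t x ∂μ ≤ St :=
      (mul_le_mul_of_nonneg_left hbound h3.le).trans (mul_le_of_le_one_left hSt0 (by linarith))
    rw [one_div_mul_eq_div, div_mul_eq_mul_div]
    exact div_le_div_of_nonneg_right (by linarith) h3.le
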